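/- **Conventions.** Let $m>0$, $E_p=\sqrt{|\vec p\,|^2+m^2}$. For functions on $\mathbb{R}^3$ put $\hat f(\vec p\,)=\int e^{i\vec p\cdot\vec x}f(\vec x\,)\,d^3x$, $(\mathsf F^{-1}f)(\vec x\,)=(2\pi)^{-3}\int e^{-i\vec p\cdot\vec x}f(\vec p\,)\,d^3p$ and $\rho^\vee(\vec x\,)=\rho(-\vec x\,)$. A *suitable mollifier* is a real Schwartz function $\rho$ on $\mathbb{R}^3$ such that $\hat\rho$ has compact support and $\hat\rho\equiv1$ near $0$; the set of these is $\mathcal A_\infty$. A *suitable damper* is a real, compactly supported $C^\infty$ function $\hat\chi$ on $\mathbb{R}^3$ with $\hat\chi\equiv1$ near $0$; put $\chi=\mathsf F^{-1}\hat\chi$. **States.** $\mathbb D$ is the space of sequences $(f_n)_{n\ge0}$ with $f_n=0$ for large $n$, where $f_n(\xi_1,\dots,\xi_n)$, $\xi_j=(t_{\xi_j},\vec\xi_j)\in\mathbb{R}\times\mathbb{R}^3$, is a complex $C^\infty$ function, symmetric in the $\xi_j$, that is, with all its derivatives, square-integrable in $(\vec\xi_1,\dots,\vec\xi_n)$ at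 all fixed times. For $\epsilon>0$ and a time $t_\xi$ let $$\langle f\|g\rangle=i\int \bigl(f^*\,\partial_{t}g-\partial_{t}f^*\,g\bigr)(t_\xi,\vec\xi\,)\,\hat\chi(\epsilon\vec\xi\,)\,d^3\xi .$$ For a one-particle function $\psi$, the operators $\mathbf a^\pm(\psi)$ are given by $(\mathbf a^+(\psi)f)_0=0$, $(\mathbf a^+(\psi)f)_n=\sqrt n\,\mathrm{Sym}\bigl(\psi(\xi_n)f_{n-1}(\xi_1,\dots,\xi_{n-1})\bigr)$ for $n\ge 1$, where $\mathrm{Sym}$ is the average over all permutations of the variables, and $(\mathbf a^-(\psi)f)_n=\sqrt{n+1}\,\langle\psi(\xi_{n+1})\|f_{n+1}(\xi_1,\dots,\xi_{n+1})\rangle$ (product taken in $\xi_{n+1}$). **Fields.** Let $\rho\in\mathcal A_\infty$, let $\hat\chi$ be a suitable damper, and for $x=(t,\vec x\,)$ let $$\Delta_\epsilon(x)=\frac1{(2\pi)^3}\int\frac{d^3p}{2E_p}\,\hat\rho(\epsilon\vec p\,)\,e^{i(\vec p\cdot\vec x-E_pt)},$$ $$\phi_0(\rho_\epsilon,x)=\mathbf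 a^+\bigl(\xi\mapsto\Delta_\epsilon(\xi-x)\bigr)+\mathbf a^-\bigl(\xi\mapsto\Delta_\epsilon(\xi-x)\bigr),$$ $$\pi_0(\rho_\epsilon,x)=\mathbf a^+\bigl(\xi\mapsto\partial_t\Delta_\epsilon(\xi-x)\bigr)+\mathbf a^-\bigl(\xi\mapsto\partial_t\Delta_\epsilon(\xi-x)\bigr).$$ **Proposition.** For every $\epsilon>0$ the operators $\phi_0(\rho_\epsilon,x)$, $\pi_0(\rho_\epsilon,x)$ are linear maps $\mathbb D\to\mathbb D$, with $\pi_0=\partial_t\phi_0$ (pointwise on every component of every state of $\mathbb D$), and: (A) for every $\epsilon>0$, at equal times $t_1=t_2=t_\xi$ and for all $\vec x_1,\vec x_2\in\mathbb{R}^3$, $$[\phi_0(\rho_\epsilon,x_1),\phi_0(\rho_\epsilon,x_2)]=0,\qquad[\pi_0(\rho_\epsilon,x_1),\pi_0(\rho_\epsilon,x_2)]=0,$$ $$[\phi_0(\rho_\epsilon,x_1),\pi_0(\rho_\epsilon,x_2)]=i\,\delta^3(\rho_\epsilon,\chi_\epsilon,\vec x_1,\vec x_2)\,\mathbf 1$$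 exactly on $\mathbb D$, where the following function is real: $$\delta^3(\rho_\epsilon,\chi_\epsilon,\vec x_1,\vec x_2)=\int d^3p_1\,\hat\rho^*(\epsilon\vec p_1)\int d^3p_2\,\hat\rho(\epsilon\vec p_2)\,\frac{1}{(2\pi)^3}\,\frac{E_{p_1}+E_{p_2}}{2E_{p_1}}\,e^{i(\vec p_1\cdot\vec x_1-\vec p_2\cdot\vec x_2)}\,\frac1{\epsilon^3}\,\chi\Bigl(\frac{\vec p_1-\vec p_2}{\epsilon}\Bigr).$$ (B) $\rho^\vee*\rho\in\mathcal A_\infty$, and $$[\phi_0(\rho_\epsilon,x_1),\pi_0(\rho_\epsilon,x_2)]\Big|_{t_1=t_2=t_\xi}=i\,\Bigl(\frac1{\epsilon^3}(\rho^\vee*\rho)\Bigl(\frac{\vec x_1-\vec x_2}{\epsilon}\Bigr)+R_\epsilon(\vec x_1,\vec x_2)\Bigr)\mathbf 1,$$ i.e. $\delta^3(\rho_\epsilon,\chi_\epsilon,\vec x_1,\vec x_2)=\epsilon^{-3}(\rho^\vee*\rho)((\vec x_1-\vec x_2)/\epsilon)+R_\epsilon(\vec x_1,\vec x_2)$, with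 a real remainder $R_\epsilon=O(\epsilon^{q-1})$ for every $q\in\mathbb N$, uniformly on compact sets: for every $q\in\mathbb N$ and every compact $K\subset\mathbb{R}^3$ there are $C,\eta>0$ with $|R_\epsilon(\vec x_1,\vec x_2)|\le C\epsilon^{q-1}$ for all $0<\epsilon<\eta$ and $\vec x_1,\vec x_2\in K$. -/

import Mathlib

open MeasureTheory Filter Topology
open scoped ContDiff SchwartzMap ComplexConjugate

noncomputable section

namespace FreeFieldCCR

/-- Euclidean three-space. -/
abbrev Space : Type := EuclideanSpace ℝ (Fin 3)

/-- Space-time points `(t, x)`. -/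
abbrev Spacetime : Type := ℝ × Space

/-! ### Fourier transformation, mollifiers and dampers -/

/-- Fourier transform with the normalization `(F f)(p) = ∫ exp(i p·x) f(x) d³x`. -/
def fourier (f : Space → ℂ) (p : Space) : ℂ :=
  ∫ x : Space, Complex.exp (Complex.I * ((inner ℝ p x : ℝ) : ℂ)) * f x

/-- Inverse transform `(F⁻¹ f)(x) = (2π)⁻³ ∫ exp(-i p·x) f(p) d³p`. -/
def invFourier (f : Space → ℂ) (x : Space) : ℂ :=
  (((2 * Real.pi) ^ 3)⁻¹ : ℝ) *
    ∫ p : Space, Complex.exp (-(Complex.I * ((inner ℝ p x : ℝ) : ℂ))) * f p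

/-- Fourier transform of a real function. -/
def rfourier (ρ : Space → ℝ) : Space → ℂ := fourier fun x => (ρ x : ℂ)

/-- Suitable mollifiers: real Schwartz functions whose Fourier transform has compact support
and is identically one near the origin. -/
structure IsSuitableMollifier (ρ : Space → ℝ) : Prop where
  schwartz : ∃ s : 𝓢(Space, ℝ), ⇑s = ρ
  eq_one : ∀ᶠ p in 𝓝 (0 : Space), rfourier ρ p = 1
  compact : HasCompactSupport (rfourier ρ)

/-- Suitable dampers: real smooth functions of compact support, identically one near the
origin. -/
structure IsSuitableDamper (χh : Space → ℝ) : Prop where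
  smooth : ContDiff ℝ ∞ χh
  compact : HasCompactSupport χh
  eq_one : ∀ᶠ x in 𝓝 (0 : Space), χh x = 1

/-- `ρ^∨ ∗ ρ`, where `ρ^∨(x) = ρ(-x)`. -/
def autoconv (ρ : Space → ℝ) : Space → ℝ :=
  convolution (fun x => ρ (-x)) ρ (ContinuousLinearMap.mul ℝ ℝ) volume

/-! ### Fock space: states with a finite number of particles -/

/-- Sequences `(f₀, f₁, f₂, …)`, where `fₙ` is a complex function of `n` space-time points. -/
abbrev FockSeq : Type := ∀ n : ℕ, (Fin n → Spacetime) → ℂ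

/-- Wave functions of `n` particles: symmetric smooth functions of `ξ₁, …, ξₙ` which, together
with all their derivatives, are square-integrable in the space variables at all fixed times. -/
structure IsWaveFunction {n : ℕ} (f : (Fin n → Spacetime) → ℂ) : Prop where
  symm : ∀ (σ : Equiv.Perm (Fin n)) (ξ : Fin n → Spacetime), f (fun j => ξ (σ j)) = f ξ
  smooth : ContDiff ℝ ∞ f
  square_integrable : ∀ (k : ℕ) (τ : Fin n → ℝ),
    MemLp (fun x : Fin n → Space => ‖iteratedFDeriv ℝ k f (fun j => (τ j, x j))‖) 2 volume

theorem continuous_norm_iteratedFDeriv {n : ℕ} {f : (Fin n → Spacetime) → ℂ}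
    (hf : ContDiff ℝ ∞ f) (k : ℕ) (τ : Fin n → ℝ) :
    Continuous fun x : Fin n → Space => ‖iteratedFDeriv ℝ k f (fun j => (τ j, x j))‖ := by
  have h : Continuous (iteratedFDeriv ℝ k f) :=
    hf.continuous_iteratedFDeriv (by exact_mod_cast le_top)
  exact (h.comp (by fun_prop : Continuous fun x : Fin n → Space => fun j => (τ j, x j))).norm

theorem IsWaveFunction.zero {n : ℕ} : IsWaveFunction (0 : (Fin n → Spacetime) → ℂ) where
  symm _ _ := rfl
  smooth := contDiff_const
  square_integrable k τ := by
    have h : iteratedFDeriv ℝ k (0 : (Fin n → Spacetime) → ℂ) = 0 := iteratedFDeriv_fun_zero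
    simp [h]

theorem IsWaveFunction.add {n : ℕ} {f g : (Fin n → Spacetime) → ℂ}
    (hf : IsWaveFunction f) (hg : IsWaveFunction g) : IsWaveFunction (f + g) where
  symm σ ξ := by simp only [Pi.add_apply, hf.symm σ ξ, hg.symm σ ξ]
  smooth := hf.smooth.add hg.smooth
  square_integrable k τ := by
    refine MemLp.mono ((hf.square_integrable k τ).add (hg.square_integrable k τ))
      (continuous_norm_iteratedFDeriv (hf.smooth.add hg.smooth) k τ).aestronglyMeasurable
      (Eventually.of_forall fun x => ?_)
    rw [iteratedFDeriv_add_apply (hf.smooth.contDiffAt.of_le (by exact_mod_cast le_top))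
      (hg.smooth.contDiffAt.of_le (by exact_mod_cast le_top)), norm_norm, Pi.add_apply]
    exact (norm_add_le _ _).trans (le_abs_self _)

theorem IsWaveFunction.smul {n : ℕ} {f : (Fin n → Spacetime) → ℂ} (c : ℂ)
    (hf : IsWaveFunction f) : IsWaveFunction (c • f) where
  symm σ ξ := by simp only [Pi.smul_apply, hf.symm σ ξ]
  smooth := hf.smooth.const_smul c
  square_integrable k τ := by
    refine MemLp.mono ((hf.square_integrable k τ).const_mul ‖c‖)
      (continuous_norm_iteratedFDeriv (hf.smooth.const_smul c) k τ).aestronglyMeasurable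
      (Eventually.of_forall fun x => ?_)
    rw [iteratedFDeriv_const_smul_apply (hf.smooth.contDiffAt.of_le (by exact_mod_cast le_top)),
      norm_norm, norm_smul]
    exact le_abs_self _

/-- The space `𝔻` of states with a finite number of particles. -/
def FiniteParticle : Submodule ℂ FockSeq where
  carrier := {Φ | (∃ N : ℕ, ∀ n ≥ N, Φ n = 0) ∧ ∀ n, IsWaveFunction (Φ n)}
  zero_mem' := ⟨⟨0, fun _ _ => rfl⟩, fun _ => IsWaveFunction.zero⟩
  add_mem' := by
    rintro Φ Ψ ⟨⟨N, hN⟩, hΦ⟩ ⟨⟨M, hM⟩, hΨ⟩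
    refine ⟨⟨max N M, fun n hn => ?_⟩, fun n => (hΦ n).add (hΨ n)⟩
    rw [Pi.add_apply, hN n (le_trans (le_max_left _ _) hn),
      hM n (le_trans (le_max_right _ _) hn), add_zero]
  smul_mem' := by
    rintro c Φ ⟨⟨N, hN⟩, hΦ⟩
    refine ⟨⟨N, fun n hn => ?_⟩, fun n => (hΦ n).smul c⟩
    rw [Pi.smul_apply, hN n hn, smul_zero]

/-- The symmetrization operator. -/
def sym {n : ℕ} (f : (Fin n → Spacetime) → ℂ) (ξ : Fin n → Spacetime) : ℂ :=
  ((n.factorial : ℂ))⁻¹ * ∑ σ : Equiv.Perm (Fin n), f (fun j => ξ (σ j))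

/-- The one-particle scalar product at time `tξ`, regularized by the damper `χh`:
`i ∫ (f* ∂ₜg - ∂ₜf* g)(tξ, x) χh(ε x) d³x`. -/
def dampedProduct (χh : Space → ℝ) (ε tξ : ℝ) (f g : Spacetime → ℂ) : ℂ :=
  Complex.I * ∫ x : Space,
    (conj (f (tξ, x)) * deriv (fun s : ℝ => g (s, x)) tξ
      - deriv (fun s : ℝ => conj (f (s, x))) tξ * g (tξ, x)) * ((χh (ε • x) : ℝ) : ℂ)

/-- Creation: `(a⁺(ψ)Φ)₀ = 0` and `(a⁺(ψ)Φ)ₙ = √n Sym(ψ(ξₙ) ⊗ fₙ₋₁)`. -/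
def creation (ψ : Spacetime → ℂ) (Φ : FockSeq) : FockSeq
  | 0 => 0
  | n + 1 => fun ξ => (Real.sqrt ((n : ℝ) + 1) : ℂ) *
      sym (fun ζ : Fin (n + 1) → Spacetime =>
        ψ (ζ (Fin.last n)) * Φ n (fun j => ζ j.castSucc)) ξ

/-- Annihilation: `(a⁻(ψ)Φ)ₙ = √(n+1) ⟨ψ(ξₙ₊₁) ‖ fₙ₊₁(ξ₁, …, ξₙ₊₁)⟩`, where the damped scalar
product at time `tξ` is taken in the last variable. -/
def annihilation (χh : Space → ℝ) (ε tξ : ℝ) (ψ : Spacetime → ℂ) (Φ : FockSeq) : FockSeq :=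
  fun n ξ => (Real.sqrt ((n : ℝ) + 1) : ℂ) *
    dampedProduct χh ε tξ ψ
      (fun ζ => Φ (n + 1) (Fin.snoc (α := fun _ => Spacetime) ξ ζ))

/-! ### The mollified free field -/

/-- `E_p = √(|p|² + m²)`. -/
def energy (m : ℝ) (p : Space) : ℝ := Real.sqrt (‖p‖ ^ 2 + m ^ 2)

/-- `Δ_ε(z) = (2π)⁻³ ∫ d³p / (2 E_p) ρ̂(ε p) exp i(p·z - E_p t)` at `z = (t, z)`. -/
def Delta (m : ℝ) (ρ : Space → ℝ) (ε : ℝ) (z : Spacetime) : ℂ :=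
  (((2 * Real.pi) ^ 3)⁻¹ : ℝ) * ∫ p : Space,
    ((2 * energy m p : ℝ) : ℂ)⁻¹ * rfourier ρ (ε • p) *
      Complex.exp (Complex.I * ((inner ℝ p z.2 - energy m p * z.1 : ℝ) : ℂ))

/-- The one-particle state function `ξ ↦ Δ_ε(ξ - x)` with parameter `x = (t, x)`. -/
def stateFn (m : ℝ) (ρ : Space → ℝ) (ε t : ℝ) (x : Space) (ξ : Spacetime) : ℂ :=
  Delta m ρ ε (ξ - (t, x))

/-- The derivative of the state function with respect to the time `t` of its parameter. -/
def stateFnDot (m : ℝ) (ρ : Space → ℝ) (ε t : ℝ) (x : Space) (ξ : Spacetime) : ℂ :=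
  deriv (fun s : ℝ => stateFn m ρ ε s x ξ) t

/-- The mollified free field `φ₀(ρ_ε, t, x) = a⁺(Δ_ε(ξ - x)) + a⁻(Δ_ε(ξ - x))`. -/
def freeField (m : ℝ) (ρ χh : Space → ℝ) (ε tξ t : ℝ) (x : Space) (Φ : FockSeq) : FockSeq :=
  creation (stateFn m ρ ε t x) Φ + annihilation χh ε tξ (stateFn m ρ ε t x) Φ

/-- The conjugate field `π₀(ρ_ε, t, x) = a⁺(∂ₜ Δ_ε(ξ - x)) + a⁻(∂ₜ Δ_ε(ξ - x))`. -/
def conjField (m : ℝ) (ρ χh : Space → ℝ) (ε tξ t : ℝ) (x : Space) (Φ : FockSeq) : FockSeq :=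
  creation (stateFnDot m ρ ε t x) Φ + annihilation χh ε tξ (stateFnDot m ρ ε t x) Φ

/-- The function `δ³(ρ_ε, χ_ε, x₁, x₂)` replacing the Dirac `δ`-function; `χ = F⁻¹ χh`. -/
def deltaG (m : ℝ) (ρ χh : Space → ℝ) (ε : ℝ) (x₁ x₂ : Space) : ℂ :=
  ∫ p₁ : Space, conj (rfourier ρ (ε • p₁)) * ∫ p₂ : Space, rfourier ρ (ε • p₂) *
    ((((2 * Real.pi) ^ 3)⁻¹ * ((energy m p₁ + energy m p₂) / (2 * energy m p₁)) : ℝ) : ℂ) *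
    Complex.exp (Complex.I * ((inner ℝ p₁ x₁ - inner ℝ p₂ x₂ : ℝ) : ℂ)) *
    (((ε ^ 3)⁻¹ : ℝ) : ℂ) * invFourier (fun x => (χh x : ℂ)) (ε⁻¹ • (p₁ - p₂))

end FreeFieldCCR

end

open FreeFieldCCR

/-!
The argument has three parts.

*Algebra of the field operators.* Symmetrizing one factor of a tensor product first does not
change the symmetrization of the product (`sym_mul_sym`), so creation operators commute
(`creation_comm`). The damped scalar products in two different variables commute by Fubini's
theorem and the symmetry of second derivatives, so annihilation operators commute
(`annihilation_comm`). On symmetric wave functions creation is a sum over the position of the new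
particle (`creation_succ_apply`); when it is followed by annihilation, the term in which the new
particle is contracted gives the scalar product of the two one-particle functions, and the other
terms are the product in the opposite order (`annihilation_creation`). Hence every commutator of
two fields `a⁺(ψ) + a⁻(ψ)` is the number `⟨ψ₁‖ψ₂⟩ - ⟨ψ₂‖ψ₁⟩` (`fieldEnd_commutator`). The
operators map `𝔻` into itself because the damper has compact support: by the Cauchy–Schwarz
inequality, integrating the last variable against a compactly supported weight keeps
square-integrability of all derivatives in the others.

*The scalar products.* Since `ρ̂` has compact support, the state functions are wave packets
`∫ w(p) exp i(p·x - E_p t) d³p` with smooth compactly supported `w`. At equal times the factors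
`exp(-i E_p t)` disappear, and `Δ_ε` and its time derivatives become, up to factors `±i`, the
functions `shellFn` with the weights `E_p⁻¹, 1, E_p`. These are real, because `ρ` is real and
`E_p` is even; this makes the commutators of equal fields vanish, and writes the commutator of the
field with its conjugate as `i · 2 ∫ D(y) χh(ε y) d³y` for a real density `D`
(`commutatorDensity`). In momentum space this integral is `deltaG` (`deltaG_eq`).

*The remainder.* Without the factor `χh(ε y)`, Plancherel's theorem turns the integral into
`ε⁻³ (ρ^∨ ∗ ρ)((x₁ - x₂) / ε)`: the energies cancel (`integral_commutatorDensity`); `ρ^∨ ∗ ρ` is a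
suitable mollifier because its Fourier transform is `|ρ̂|²`. The remainder is therefore
`2 ∫ D(y) (χh(ε y) - 1) d³y`. Here `|χh(ε y) - 1| ≤ B (ε ‖y‖)^M` for every `M`, because `χh` is
bounded and equal to one near the origin. On the other hand all derivatives of `E_p⁻¹` and of
`p / E_p` are bounded, so each derivative of the weights in momentum space is integrable with a
norm `O(ε⁻⁵)`, and `D` decays faster than every power of `‖y - x₁‖` with constants `O(ε⁻¹⁰)`,
where the exponent does not depend on the power (`exists_commutatorDensity_decay`). Taking
`M = q + 10` gives a remainder `O(ε^q)` for every `q` (`exists_remainder_bound`).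
-/

namespace FreeFieldCCR

/-! ### Integrals depending smoothly on a parameter -/

section ParametricIntegral

variable {H X E : Type} [NormedAddCommGroup H] [NormedSpace ℝ H] [ProperSpace H]
  [NormedAddCommGroup X] [NormedSpace ℝ X] [MeasurableSpace X]
  [BorelSpace X] {μ : Measure X} [IsFiniteMeasureOnCompacts μ]

omit [ProperSpace H] [MeasurableSpace X] [BorelSpace X] in
theorem contDiff_fderiv_slice [NormedAddCommGroup E] [NormedSpace ℝ E] {G : H → X → E}
    (hG : ContDiff ℝ ∞ (Function.uncurry G)) :
    ContDiff ℝ ∞ (Function.uncurry fun z x => fderiv ℝ (fun z' => G z' x) z) := by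
  have h : ContDiff ℝ ∞ (Function.uncurry fun (q : H × X) (z' : H) => G z' q.2) :=
    hG.comp (by fun_prop : ContDiff ℝ ∞ fun r : (H × X) × H => (r.2, r.1.2))
  exact ContDiff.fderiv (m := ∞) (n := ∞) h contDiff_fst (by simp)

omit [NormedSpace ℝ H] [ProperSpace H] [NormedSpace ℝ X] in
theorem integrable_slice [NormedAddCommGroup E] {G : H → X → E}
    (hG : Continuous (Function.uncurry G)) {K : Set X} (hK : IsCompact K)
    (hGK : ∀ z, ∀ x ∉ K, G z x = 0) (z : H) : Integrable (G z) μ :=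
  (hG.comp (by fun_prop : Continuous fun x : X => (z, x))).integrable_of_hasCompactSupport
    (HasCompactSupport.intro hK (hGK z))

omit [ProperSpace H] [MeasurableSpace X] [BorelSpace X]
  [NormedSpace ℝ X] [NormedAddCommGroup X] in
theorem fderiv_slice_eq_zero [NormedAddCommGroup E] [NormedSpace ℝ E] {G : H → X → E} {K : Set X}
    (hGK : ∀ z, ∀ x ∉ K, G z x = 0) (z : H) (x : X) (hx : x ∉ K) :
    fderiv ℝ (fun z' => G z' x) z = 0 := by
  have : (fun z' => G z' x) = fun _ => 0 := funext fun z' => hGK z' x hx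
  simp [this]

/-- Differentiation under the integral sign for jointly smooth integrands supported in a fixed
compact set. -/
theorem hasFDerivAt_integral_of_compact [NormedAddCommGroup E] [NormedSpace ℝ E]
    {G : H → X → E} (hG : ContDiff ℝ ∞ (Function.uncurry G)) {K : Set X} (hK : IsCompact K)
    (hGK : ∀ z, ∀ x ∉ K, G z x = 0) (z : H) :
    HasFDerivAt (fun z => ∫ x, G z x ∂μ) (∫ x, fderiv ℝ (fun z' => G z' x) z ∂μ) z := by
  have hF := contDiff_fderiv_slice hG
  have hcomp : IsCompact (Metric.closedBall z 1 ×ˢ K) := (isCompact_closedBall z 1).prod hK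
  obtain ⟨C, hC⟩ := hcomp.exists_bound_of_continuousOn hF.continuous.continuousOn
  refine hasFDerivAt_integral_of_dominated_of_fderiv_le
    (F := G) (F' := fun z x => fderiv ℝ (fun z' => G z' x) z)
    (bound := K.indicator fun _ => C) (Metric.closedBall_mem_nhds z one_pos)
    (Eventually.of_forall fun y => (integrable_slice hG.continuous hK hGK y).aestronglyMeasurable)
    (integrable_slice hG.continuous hK hGK z)
    (integrable_slice hF.continuous hK (fderiv_slice_eq_zero hGK) z).aestronglyMeasurable
    (Eventually.of_forall fun x y hy => ?_) ?_ (Eventually.of_forall fun x y _ => ?_)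
  · by_cases hx : x ∈ K
    · simpa [hx] using hC (y, x) ⟨hy, hx⟩
    · simp [hx, fderiv_slice_eq_zero hGK y x hx]
  · exact (integrable_indicator_iff hK.measurableSet).2
      (integrableOn_const hK.measure_lt_top.ne)
  · have hd : Differentiable ℝ (fun z' => G z' x) :=
      (hG.comp (by fun_prop : ContDiff ℝ ∞ fun z' : H => (z', x))).differentiable (by simp)
    exact (hd y).hasFDerivAt

theorem fderiv_integral_of_compact [NormedAddCommGroup E] [NormedSpace ℝ E]
    {G : H → X → E} (hG : ContDiff ℝ ∞ (Function.uncurry G)) {K : Set X} (hK : IsCompact K)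
    (hGK : ∀ z, ∀ x ∉ K, G z x = 0) :
    fderiv ℝ (fun z => ∫ x, G z x ∂μ) = fun z => ∫ x, fderiv ℝ (fun z' => G z' x) z ∂μ :=
  funext fun z => (hasFDerivAt_integral_of_compact hG hK hGK z).fderiv

/-- An integral over a compact set of a jointly smooth function is smooth in the parameter. -/
theorem contDiff_integral_of_compact [NormedAddCommGroup E] [NormedSpace ℝ E]
    {G : H → X → E} (hG : ContDiff ℝ ∞ (Function.uncurry G)) {K : Set X} (hK : IsCompact K)
    (hGK : ∀ z, ∀ x ∉ K, G z x = 0) : ContDiff ℝ ∞ (fun z => ∫ x, G z x ∂μ) := by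
  rw [contDiff_infty]
  intro n
  induction n generalizing E with
  | zero =>
    exact contDiff_zero.2 (continuous_iff_continuousAt.2 fun z =>
      (hasFDerivAt_integral_of_compact hG hK hGK z).continuousAt)
  | succ n ih =>
    push_cast
    exact contDiff_succ_iff_hasFDerivAt.2 ⟨_, ih (contDiff_fderiv_slice hG)
      (fderiv_slice_eq_zero hGK), hasFDerivAt_integral_of_compact hG hK hGK⟩

/-- Together with `memLp_two_integral_mul`, this transfers square-integrability of derivatives
through a partial integration. -/
theorem norm_iteratedFDeriv_integral_le [NormedAddCommGroup E] [NormedSpace ℝ E]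
    {G : H → X → E} (hG : ContDiff ℝ ∞ (Function.uncurry G)) {K : Set X} (hK : IsCompact K)
    (hGK : ∀ z, ∀ x ∉ K, G z x = 0) (k : ℕ) (z : H) :
    ‖iteratedFDeriv ℝ k (fun z => ∫ x, G z x ∂μ) z‖
      ≤ ∫ x, ‖iteratedFDeriv ℝ k (fun z' => G z' x) z‖ ∂μ := by
  induction k generalizing E with
  | zero => simpa using norm_integral_le_integral_norm (μ := μ) (G z)
  | succ k ih =>
    simp_rw [← norm_iteratedFDeriv_fderiv]
    rw [fderiv_integral_of_compact hG hK hGK]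
    exact ih (contDiff_fderiv_slice hG) (fderiv_slice_eq_zero hGK)

end ParametricIntegral

section Deriv

variable {P E : Type} [NormedAddCommGroup P] [NormedSpace ℝ P] [NormedAddCommGroup E]
  [NormedSpace ℝ E]

theorem contDiff_deriv_param {F : P → ℝ → E} (hF : ContDiff ℝ ∞ (Function.uncurry F))
    {τ : P → ℝ} (hτ : ContDiff ℝ ∞ τ) : ContDiff ℝ ∞ fun p => deriv (F p) (τ p) := by
  simp_rw [← fderiv_apply_one_eq_deriv]
  exact ContDiff.fderiv_apply (m := ∞) (n := ∞) hF hτ contDiff_const (by simp)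

theorem hasDerivAt_integral_of_compact {X : Type} [NormedAddCommGroup X] [NormedSpace ℝ X]
    [MeasurableSpace X] [BorelSpace X] {μ : Measure X}
    [IsFiniteMeasureOnCompacts μ] [CompleteSpace E] {G : ℝ → X → E}
    (hG : ContDiff ℝ ∞ (Function.uncurry G)) {K : Set X} (hK : IsCompact K)
    (hGK : ∀ z, ∀ x ∉ K, G z x = 0) (s : ℝ) :
    HasDerivAt (fun s => ∫ x, G s x ∂μ) (∫ x, deriv (fun s' => G s' x) s ∂μ) s := by
  have h := (hasFDerivAt_integral_of_compact (μ := μ) hG hK hGK s).hasDerivAt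
  rw [ContinuousLinearMap.integral_apply (integrable_slice (contDiff_fderiv_slice hG).continuous
    hK (fderiv_slice_eq_zero hGK) s)] at h
  simpa only [fderiv_apply_one_eq_deriv] using h

/-- Derivatives in two independent real variables commute. -/
theorem deriv_deriv_comm {F : ℝ → ℝ → E} (hF : ContDiff ℝ ∞ (Function.uncurry F)) (s t : ℝ) :
    deriv (fun s' => deriv (fun t' => F s' t') t) s
      = deriv (fun t' => deriv (fun s' => F s' t') s) t := by
  set f := Function.uncurry F
  have hd : Differentiable ℝ f := hF.differentiable (by simp)
  have hd2 : Differentiable ℝ (fderiv ℝ f) :=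
    (hF.fderiv_right (m := ∞) (by simp)).differentiable (by simp)
  have h1 : ∀ s' t', deriv (fun t' => F s' t') t' = fderiv ℝ f (s', t') (0, 1) := fun s' t' =>
    ((hd (s', t')).hasFDerivAt.comp_hasDerivAt t'
      ((hasDerivAt_const t' s').prodMk (hasDerivAt_id t'))).deriv
  have h2 : ∀ s' t', deriv (fun s' => F s' t') s' = fderiv ℝ f (s', t') (1, 0) := fun s' t' =>
    HasDerivAt.deriv <| (hd (s', t')).hasFDerivAt.comp_hasDerivAt (f := fun s' => (s', t')) s'
      ((hasDerivAt_id s').prodMk (hasDerivAt_const s' t'))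
  have h3 : HasDerivAt (fun s' => fderiv ℝ f (s', t)) (fderiv ℝ (fderiv ℝ f) (s, t) (1, 0)) s :=
    (hd2 (s, t)).hasFDerivAt.comp_hasDerivAt s
      ((hasDerivAt_id s).prodMk (hasDerivAt_const s t))
  have h4 : HasDerivAt (fun t' => fderiv ℝ f (s, t')) (fderiv ℝ (fderiv ℝ f) (s, t) (0, 1)) t :=
    (hd2 (s, t)).hasFDerivAt.comp_hasDerivAt t
      ((hasDerivAt_const t s).prodMk (hasDerivAt_id t))
  simp_rw [h1, h2]
  rw [(h3.clm_apply (hasDerivAt_const s _)).deriv, (h4.clm_apply (hasDerivAt_const t _)).deriv]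
  have hsym : IsSymmSndFDerivAt ℝ f (s, t) := hF.contDiffAt.isSymmSndFDerivAt (by
    simpa using (ENat.LEInfty.out : (2 : WithTop ℕ∞) ≤ ∞))
  simpa using hsym.eq (1, 0) (0, 1)

end Deriv

/-! ### Smooth functions with square-integrable derivatives -/

theorem norm_iteratedFDeriv_comp_clm_le {E F G : Type*} [NormedAddCommGroup E] [NormedSpace ℝ E]
    [NormedAddCommGroup F] [NormedSpace ℝ F] [NormedAddCommGroup G] [NormedSpace ℝ G]
    {f : F → G} (hf : ContDiff ℝ ∞ f) (L : E →L[ℝ] F) (hL : ‖L‖ ≤ 1) (k : ℕ) (x : E) :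
    ‖iteratedFDeriv ℝ k (fun y => f (L y)) x‖ ≤ ‖iteratedFDeriv ℝ k f (L x)‖ := by
  have h := L.iteratedFDeriv_comp_right hf x (i := k) (by exact_mod_cast le_top)
  change iteratedFDeriv ℝ k (fun y => f (L y)) x = _ at h
  rw [h]
  refine (ContinuousMultilinearMap.norm_compContinuousLinearMap_le _ _).trans ?_
  have : ∏ _i : Fin k, ‖L‖ ≤ 1 := Finset.prod_le_one (fun _ _ => norm_nonneg _) fun _ _ => hL
  exact mul_le_of_le_one_right (norm_nonneg _) this

/-- Smooth functions of `n` space-time points that are, with all their derivatives,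
square-integrable in the space variables at fixed times: wave functions without symmetry. -/
structure HasL2Derivs {n : ℕ} (f : (Fin n → Spacetime) → ℂ) : Prop where
  smooth : ContDiff ℝ ∞ f
  square_integrable : ∀ (k : ℕ) (τ : Fin n → ℝ),
    MemLp (fun x : Fin n → Space => ‖iteratedFDeriv ℝ k f (fun j => (τ j, x j))‖) 2 volume

/-- The one-particle version of `HasL2Derivs`. -/
structure IsOneParticle (ψ : Spacetime → ℂ) : Prop where
  smooth : ContDiff ℝ ∞ ψ
  square_integrable : ∀ (k : ℕ) (t : ℝ),
    MemLp (fun x : Space => ‖iteratedFDeriv ℝ k ψ (t, x)‖) 2 volume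

theorem IsWaveFunction.hasL2Derivs {n : ℕ} {f : (Fin n → Spacetime) → ℂ}
    (hf : IsWaveFunction f) : HasL2Derivs f := ⟨hf.smooth, hf.square_integrable⟩

/-- It suffices to dominate each derivative by a square-integrable function. -/
theorem HasL2Derivs.of_le {n : ℕ} {f : (Fin n → Spacetime) → ℂ} (hf : ContDiff ℝ ∞ f)
    (h : ∀ (k : ℕ) (τ : Fin n → ℝ), ∃ g : (Fin n → Space) → ℝ, MemLp g 2 volume ∧
      ∀ x, ‖iteratedFDeriv ℝ k f (fun j => (τ j, x j))‖ ≤ g x) : HasL2Derivs f where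
  smooth := hf
  square_integrable k τ := by
    obtain ⟨g, hg, hle⟩ := h k τ
    refine hg.mono (continuous_norm_iteratedFDeriv hf k τ).aestronglyMeasurable
      (Eventually.of_forall fun x => ?_)
    rw [norm_norm]
    exact (hle x).trans (le_abs_self _)

theorem HasL2Derivs.sum {n : ℕ} {ι : Type*} (s : Finset ι) {f : ι → (Fin n → Spacetime) → ℂ}
    (hf : ∀ i ∈ s, HasL2Derivs (f i)) : HasL2Derivs (fun ξ => ∑ i ∈ s, f i ξ) := by
  refine .of_le (ContDiff.sum fun i hi => (hf i hi).smooth) fun k τ =>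
    ⟨_, memLp_finsetSum s fun i hi => (hf i hi).square_integrable k τ, fun x => ?_⟩
  rw [iteratedFDeriv_sum fun i hi => (hf i hi).smooth.of_le (by exact_mod_cast le_top)]
  simpa using norm_sum_le s _

theorem HasL2Derivs.const_mul {n : ℕ} {f : (Fin n → Spacetime) → ℂ} (c : ℂ)
    (hf : HasL2Derivs f) : HasL2Derivs (fun ξ => c * f ξ) := by
  refine .of_le (contDiff_const.mul hf.smooth) fun k τ =>
    ⟨_, (hf.square_integrable k τ).const_mul ‖c‖, fun x => ?_⟩
  have := iteratedFDeriv_const_smul_apply (a := c) (i := k)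
    (x := fun j => (τ j, x j)) (hf.smooth.contDiffAt.of_le (by exact_mod_cast le_top))
  change iteratedFDeriv ℝ k (fun ξ => c * f ξ) _ = _ at this
  rw [this, norm_smul]

theorem HasL2Derivs.sub {n : ℕ} {f g : (Fin n → Spacetime) → ℂ}
    (hf : HasL2Derivs f) (hg : HasL2Derivs g) : HasL2Derivs (fun ξ => f ξ - g ξ) := by
  have h := HasL2Derivs.sum (Finset.univ : Finset (Fin 2)) (f := ![f, fun ξ => (-1) * g ξ])
    (by intro i _; fin_cases i; exacts [hf, hg.const_mul _])
  convert h using 2 with ξ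
  simp [Fin.sum_univ_two]
  ring

/-- Substitution of variables along a map of indices. -/
def reindexL {n m : ℕ} (e : Fin n → Fin m) : (Fin m → Spacetime) →L[ℝ] (Fin n → Spacetime) :=
  ContinuousLinearMap.pi fun j => ContinuousLinearMap.proj (e j)

theorem reindexL_apply {n m : ℕ} (e : Fin n → Fin m) (ξ : Fin m → Spacetime) :
    reindexL e ξ = fun j => ξ (e j) := rfl

theorem norm_reindexL_le {n m : ℕ} (e : Fin n → Fin m) : ‖reindexL e‖ ≤ 1 := by
  refine ContinuousLinearMap.opNorm_le_bound _ zero_le_one fun ξ => ?_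
  rw [one_mul, reindexL_apply, pi_norm_le_iff_of_nonneg (norm_nonneg _)]
  exact fun j => norm_le_pi_norm ξ (e j)

theorem measurePreserving_comp_perm {n : ℕ} (σ : Equiv.Perm (Fin n)) :
    MeasurePreserving (fun (x : Fin n → Space) j => x (σ j)) volume volume :=
  volume_preserving_arrowCongr' σ.symm (MeasurableEquiv.refl Space) (MeasurePreserving.id _)

theorem HasL2Derivs.comp_perm {n : ℕ} {f : (Fin n → Spacetime) → ℂ} (hf : HasL2Derivs f)
    (σ : Equiv.Perm (Fin n)) : HasL2Derivs (fun ξ => f (fun j => ξ (σ j))) := by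
  refine .of_le (hf.smooth.comp (reindexL σ).contDiff) fun k τ =>
    ⟨_, (hf.square_integrable k fun j => τ (σ j)).comp_measurePreserving
      (measurePreserving_comp_perm σ), fun x => ?_⟩
  exact norm_iteratedFDeriv_comp_clm_le hf.smooth _ (norm_reindexL_le σ) k _

theorem sym_comp_perm {n : ℕ} (f : (Fin n → Spacetime) → ℂ) (σ : Equiv.Perm (Fin n))
    (ξ : Fin n → Spacetime) : sym f (fun j => ξ (σ j)) = sym f ξ := by
  unfold sym
  congr 1
  exact Equiv.sum_comp (Equiv.mulLeft σ) fun τ => f (fun j => ξ (τ j))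

theorem HasL2Derivs.sym {n : ℕ} {f : (Fin n → Spacetime) → ℂ} (hf : HasL2Derivs f) :
    IsWaveFunction (sym f) := by
  have h : HasL2Derivs (FreeFieldCCR.sym f) :=
    (HasL2Derivs.sum _ fun σ _ => hf.comp_perm σ).const_mul _
  exact ⟨sym_comp_perm f, h.smooth, h.square_integrable⟩

/-! ### Creation operators preserve wave functions -/

theorem memLp_two_mul_prod {X Y : Type*} [MeasurableSpace X] [MeasurableSpace Y]
    {μ : Measure X} {ν : Measure Y} [SFinite μ] [SFinite ν] {f : X → ℝ} {g : Y → ℝ}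
    (hf : MemLp f 2 μ) (hg : MemLp g 2 ν) :
    MemLp (fun z : X × Y => f z.1 * g z.2) 2 (μ.prod ν) := by
  refine (memLp_two_iff_integrable_sq (hf.1.comp_fst.mul hg.1.comp_snd)).2 ?_
  simp only [Pi.mul_apply, mul_pow]
  exact ((memLp_two_iff_integrable_sq hf.1).1 hf).mul_prod
    ((memLp_two_iff_integrable_sq hg.1).1 hg)

theorem measurePreserving_last_init (n : ℕ) :
    MeasurePreserving
      (fun x : Fin (n + 1) → Space => (x (Fin.last n), fun j : Fin n => x j.castSucc)) volume
      (volume.prod volume) := by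
  have h := volume_preserving_piFinSuccAbove (fun _ : Fin (n + 1) => Space) (Fin.last n)
  have he : (fun x : Fin (n + 1) → Space => (x (Fin.last n), fun j : Fin n => x j.castSucc))
      = MeasurableEquiv.piFinSuccAbove (fun _ => Space) (Fin.last n) := by
    funext x
    simp [MeasurableEquiv.piFinSuccAbove, Fin.init_def]
  rw [he]
  exact h

/-- The projection to the last variable. -/
def lastL (n : ℕ) : (Fin (n + 1) → Spacetime) →L[ℝ] Spacetime :=
  ContinuousLinearMap.proj (Fin.last n)

theorem norm_lastL_le (n : ℕ) : ‖lastL n‖ ≤ 1 :=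
  ContinuousLinearMap.opNorm_le_bound _ zero_le_one fun ξ => by
    rw [one_mul]; exact norm_le_pi_norm ξ _

/-- The tensor product, before symmetrization, that enters the creation operator: by the Leibniz
rule each derivative is dominated by products of square-integrable functions of separate
variables. -/
theorem HasL2Derivs.tensor {n : ℕ} {ψ : Spacetime → ℂ} {f : (Fin n → Spacetime) → ℂ}
    (hψ : IsOneParticle ψ) (hf : HasL2Derivs f) :
    HasL2Derivs (fun ζ : Fin (n + 1) → Spacetime =>
      ψ (ζ (Fin.last n)) * f (fun j => ζ j.castSucc)) := by
  have h1 : ContDiff ℝ ∞ fun ζ : Fin (n + 1) → Spacetime => ψ (lastL n ζ) :=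
    hψ.smooth.comp (lastL n).contDiff
  have h2 : ContDiff ℝ ∞ fun ζ : Fin (n + 1) → Spacetime => f (reindexL Fin.castSucc ζ) :=
    hf.smooth.comp (reindexL Fin.castSucc).contDiff
  refine .of_le (h1.mul h2) fun k τ =>
    ⟨fun x => ∑ i ∈ Finset.range (k + 1), (k.choose i : ℝ) *
      (‖iteratedFDeriv ℝ i ψ (τ (Fin.last n), x (Fin.last n))‖ *
      ‖iteratedFDeriv ℝ (k - i) f (fun j => (τ j.castSucc, x j.castSucc))‖),
      memLp_finsetSum _ fun i _ => ?_, fun x => ?_⟩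
  · exact ((memLp_two_mul_prod (hψ.square_integrable i (τ (Fin.last n)))
      (hf.square_integrable (k - i) fun j => τ j.castSucc)).comp_measurePreserving
      (measurePreserving_last_init n)).const_mul _
  · refine (norm_iteratedFDeriv_mul_le h1 h2 _ (n := k) (by exact_mod_cast le_top)).trans
      (Finset.sum_le_sum fun i _ => ?_)
    rw [mul_assoc]
    gcongr
    · exact norm_iteratedFDeriv_comp_clm_le hψ.smooth _ (norm_lastL_le n) i _
    · exact norm_iteratedFDeriv_comp_clm_le hf.smooth _ (norm_reindexL_le _) (k - i) _

theorem isWaveFunction_creation {ψ : Spacetime → ℂ} (hψ : IsOneParticle ψ) {Φ : FockSeq}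
    (hΦ : ∀ n, IsWaveFunction (Φ n)) (n : ℕ) : IsWaveFunction (creation ψ Φ n) := by
  cases n with
  | zero => exact IsWaveFunction.zero
  | succ n => exact (HasL2Derivs.tensor hψ (hΦ n).hasL2Derivs).sym.smul _

/-! ### Annihilation operators preserve wave functions -/

/-- Appending a last variable, as a linear map. -/
def snocL (n : ℕ) : ((Fin n → Spacetime) × Spacetime) →L[ℝ] (Fin (n + 1) → Spacetime) :=
  ContinuousLinearMap.pi fun j => Fin.lastCases
    (motive := fun _ => ((Fin n → Spacetime) × Spacetime) →L[ℝ] Spacetime)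
    (ContinuousLinearMap.snd ℝ _ _)
    (fun i => (ContinuousLinearMap.proj i).comp (ContinuousLinearMap.fst ℝ _ _)) j

theorem snocL_apply {n : ℕ} (ξ : Fin n → Spacetime) (ζ : Spacetime) :
    snocL n (ξ, ζ) = Fin.snoc (α := fun _ => Spacetime) ξ ζ := by
  ext1 j
  refine Fin.lastCases ?_ (fun i => ?_) j <;> simp [snocL]

theorem norm_snocL_le (n : ℕ) : ‖snocL n‖ ≤ 1 := by
  refine ContinuousLinearMap.opNorm_le_bound _ zero_le_one fun ⟨ξ, ζ⟩ => ?_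
  rw [one_mul, snocL_apply, pi_norm_le_iff_of_nonneg (norm_nonneg _)]
  intro j
  refine Fin.lastCases ?_ (fun i => ?_) j
  · simp
  · simpa using (norm_le_pi_norm ξ i).trans (norm_fst_le (ξ, ζ))

theorem norm_iteratedFDeriv_snoc_le {n : ℕ} {f : (Fin (n + 1) → Spacetime) → ℂ}
    (hf : ContDiff ℝ ∞ f) (k : ℕ) (ξ : Fin n → Spacetime) (ζ : Spacetime) :
    ‖iteratedFDeriv ℝ k (fun ξ => f (Fin.snoc (α := fun _ => Spacetime) ξ ζ)) ξ‖
      ≤ ‖iteratedFDeriv ℝ k f (Fin.snoc (α := fun _ => Spacetime) ξ ζ)‖ := by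
  set L : (Fin n → Spacetime) →L[ℝ] (Fin (n + 1) → Spacetime) :=
    (snocL n).comp (ContinuousLinearMap.inl ℝ _ _)
  have hL : ‖L‖ ≤ 1 := (ContinuousLinearMap.opNorm_comp_le _ _).trans
    (mul_le_one₀ (norm_snocL_le n) (norm_nonneg _) (ContinuousLinearMap.norm_inl_le_one ℝ _ _))
  have hs : ∀ ξ, Fin.snoc (α := fun _ => Spacetime) ξ ζ = L ξ + snocL n (0, ζ) := fun ξ => by
    simp [L, ← map_add, ← snocL_apply]
  have h := norm_iteratedFDeriv_comp_clm_le (f := fun y => f (y + snocL n (0, ζ)))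
    (by fun_prop) L hL k ξ
  rw [iteratedFDeriv_comp_add_right] at h
  simpa only [hs] using h

theorem integral_mul_sq_le {X : Type*} [MeasurableSpace X] {μ : Measure X} {f g : X → ℝ}
    (hf : MemLp f 2 μ) (hg : MemLp g 2 μ) (hf0 : 0 ≤ f) (hg0 : 0 ≤ g) :
    (∫ x, f x * g x ∂μ) ^ 2 ≤ (∫ x, f x ^ 2 ∂μ) * ∫ x, g x ^ 2 ∂μ := by
  have h := integral_mul_le_Lp_mul_Lq_of_nonneg (μ := μ) Real.HolderConjugate.two_two
    (Eventually.of_forall hf0) (Eventually.of_forall hg0) (by simpa using hf) (by simpa using hg)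
  have h0 : 0 ≤ ∫ x, f x * g x ∂μ := integral_nonneg fun x => mul_nonneg (hf0 x) (hg0 x)
  have hA : 0 ≤ ∫ x, f x ^ 2 ∂μ := integral_nonneg fun x => sq_nonneg _
  have hB : 0 ≤ ∫ x, g x ^ 2 ∂μ := integral_nonneg fun x => sq_nonneg _
  simp only [Real.rpow_ofNat, ← Real.sqrt_eq_rpow] at h
  calc _ ≤ (√(∫ x, f x ^ 2 ∂μ) * √(∫ x, g x ^ 2 ∂μ)) ^ 2 := by gcongr
    _ = _ := by rw [mul_pow, Real.sq_sqrt hA, Real.sq_sqrt hB]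

/-- Partial integration of a square-integrable function against a square-integrable weight is
square-integrable in the remaining variable, by the Cauchy–Schwarz inequality. -/
theorem memLp_two_integral_mul {X Y : Type*} [MeasurableSpace X] [MeasurableSpace Y]
    {μ : Measure X} {ν : Measure Y} [SFinite μ] [SFinite ν] {a : X → ℝ} {h : X × Y → ℝ}
    (ha : MemLp a 2 μ) (hh : MemLp h 2 (μ.prod ν)) (ha0 : 0 ≤ a) (hh0 : 0 ≤ h) :
    MemLp (fun y => ∫ x, a x * h (x, y) ∂μ) 2 ν := by
  have hm : AEStronglyMeasurable (fun y => ∫ x, a x * h (x, y) ∂μ) ν :=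
    (ha.1.comp_fst.mul hh.1).prod_swap.integral_prod_right'
  rw [memLp_two_iff_integrable_sq hm]
  have hsq := (memLp_two_iff_integrable_sq hh.1).1 hh
  refine (hsq.integral_prod_right.const_mul (∫ x, a x ^ 2 ∂μ)).mono' (hm.pow 2) ?_
  have hmeas : ∀ᵐ y ∂ν, AEStronglyMeasurable (fun x => h (x, y)) μ :=
    hh.1.prod_swap.prodMk_left
  filter_upwards [hsq.prod_left_ae, hmeas] with y hy hym
  rw [Real.norm_of_nonneg (sq_nonneg _)]
  exact integral_mul_sq_le ha ((memLp_two_iff_integrable_sq hym).2 hy) ha0 fun x => hh0 (x, y)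

theorem contDiff_snoc {n : ℕ} {f : (Fin (n + 1) → Spacetime) → ℂ} (hf : ContDiff ℝ ∞ f)
    {P : Type*} [NormedAddCommGroup P] [NormedSpace ℝ P] {u : P → Fin n → Spacetime}
    {v : P → Spacetime} (hu : ContDiff ℝ ∞ u) (hv : ContDiff ℝ ∞ v) :
    ContDiff ℝ ∞ fun p => f (Fin.snoc (α := fun _ => Spacetime) (u p) (v p)) := by
  simp_rw [← snocL_apply]
  exact hf.comp ((snocL n).contDiff.comp (hu.prodMk hv))

/-- Integrating the last space variable against a compactly supported weight, at a fixed time, as in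
the annihilation operator. -/
theorem HasL2Derivs.integral_last {n : ℕ} {f : (Fin (n + 1) → Spacetime) → ℂ}
    (hf : HasL2Derivs f) {α : Space → ℂ} (hα : ContDiff ℝ ∞ α) (hc : HasCompactSupport α)
    (t : ℝ) : HasL2Derivs (fun ξ : Fin n → Spacetime =>
      ∫ x : Space, α x * f (Fin.snoc (α := fun _ => Spacetime) ξ (t, x))) := by
  have hG : ContDiff ℝ ∞ (Function.uncurry fun (ξ : Fin n → Spacetime) (x : Space) =>
      α x * f (Fin.snoc (α := fun _ => Spacetime) ξ (t, x))) :=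
    (hα.comp contDiff_snd).mul (contDiff_snoc hf.smooth contDiff_fst
      (contDiff_const.prodMk contDiff_snd))
  have hK : ∀ (ξ : Fin n → Spacetime), ∀ x ∉ tsupport α,
      α x * f (Fin.snoc (α := fun _ => Spacetime) ξ (t, x)) = 0 := fun ξ x hx => by
    rw [image_eq_zero_of_notMem_tsupport hx, zero_mul]
  refine .of_le (contDiff_integral_of_compact hG hc hK) fun k τ =>
    ⟨fun y => ∫ x, ‖α x‖ * ‖iteratedFDeriv ℝ k f
      (Fin.snoc (α := fun _ => Spacetime) (fun j => (τ j, y j)) (t, x))‖, ?_, fun y => ?_⟩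
  · have hmp : MeasurePreserving (fun z : Space × (Fin n → Space) =>
        (Fin.snoc (α := fun _ => Space) z.2 z.1 : Fin (n + 1) → Space))
        (volume.prod volume) volume := by
      have h := (volume_preserving_piFinSuccAbove (fun _ : Fin (n + 1) => Space)
        (Fin.last n)).symm
      have he : (fun z : Space × (Fin n → Space) =>
          (Fin.snoc (α := fun _ => Space) z.2 z.1 : Fin (n + 1) → Space))
          = (MeasurableEquiv.piFinSuccAbove (fun _ => Space) (Fin.last n)).symm := by
        funext z
        simp [MeasurableEquiv.piFinSuccAbove]
        rfl
      rw [he]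
      exact h
    have h2 := (hf.square_integrable k
      (Fin.snoc (α := fun _ => ℝ) τ t)).comp_measurePreserving hmp
    have ha : MemLp (fun x => ‖α x‖) 2 volume :=
      (hα.continuous.memLp_of_hasCompactSupport hc).norm
    have hp : ∀ (y : Fin n → Space) (x : Space),
        (fun j => (Fin.snoc (α := fun _ => ℝ) τ t j, Fin.snoc (α := fun _ => Space) y x j))
          = Fin.snoc (α := fun _ => Spacetime) (fun j => (τ j, y j)) (t, x) := fun y x => by
      ext1 j
      refine Fin.lastCases ?_ (fun i => ?_) j <;> simp
    have h3 := memLp_two_integral_mul ha h2 (fun x => norm_nonneg _) (fun x => norm_nonneg _)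
    simp only [Function.comp_def, hp] at h3
    exact h3
  · refine (norm_iteratedFDeriv_integral_le hG hc hK k _).trans ?_
    refine integral_mono_of_nonneg (Eventually.of_forall fun x => norm_nonneg _) ?_
      (Eventually.of_forall fun x => ?_)
    · refine Continuous.integrable_of_hasCompactSupport ?_ hc.norm.mul_right
      have h1 : Continuous (iteratedFDeriv ℝ k f) :=
        hf.smooth.continuous_iteratedFDeriv (by exact_mod_cast le_top)
      refine hα.continuous.norm.mul (h1.comp ?_).norm
      simp_rw [← snocL_apply]
      fun_prop
    · dsimp only
      have h3 := iteratedFDeriv_const_smul_apply (𝕜 := ℝ) (a := α x) (i := k)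
        (f := fun ξ => f (Fin.snoc (α := fun _ => Spacetime) ξ (t, x)))
        (x := fun j => (τ j, y j)) ((contDiff_snoc hf.smooth contDiff_id
          contDiff_const).contDiffAt.of_le (by exact_mod_cast le_top))
      change iteratedFDeriv ℝ k (fun ξ => α x * f (Fin.snoc (α := fun _ => Spacetime) ξ (t, x))) _
        = _ at h3
      rw [h3, norm_smul]
      gcongr
      exact norm_iteratedFDeriv_snoc_le hf.smooth k _ _

/-- The time derivative of a wave function in its last variable. -/
noncomputable def lastDeriv {n : ℕ} (f : (Fin (n + 1) → Spacetime) → ℂ)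
    (ζ : Fin (n + 1) → Spacetime) : ℂ :=
  fderiv ℝ f ζ (snocL n (0, (1, 0)))

theorem HasL2Derivs.lastDeriv {n : ℕ} {f : (Fin (n + 1) → Spacetime) → ℂ}
    (hf : HasL2Derivs f) : HasL2Derivs (lastDeriv f) := by
  have hs : ContDiff ℝ ∞ (fderiv ℝ f) := hf.smooth.fderiv_right (by simp)
  refine .of_le (hs.clm_apply contDiff_const) fun k τ =>
    ⟨_, (hf.square_integrable (k + 1) τ).const_mul ‖snocL n (0, (1, 0))‖, fun x => ?_⟩
  rw [← norm_iteratedFDeriv_fderiv]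
  exact norm_iteratedFDeriv_clm_apply_const hs.contDiffAt (by exact_mod_cast le_top)

theorem hasDerivAt_snoc {n : ℕ} {f : (Fin (n + 1) → Spacetime) → ℂ}
    (hf : ContDiff ℝ ∞ f) (ξ : Fin n → Spacetime) (t : ℝ) (x : Space) :
    HasDerivAt (fun s => f (Fin.snoc (α := fun _ => Spacetime) ξ (s, x)))
      (lastDeriv f (Fin.snoc (α := fun _ => Spacetime) ξ (t, x))) t := by
  have h : HasDerivAt (fun s : ℝ => snocL n (ξ, (s, x))) (snocL n (0, (1, 0))) t :=
    (snocL n).hasFDerivAt.comp_hasDerivAt t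
      ((hasDerivAt_const t ξ).prodMk ((hasDerivAt_id t).prodMk (hasDerivAt_const t x)))
  have h2 := (hf.differentiable (by simp) (snocL n (ξ, (t, x)))).hasFDerivAt.comp_hasDerivAt t h
  simp only [Function.comp_def, snocL_apply ξ] at h2
  exact h2

theorem IsSuitableDamper.contDiff_scaled {χh : Space → ℝ} (hχ : IsSuitableDamper χh) (ε : ℝ) :
    ContDiff ℝ ∞ fun x : Space => ((χh (ε • x) : ℝ) : ℂ) :=
  Complex.ofRealCLM.contDiff.comp (hχ.smooth.comp (contDiff_const_smul ε))

theorem IsSuitableDamper.hasCompactSupport_scaled {χh : Space → ℝ} (hχ : IsSuitableDamper χh)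
    {ε : ℝ} (hε : 0 < ε) : HasCompactSupport fun x : Space => ((χh (ε • x) : ℝ) : ℂ) :=
  (hχ.compact.comp_homeomorph (Homeomorph.smulOfNeZero ε hε.ne')).comp_left
    (g := ((↑) : ℝ → ℂ)) Complex.ofReal_zero

theorem contDiff_conj_slice {ψ : Spacetime → ℂ} (hψ : ContDiff ℝ ∞ ψ) :
    ContDiff ℝ ∞ (Function.uncurry fun (x : Space) (s : ℝ) => conj (ψ (s, x))) :=
  Complex.conjCLE.contDiff.comp (hψ.comp (by fun_prop))

/-- Extension of a permutation by fixing the last element. -/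
def extendPerm {n : ℕ} (σ : Equiv.Perm (Fin n)) : Equiv.Perm (Fin (n + 1)) :=
  finSuccEquivLast.symm.permCongr (Equiv.optionCongr σ)

@[simp] theorem extendPerm_last {n : ℕ} (σ : Equiv.Perm (Fin n)) :
    extendPerm σ (Fin.last n) = Fin.last n := by simp [extendPerm]

@[simp] theorem extendPerm_castSucc {n : ℕ} (σ : Equiv.Perm (Fin n)) (j : Fin n) :
    extendPerm σ j.castSucc = (σ j).castSucc := by simp [extendPerm]

section Annihilation

variable {χh : Space → ℝ} {ε : ℝ} {ψ : Spacetime → ℂ}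

theorem contDiff_weight (hχ : IsSuitableDamper χh) (hψ : ContDiff ℝ ∞ ψ) (t : ℝ) :
    ContDiff ℝ ∞ fun x : Space => conj (ψ (t, x)) * ((χh (ε • x) : ℝ) : ℂ) :=
  ((contDiff_conj_slice hψ).comp (contDiff_id.prodMk contDiff_const)).mul (hχ.contDiff_scaled ε)

theorem contDiff_weightDeriv (hχ : IsSuitableDamper χh) (hψ : ContDiff ℝ ∞ ψ) (t : ℝ) :
    ContDiff ℝ ∞ fun x : Space =>
      deriv (fun s : ℝ => conj (ψ (s, x))) t * ((χh (ε • x) : ℝ) : ℂ) :=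
  (contDiff_deriv_param (contDiff_conj_slice hψ) contDiff_const).mul (hχ.contDiff_scaled ε)

/-- The regularized scalar product as a difference of two integrals against compactly supported
weights. -/
theorem dampedProduct_eq (hχ : IsSuitableDamper χh) (hε : 0 < ε) (hψ : ContDiff ℝ ∞ ψ)
    {g : Spacetime → ℂ} (hg : ContDiff ℝ ∞ g) (t : ℝ) :
    dampedProduct χh ε t ψ g = Complex.I *
      ((∫ x : Space, conj (ψ (t, x)) * ((χh (ε • x) : ℝ) : ℂ) * deriv (fun s => g (s, x)) t) -
      ∫ x : Space, deriv (fun s : ℝ => conj (ψ (s, x))) t * ((χh (ε • x) : ℝ) : ℂ)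
        * g (t, x)) := by
  have hg' : ContDiff ℝ ∞ (Function.uncurry fun (x : Space) (s : ℝ) => g (s, x)) :=
    hg.comp (by fun_prop)
  have hc := hχ.hasCompactSupport_scaled hε
  unfold dampedProduct
  rw [← integral_sub]
  · congr 2 with x
    ring
  · exact ((contDiff_weight hχ hψ t).continuous.mul (contDiff_deriv_param hg'
      contDiff_const).continuous).integrable_of_hasCompactSupport hc.mul_left.mul_right
  · exact ((contDiff_weightDeriv hχ hψ t).continuous.mul
      (hg.continuous.comp (by fun_prop))).integrable_of_hasCompactSupport hc.mul_left.mul_right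

theorem annihilation_eq (hχ : IsSuitableDamper χh) (hε : 0 < ε) (hψ : ContDiff ℝ ∞ ψ)
    {Φ : FockSeq} {n : ℕ} (hΦ : ContDiff ℝ ∞ (Φ (n + 1))) (t : ℝ) (ξ : Fin n → Spacetime) :
    annihilation χh ε t ψ Φ n ξ = (Real.sqrt ((n : ℝ) + 1) : ℂ) * (Complex.I *
      ((∫ x : Space, conj (ψ (t, x)) * ((χh (ε • x) : ℝ) : ℂ) *
        lastDeriv (Φ (n + 1)) (Fin.snoc (α := fun _ => Spacetime) ξ (t, x))) -
      ∫ x : Space, deriv (fun s : ℝ => conj (ψ (s, x))) t * ((χh (ε • x) : ℝ) : ℂ)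
        * Φ (n + 1) (Fin.snoc (α := fun _ => Spacetime) ξ (t, x)))) := by
  unfold annihilation
  rw [dampedProduct_eq hχ hε hψ (g := fun ζ => Φ (n + 1) (Fin.snoc (α := fun _ => Spacetime) ξ ζ))
    (contDiff_snoc hΦ contDiff_const contDiff_id)]
  simp_rw [fun x => (hasDerivAt_snoc hΦ ξ t x).deriv]

theorem isWaveFunction_annihilation (hχ : IsSuitableDamper χh) (hε : 0 < ε)
    (hψ : ContDiff ℝ ∞ ψ) {Φ : FockSeq} (hΦ : ∀ n, IsWaveFunction (Φ n)) (t : ℝ) (n : ℕ) :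
    IsWaveFunction (annihilation χh ε t ψ Φ n) := by
  have hf := (hΦ (n + 1)).hasL2Derivs
  have hc := hχ.hasCompactSupport_scaled hε
  have h : HasL2Derivs (annihilation χh ε t ψ Φ n) := by
    rw [funext (annihilation_eq hχ hε hψ hf.smooth t)]
    exact (((hf.lastDeriv.integral_last (contDiff_weight hχ hψ t) hc.mul_left t).sub
      (hf.integral_last (contDiff_weightDeriv hχ hψ t) hc.mul_left t)).const_mul _).const_mul _
  refine ⟨fun σ ξ => ?_, h.smooth, h.square_integrable⟩
  unfold annihilation
  congr 3 with ζ
  rw [← (hΦ (n + 1)).symm (extendPerm σ) (Fin.snoc (α := fun _ => Spacetime) ξ ζ)]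
  congr 1
  ext1 j
  refine Fin.lastCases ?_ (fun i => ?_) j <;> simp

end Annihilation

/-! ### Symmetrization and commutation of creation operators -/

/-- A permutation that fixes the last element restricts to the other elements; converse of
`extendPerm`. -/
theorem exists_restrict_perm {n : ℕ} (π : Equiv.Perm (Fin (n + 1)))
    (h : π (Fin.last n) = Fin.last n) :
    ∃ τ : Equiv.Perm (Fin n), ∀ j, π j.castSucc = (τ j).castSucc := by
  have hne : ∀ j : Fin n, π j.castSucc ≠ Fin.last n := fun j hj =>
    (Fin.castSucc_ne_last j) (π.injective (hj.trans h.symm))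
  have hinj : Function.Injective fun j : Fin n => (π j.castSucc).castPred (hne j) :=
    fun i j hij => by simpa using hij
  exact ⟨Equiv.ofBijective _ (Finite.injective_iff_bijective.1 hinj), fun j => by simp⟩

theorem sym_precomp {n : ℕ} (f : (Fin n → Spacetime) → ℂ) (τ : Equiv.Perm (Fin n)) :
    sym (fun ξ => f (fun j => ξ (τ j))) = sym f := by
  funext ξ
  unfold sym
  congr 1
  exact Equiv.sum_comp (Equiv.mulRight τ) fun σ => f (fun j => ξ (σ j))

/-- Symmetrizing a tensor factor first does not change the symmetrized tensor product. -/
theorem sym_mul_sym {n : ℕ} (ψ : Spacetime → ℂ) (f : (Fin n → Spacetime) → ℂ) :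
    sym (fun ζ : Fin (n + 1) → Spacetime => ψ (ζ (Fin.last n)) * sym f fun j => ζ j.castSucc)
      = sym fun ζ => ψ (ζ (Fin.last n)) * f fun j => ζ j.castSucc := by
  funext ξ
  have h : ∀ τ : Equiv.Perm (Fin n),
      ∑ σ : Equiv.Perm (Fin (n + 1)), ψ (ξ (σ (Fin.last n))) * f (fun j => ξ (σ (τ j).castSucc))
      = ∑ σ : Equiv.Perm (Fin (n + 1)), ψ (ξ (σ (Fin.last n))) * f (fun j => ξ (σ j.castSucc)) :=
    fun τ => by
      rw [← Equiv.sum_comp (Equiv.mulRight (extendPerm τ))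
        fun σ => ψ (ξ (σ (Fin.last n))) * f (fun j => ξ (σ j.castSucc))]
      simp
  have hn : ((n.factorial : ℕ) : ℂ) ≠ 0 := by exact_mod_cast n.factorial_ne_zero
  unfold sym
  congr 1
  simp_rw [Finset.mul_sum, mul_left_comm _ ((n.factorial : ℂ)⁻¹)]
  rw [Finset.sum_comm]
  simp_rw [← Finset.mul_sum, h]
  rw [Finset.sum_const, Finset.card_univ, Fintype.card_perm, Fintype.card_fin, nsmul_eq_mul,
    inv_mul_cancel_left₀ hn]

theorem sym_const_mul {n : ℕ} (c : ℂ) (f : (Fin n → Spacetime) → ℂ) (ξ : Fin n → Spacetime) :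
    sym (fun ζ => c * f ζ) ξ = c * sym f ξ := by
  unfold sym
  rw [← Finset.mul_sum, mul_left_comm]

theorem sym_add {n : ℕ} (f g : (Fin n → Spacetime) → ℂ) (ξ : Fin n → Spacetime) :
    sym (fun ζ => f ζ + g ζ) ξ = sym f ξ + sym g ξ := by
  unfold sym
  rw [Finset.sum_add_distrib, mul_add]

theorem creation_comm (ψ₁ ψ₂ : Spacetime → ℂ) (Φ : FockSeq) :
    creation ψ₁ (creation ψ₂ Φ) = creation ψ₂ (creation ψ₁ Φ) := by
  have key : ∀ (ψ₁ ψ₂ : Spacetime → ℂ) (n : ℕ) (ξ : Fin (n + 2) → Spacetime),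
      creation ψ₁ (creation ψ₂ Φ) (n + 2) ξ
        = (Real.sqrt ((n + 1 : ℕ) + 1 : ℝ) : ℂ) * ((Real.sqrt ((n : ℝ) + 1) : ℂ) *
          sym (fun ζ : Fin (n + 2) → Spacetime => ψ₁ (ζ (Fin.last (n + 1))) *
            (ψ₂ (ζ (Fin.last n).castSucc) * Φ n (fun j => ζ j.castSucc.castSucc))) ξ) := by
    intro ψ₁ ψ₂ n ξ
    simp only [creation, mul_left_comm (ψ₁ _)]
    rw [sym_const_mul, sym_mul_sym ψ₁ fun ζ => ψ₂ (ζ (Fin.last n)) * Φ n fun j => ζ j.castSucc]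
    simp only [mul_left_comm (ψ₁ _)]
  funext n ξ
  match n with
  | 0 => rfl
  | 1 => simp [creation, sym]
  | n + 2 =>
    rw [key, key]
    congr 2
    rw [← sym_precomp _ (Equiv.swap (Fin.last (n + 1)) (Fin.last n).castSucc)]
    congr 1
    funext ζ
    have h : ∀ j : Fin n, Equiv.swap (Fin.last (n + 1)) (Fin.last n).castSucc j.castSucc.castSucc
        = j.castSucc.castSucc := fun j =>
      Equiv.swap_apply_of_ne_of_ne (Fin.castSucc_ne_last _)
        (fun h => Fin.castSucc_ne_last j (Fin.castSucc_injective _ h))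
    simp only [Equiv.swap_apply_left, Equiv.swap_apply_right, h]
    ring

/-- On symmetric wave functions the creation operator is a sum over the position of the new
particle. -/
theorem creation_succ_apply (ψ : Spacetime → ℂ) {Φ : FockSeq} {n : ℕ}
    (hΦ : ∀ (σ : Equiv.Perm (Fin n)) (ξ : Fin n → Spacetime), Φ n (fun j => ξ (σ j)) = Φ n ξ)
    (ξ : Fin (n + 1) → Spacetime) :
    creation ψ Φ (n + 1) ξ = (Real.sqrt ((n : ℝ) + 1) : ℂ)⁻¹ *
      ∑ i, ψ (ξ i) * Φ n (fun j => ξ (Equiv.swap i (Fin.last n) j.castSucc)) := by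
  set F : Equiv.Perm (Fin (n + 1)) → ℂ := fun σ =>
    ψ (ξ (σ (Fin.last n))) * Φ n (fun j => ξ (σ j.castSucc)) with hF
  set A : Fin (n + 1) → ℂ := fun i =>
    ψ (ξ i) * Φ n (fun j => ξ (Equiv.swap i (Fin.last n) j.castSucc)) with hA
  have hFA : ∀ σ i, F (σ * Equiv.swap i (Fin.last n)) = A (σ i) := by
    intro σ i
    obtain ⟨τ, hτ⟩ := exists_restrict_perm
      (Equiv.swap (σ i) (Fin.last n) * σ * Equiv.swap i (Fin.last n)) (by simp)
    simp only [hF, hA, Equiv.Perm.mul_apply, Equiv.swap_apply_right]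
    congr 1
    rw [← hΦ τ fun j => ξ (Equiv.swap (σ i) (Fin.last n) j.castSucc)]
    congr 1
    funext j
    simp [← hτ]
  -- averaging the sum over permutations over the right translates by transpositions
  have hsum : ((n : ℂ) + 1) * ∑ σ, F σ = ((n + 1).factorial : ℂ) * ∑ i, A i := by
    calc ((n : ℂ) + 1) * ∑ σ, F σ = ∑ _i : Fin (n + 1), ∑ σ, F σ := by simp
      _ = ∑ i, ∑ σ : Equiv.Perm (Fin (n + 1)), A (σ i) := by
        refine Finset.sum_congr rfl fun i _ => ?_
        rw [← Equiv.sum_comp (Equiv.mulRight (Equiv.swap i (Fin.last n)))]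
        exact Finset.sum_congr rfl fun σ _ => hFA σ i
      _ = ∑ σ : Equiv.Perm (Fin (n + 1)), ∑ i, A i := by
        rw [Finset.sum_comm]
        exact Finset.sum_congr rfl fun σ _ => Equiv.sum_comp σ A
      _ = _ := by simp [Fintype.card_perm]
  have hn : ((n : ℂ) + 1) ≠ 0 := by exact_mod_cast n.succ_ne_zero
  have hfac : (((n + 1).factorial : ℕ) : ℂ) ≠ 0 := by exact_mod_cast (n + 1).factorial_ne_zero
  have hsq : (Real.sqrt ((n : ℝ) + 1) : ℂ) * (Real.sqrt ((n : ℝ) + 1) : ℂ) = (n : ℂ) + 1 := by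
    rw [← Complex.ofReal_mul, Real.mul_self_sqrt (by positivity)]
    push_cast
    ring
  have hsq0 : (Real.sqrt ((n : ℝ) + 1) : ℂ) ≠ 0 := fun h => hn (by rw [← hsq, h, mul_zero])
  change (Real.sqrt ((n : ℝ) + 1) : ℂ) * ((((n + 1).factorial : ℕ) : ℂ)⁻¹ * ∑ σ, F σ) = _
  rw [eq_inv_mul_iff_mul_eq₀ hsq0, ← mul_assoc, hsq, mul_left_comm, hsum,
    inv_mul_cancel_left₀ hfac]

theorem creation_add (ψ : Spacetime → ℂ) (Φ Ψ : FockSeq) :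
    creation ψ (Φ + Ψ) = creation ψ Φ + creation ψ Ψ := by
  funext n ξ
  cases n with
  | zero => simp [creation]
  | succ n => simp only [creation, Pi.add_apply, mul_add, sym_add]

theorem creation_smul (ψ : Spacetime → ℂ) (c : ℂ) (Φ : FockSeq) :
    creation ψ (c • Φ) = c • creation ψ Φ := by
  funext n ξ
  cases n with
  | zero => simp [creation]
  | succ n =>
    simp only [creation, Pi.smul_apply, smul_eq_mul, mul_left_comm _ c, sym_const_mul]

/-! ### The regularized scalar product -/

/-- The integrand of the regularized scalar product. -/
noncomputable def dampedIntegrand (χh : Space → ℝ) (ε t : ℝ) (ψ g : Spacetime → ℂ) (x : Space) :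
    ℂ :=
  (conj (ψ (t, x)) * deriv (fun s : ℝ => g (s, x)) t
    - deriv (fun s : ℝ => conj (ψ (s, x))) t * g (t, x)) * ((χh (ε • x) : ℝ) : ℂ)

theorem dampedProduct_eq_integral (χh : Space → ℝ) (ε t : ℝ) (ψ g : Spacetime → ℂ) :
    dampedProduct χh ε t ψ g = Complex.I * ∫ x, dampedIntegrand χh ε t ψ g x := rfl

theorem contDiff_time_slice {g : Spacetime → ℂ} (hg : ContDiff ℝ ∞ g) (x : Space) :
    ContDiff ℝ ∞ fun s : ℝ => g (s, x) := hg.comp (by fun_prop)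

section DampedProduct

variable {χh : Space → ℝ} {ε : ℝ} {ψ ψ₁ ψ₂ g h : Spacetime → ℂ}

theorem contDiff_dampedIntegrand {P : Type} [NormedAddCommGroup P] [NormedSpace ℝ P]
    (hχ : IsSuitableDamper χh) (hψ : ContDiff ℝ ∞ ψ) {g : P → Spacetime → ℂ}
    (hg : ContDiff ℝ ∞ (Function.uncurry g)) {u : P → Space} (hu : ContDiff ℝ ∞ u) (t : ℝ) :
    ContDiff ℝ ∞ fun p => dampedIntegrand χh ε t ψ (g p) (u p) := by
  have h1 : ContDiff ℝ ∞ (Function.uncurry fun (p : P) (s : ℝ) => g p (s, u p)) :=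
    hg.comp (contDiff_fst.prodMk (contDiff_snd.prodMk (hu.comp contDiff_fst)))
  have h2 : ContDiff ℝ ∞ (Function.uncurry fun (p : P) (s : ℝ) => conj (ψ (s, u p))) :=
    (contDiff_conj_slice hψ).comp ((hu.comp contDiff_fst).prodMk contDiff_snd)
  refine ((((h2.comp (contDiff_id.prodMk contDiff_const)).mul
    (contDiff_deriv_param h1 contDiff_const)).sub ((contDiff_deriv_param h2 contDiff_const).mul
    (h1.comp (contDiff_id.prodMk contDiff_const)))).mul ((hχ.contDiff_scaled ε).comp hu))

theorem dampedIntegrand_eq_zero {x : Space}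
    (hx : x ∉ tsupport fun x : Space => ((χh (ε • x) : ℝ) : ℂ)) (t : ℝ) :
    dampedIntegrand χh ε t ψ g x = 0 := by
  unfold dampedIntegrand
  rw [show ((χh (ε • x) : ℝ) : ℂ) = 0 from image_eq_zero_of_notMem_tsupport
    (f := fun x : Space => ((χh (ε • x) : ℝ) : ℂ)) hx, mul_zero]

theorem integrable_dampedIntegrand (hχ : IsSuitableDamper χh) (hε : 0 < ε)
    (hψ : ContDiff ℝ ∞ ψ) (hg : ContDiff ℝ ∞ g) (t : ℝ) :
    Integrable (dampedIntegrand χh ε t ψ g) :=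
  (contDiff_dampedIntegrand (P := Space) (g := fun _ => g) (u := id) hχ hψ
    (hg.comp contDiff_snd) contDiff_id t).continuous.integrable_of_hasCompactSupport
    (HasCompactSupport.intro (hχ.hasCompactSupport_scaled hε)
      fun _ hx => dampedIntegrand_eq_zero hx t)

theorem dampedIntegrand_add (hg : ContDiff ℝ ∞ g) (hh : ContDiff ℝ ∞ h) (t : ℝ) (x : Space) :
    dampedIntegrand χh ε t ψ (fun ζ => g ζ + h ζ) x
      = dampedIntegrand χh ε t ψ g x + dampedIntegrand χh ε t ψ h x := by
  unfold dampedIntegrand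
  rw [deriv_fun_add ((contDiff_time_slice hg x).differentiable (by simp) t)
    ((contDiff_time_slice hh x).differentiable (by simp) t)]
  ring

theorem dampedProduct_add (hχ : IsSuitableDamper χh) (hε : 0 < ε) (hψ : ContDiff ℝ ∞ ψ)
    (hg : ContDiff ℝ ∞ g) (hh : ContDiff ℝ ∞ h) (t : ℝ) :
    dampedProduct χh ε t ψ (fun ζ => g ζ + h ζ)
      = dampedProduct χh ε t ψ g + dampedProduct χh ε t ψ h := by
  simp_rw [dampedProduct_eq_integral, dampedIntegrand_add hg hh]
  rw [integral_add (integrable_dampedIntegrand hχ hε hψ hg t)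
    (integrable_dampedIntegrand hχ hε hψ hh t), mul_add]

theorem dampedProduct_const_mul (c : ℂ) (t : ℝ) :
    dampedProduct χh ε t ψ (fun ζ => c * g ζ) = c * dampedProduct χh ε t ψ g := by
  have : ∀ x, dampedIntegrand χh ε t ψ (fun ζ => c * g ζ) x
      = c * dampedIntegrand χh ε t ψ g x := fun x => by
    unfold dampedIntegrand
    rw [deriv_const_mul_field]
    ring
  simp_rw [dampedProduct_eq_integral, this]
  rw [integral_const_mul, mul_left_comm]

theorem dampedProduct_sum (hχ : IsSuitableDamper χh) (hε : 0 < ε) (hψ : ContDiff ℝ ∞ ψ)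
    {ι : Type*} (s : Finset ι) {f : ι → Spacetime → ℂ} (hf : ∀ i, ContDiff ℝ ∞ (f i)) (t : ℝ) :
    dampedProduct χh ε t ψ (fun ζ => ∑ i ∈ s, f i ζ)
      = ∑ i ∈ s, dampedProduct χh ε t ψ (f i) := by
  classical
  induction s using Finset.induction_on with
  | empty => simpa using dampedProduct_const_mul (χh := χh) (ε := ε) (ψ := ψ) (g := 0) 0 t
  | insert i s hi ih =>
    simp_rw [Finset.sum_insert hi]
    rw [dampedProduct_add hχ hε hψ (hf i) (ContDiff.sum fun i _ => hf i), ih]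

/-- The integrands in two different variables commute since mixed time derivatives do. -/
theorem dampedIntegrand_comm {G : Spacetime → Spacetime → ℂ}
    (hG : ContDiff ℝ ∞ (Function.uncurry G)) (t : ℝ) (x y : Space) :
    dampedIntegrand χh ε t ψ₁ (fun η => dampedIntegrand χh ε t ψ₂ (G η) y) x
      = dampedIntegrand χh ε t ψ₂ (fun ζ => dampedIntegrand χh ε t ψ₁ (fun η => G η ζ) x) y := by
  set F : ℝ → ℝ → ℂ := fun s r => G (s, x) (r, y) with hF
  have hFs : ContDiff ℝ ∞ (Function.uncurry F) := hG.comp (by fun_prop :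
    ContDiff ℝ ∞ fun p : ℝ × ℝ => (((p.1, x), (p.2, y)) : Spacetime × Spacetime))
  have hFs' : ContDiff ℝ ∞ (Function.uncurry fun r s => F s r) := hFs.comp (by fun_prop :
    ContDiff ℝ ∞ fun p : ℝ × ℝ => (p.2, p.1))
  have d1 : DifferentiableAt ℝ (fun s => deriv (F s) t) t :=
    (contDiff_deriv_param hFs contDiff_const).differentiable (by simp) t
  have d2 : DifferentiableAt ℝ (fun r => deriv (fun s => F s r) t) t :=
    (contDiff_deriv_param hFs' contDiff_const).differentiable (by simp) t
  have d3 : DifferentiableAt ℝ (fun s => F s t) t :=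
    (hFs.comp (by fun_prop : ContDiff ℝ ∞ fun s : ℝ => (s, t))).differentiable (by simp) t
  have d4 : DifferentiableAt ℝ (fun r => F t r) t :=
    (hFs.comp (by fun_prop : ContDiff ℝ ∞ fun r : ℝ => (t, r))).differentiable (by simp) t
  have hc := deriv_deriv_comm hFs t t
  have e1 : ∀ a b c : ℂ, deriv (fun s => (a * deriv (F s) t - b * F s t) * c) t
      = (a * deriv (fun s => deriv (F s) t) t - b * deriv (fun s => F s t) t) * c :=
    fun a b c => (((d1.hasDerivAt.const_mul a).sub (d3.hasDerivAt.const_mul b)).mul_const c).deriv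
  have e2 : ∀ a b c : ℂ, deriv (fun r => (a * deriv (fun s => F s r) t - b * F t r) * c) t
      = (a * deriv (fun r => deriv (fun s => F s r) t) t - b * deriv (fun r => F t r) t) * c :=
    fun a b c => (((d2.hasDerivAt.const_mul a).sub (d4.hasDerivAt.const_mul b)).mul_const c).deriv
  unfold dampedIntegrand
  simp only [hF] at e1 e2 hc
  rw [e1, e2, hc]
  ring

theorem dampedIntegrand_integral (hχ : IsSuitableDamper χh) (hε : 0 < ε)
    (hψ₂ : ContDiff ℝ ∞ ψ₂) {G : Spacetime → Spacetime → ℂ}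
    (hG : ContDiff ℝ ∞ (Function.uncurry G)) (t : ℝ) (x : Space) :
    dampedIntegrand χh ε t ψ₁ (fun η => ∫ y, dampedIntegrand χh ε t ψ₂ (G η) y) x
      = ∫ y, dampedIntegrand χh ε t ψ₁ (fun η => dampedIntegrand χh ε t ψ₂ (G η) y) x := by
  have hGs : ContDiff ℝ ∞ (Function.uncurry fun (s : ℝ) (y : Space) =>
      dampedIntegrand χh ε t ψ₂ (G (s, x)) y) :=
    contDiff_dampedIntegrand (P := ℝ × Space) (g := fun p => G (p.1, x)) hχ hψ₂
      (hG.comp (by fun_prop : ContDiff ℝ ∞ fun p : (ℝ × Space) × Spacetime => ((p.1.1, x), p.2)))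
      contDiff_snd t
  have hK := hχ.hasCompactSupport_scaled hε
  have hd := hasDerivAt_integral_of_compact (μ := volume) hGs hK
    (fun s y hy => dampedIntegrand_eq_zero hy t) t
  have i1 := integrable_slice (μ := volume) hGs.continuous hK
    (fun s y hy => dampedIntegrand_eq_zero hy t) t
  have hGd : ContDiff ℝ ∞ (Function.uncurry fun (r : ℝ) (y : Space) =>
      deriv (fun s => dampedIntegrand χh ε t ψ₂ (G (s, x)) y) r) :=
    contDiff_deriv_param (P := ℝ × Space)
      (F := fun p s => dampedIntegrand χh ε t ψ₂ (G (s, x)) p.2)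
      (hGs.comp (by fun_prop : ContDiff ℝ ∞ fun p : (ℝ × Space) × ℝ => (p.2, p.1.2))) contDiff_fst
  have i2 := integrable_slice (μ := volume) hGd.continuous hK (fun r y hy => by
    simp [dampedIntegrand_eq_zero hy]) t
  change (conj (ψ₁ (t, x)) * deriv (fun s => ∫ y, dampedIntegrand χh ε t ψ₂ (G (s, x)) y) t
    - deriv (fun s => conj (ψ₁ (s, x))) t * ∫ y, dampedIntegrand χh ε t ψ₂ (G (t, x)) y) * _ = _
  rw [hd.deriv, ← integral_const_mul, ← integral_const_mul,
    ← integral_sub (i2.const_mul _) (i1.const_mul _), ← integral_mul_const]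
  rfl

/-- Scalar products in two different variables commute. -/
theorem dampedProduct_comm (hχ : IsSuitableDamper χh) (hε : 0 < ε) (hψ₁ : ContDiff ℝ ∞ ψ₁)
    (hψ₂ : ContDiff ℝ ∞ ψ₂) {G : Spacetime → Spacetime → ℂ}
    (hG : ContDiff ℝ ∞ (Function.uncurry G)) (t : ℝ) :
    dampedProduct χh ε t ψ₁ (fun η => dampedProduct χh ε t ψ₂ (G η))
      = dampedProduct χh ε t ψ₂ (fun ζ => dampedProduct χh ε t ψ₁ (fun η => G η ζ)) := by
  have hG' : ContDiff ℝ ∞ (Function.uncurry fun ζ η => G η ζ) :=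
    hG.comp (by fun_prop : ContDiff ℝ ∞ fun p : Spacetime × Spacetime => (p.2, p.1))
  have e1 : dampedProduct χh ε t ψ₁ (fun η => dampedProduct χh ε t ψ₂ (G η))
      = Complex.I * (Complex.I * ∫ x, ∫ y,
        dampedIntegrand χh ε t ψ₁ (fun η => dampedIntegrand χh ε t ψ₂ (G η) y) x) := by
    simp_rw [dampedProduct_eq_integral χh ε t ψ₂]
    rw [dampedProduct_const_mul, dampedProduct_eq_integral]
    simp_rw [dampedIntegrand_integral hχ hε hψ₂ hG]
  have e2 : dampedProduct χh ε t ψ₂ (fun ζ => dampedProduct χh ε t ψ₁ (fun η => G η ζ))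
      = Complex.I * (Complex.I * ∫ y, ∫ x, dampedIntegrand χh ε t ψ₂
        (fun ζ => dampedIntegrand χh ε t ψ₁ (fun η => G η ζ) x) y) := by
    simp_rw [dampedProduct_eq_integral χh ε t ψ₁]
    rw [dampedProduct_const_mul, dampedProduct_eq_integral]
    simp_rw [dampedIntegrand_integral hχ hε hψ₁ hG']
  rw [e1, e2, integral_integral_swap]
  · simp_rw [dampedIntegrand_comm hG]
  · have hin : ContDiff ℝ ∞ (Function.uncurry fun (p : Space × Space) (η : Spacetime) =>
        dampedIntegrand χh ε t ψ₂ (G η) p.2) :=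
      contDiff_dampedIntegrand (P := (Space × Space) × Spacetime) (g := fun p => G p.2) hχ hψ₂
        (hG.comp (by fun_prop : ContDiff ℝ ∞
          fun q : ((Space × Space) × Spacetime) × Spacetime => (q.1.2, q.2)))
        (by fun_prop : ContDiff ℝ ∞ fun q : (Space × Space) × Spacetime => q.1.2) t
    have hc := hχ.hasCompactSupport_scaled hε
    refine (contDiff_dampedIntegrand (P := Space × Space) (u := Prod.fst) hχ hψ₁ hin
      contDiff_fst t).continuous.integrable_of_hasCompactSupport
      (HasCompactSupport.intro (hc.prod hc) fun p hp => ?_)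
    by_cases h1 : p.1 ∈ tsupport fun x : Space => ((χh (ε • x) : ℝ) : ℂ)
    · have h2 : p.2 ∉ tsupport fun x : Space => ((χh (ε • x) : ℝ) : ℂ) := fun h2 => hp ⟨h1, h2⟩
      simp_rw [dampedIntegrand_eq_zero h2]
      simp [dampedIntegrand]
    · exact dampedIntegrand_eq_zero h1 t

end DampedProduct

/-! ### Commutation relations of creation and annihilation operators -/

section CCR

variable {χh : Space → ℝ} {ε : ℝ} {ψ ψ₁ ψ₂ : Spacetime → ℂ} {Φ Ψ : FockSeq}

theorem annihilation_add (hχ : IsSuitableDamper χh) (hε : 0 < ε) (hψ : ContDiff ℝ ∞ ψ)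
    (hΦ : ∀ n, ContDiff ℝ ∞ (Φ n)) (hΨ : ∀ n, ContDiff ℝ ∞ (Ψ n)) (t : ℝ) :
    annihilation χh ε t ψ (Φ + Ψ) = annihilation χh ε t ψ Φ + annihilation χh ε t ψ Ψ := by
  funext n ξ
  change _ * dampedProduct χh ε t ψ (fun ζ => Φ (n + 1) (Fin.snoc (α := fun _ => Spacetime) ξ ζ)
    + Ψ (n + 1) (Fin.snoc (α := fun _ => Spacetime) ξ ζ)) = _
  rw [dampedProduct_add hχ hε hψ
    (g := fun ζ => Φ (n + 1) (Fin.snoc (α := fun _ => Spacetime) ξ ζ))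
    (h := fun ζ => Ψ (n + 1) (Fin.snoc (α := fun _ => Spacetime) ξ ζ))
    (contDiff_snoc (hΦ _) contDiff_const contDiff_id)
    (contDiff_snoc (hΨ _) contDiff_const contDiff_id), mul_add]
  rfl

theorem annihilation_smul (c : ℂ) (t : ℝ) :
    annihilation χh ε t ψ (c • Φ) = c • annihilation χh ε t ψ Φ := by
  funext n ξ
  change _ * dampedProduct χh ε t ψ
    (fun ζ => c * Φ (n + 1) (Fin.snoc (α := fun _ => Spacetime) ξ ζ)) = _
  rw [dampedProduct_const_mul, mul_left_comm]
  rfl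

/-- Annihilation operators commute: the order of the two contractions is exchanged by Fubini's
theorem and the symmetry of the wave function. -/
theorem annihilation_comm (hχ : IsSuitableDamper χh) (hε : 0 < ε) (hψ₁ : ContDiff ℝ ∞ ψ₁)
    (hψ₂ : ContDiff ℝ ∞ ψ₂) (hΦ : ∀ n, IsWaveFunction (Φ n)) (t : ℝ) :
    annihilation χh ε t ψ₁ (annihilation χh ε t ψ₂ Φ)
      = annihilation χh ε t ψ₂ (annihilation χh ε t ψ₁ Φ) := by
  funext n ξ
  have hG : ContDiff ℝ ∞ (Function.uncurry fun η ζ : Spacetime => Φ (n + 2)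
      (Fin.snoc (α := fun _ => Spacetime) (Fin.snoc (α := fun _ => Spacetime) ξ η) ζ)) :=
    contDiff_snoc (hΦ _).smooth (contDiff_pi.2 fun j => by
      refine Fin.lastCases ?_ (fun i => ?_) j
      · simpa using contDiff_fst
      · simpa using contDiff_const) contDiff_snd
  unfold annihilation
  rw [dampedProduct_const_mul, dampedProduct_const_mul, dampedProduct_comm hχ hε hψ₁ hψ₂ hG]
  congr 3
  funext ζ
  congr 1
  funext η
  rw [← (hΦ (n + 2)).symm (Equiv.swap (Fin.last (n + 1)) (Fin.last n).castSucc)]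
  congr 1
  funext j
  refine Fin.lastCases ?_ (fun i => Fin.lastCases ?_ (fun k => ?_) i) j
  · simp
  · simp
  · rw [Equiv.swap_apply_of_ne_of_ne (Fin.castSucc_ne_last _)
      (fun h => Fin.castSucc_ne_last k (Fin.castSucc_injective _ h))]
    simp

theorem snoc_swap_castSucc {n : ℕ} (ξ : Fin n → Spacetime) (ζ : Spacetime) (k j : Fin n) :
    Fin.snoc (α := fun _ => Spacetime) ξ ζ (Equiv.swap k.castSucc (Fin.last n) j.castSucc)
      = Function.update ξ k ζ j := by
  by_cases h : j = k
  · subst h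
    simp
  · rw [Equiv.swap_apply_of_ne_of_ne (fun h' => h (Fin.castSucc_injective _ h'))
      (Fin.castSucc_ne_last _), Function.update_of_ne h, Fin.snoc_castSucc]

theorem snoc_comp_swap {n : ℕ} (ξ : Fin (n + 1) → Spacetime) (ζ : Spacetime) (k : Fin (n + 1)) :
    Fin.snoc (α := fun _ => Spacetime)
      (fun j : Fin n => ξ (Equiv.swap k (Fin.last n) j.castSucc)) ζ
      = fun j => Function.update ξ k ζ (Equiv.swap k (Fin.last n) j) := by
  funext j
  refine Fin.lastCases ?_ (fun i => ?_) j
  · simp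
  · have h : Equiv.swap k (Fin.last n) i.castSucc ≠ k := fun h =>
      Fin.castSucc_ne_last i
        ((Equiv.swap k (Fin.last n)).injective (h.trans (Equiv.swap_apply_right k _).symm))
    rw [Function.update_of_ne h, Fin.snoc_castSucc]

theorem contDiff_update {n : ℕ} {f : (Fin n → Spacetime) → ℂ} (hf : ContDiff ℝ ∞ f)
    (ξ : Fin n → Spacetime) (k : Fin n) :
    ContDiff ℝ ∞ fun ζ : Spacetime => f (Function.update ξ k ζ) :=
  hf.comp (_root_.contDiff_update ∞ ξ k)

/-- The commutator of an annihilation and a creation operator: contracting the new particle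
gives the scalar product, the other contractions cancel. -/
theorem annihilation_creation (hχ : IsSuitableDamper χh) (hε : 0 < ε) (hψ₁ : ContDiff ℝ ∞ ψ₁)
    (hψ₂ : ContDiff ℝ ∞ ψ₂) (hΦ : ∀ n, IsWaveFunction (Φ n)) (t : ℝ) :
    annihilation χh ε t ψ₁ (creation ψ₂ Φ)
      = creation ψ₂ (annihilation χh ε t ψ₁ Φ) + dampedProduct χh ε t ψ₁ ψ₂ • Φ := by
  have hsq0 : ∀ n : ℕ, (Real.sqrt ((n : ℝ) + 1) : ℂ) ≠ 0 := fun n =>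
    Complex.ofReal_ne_zero.2 (Real.sqrt_ne_zero'.2 (by positivity))
  have h1 : ∀ (n : ℕ) (ξ : Fin n → Spacetime), annihilation χh ε t ψ₁ (creation ψ₂ Φ) n ξ
      = dampedProduct χh ε t ψ₁ ψ₂ * Φ n ξ + ∑ k, ψ₂ (ξ k) *
        dampedProduct χh ε t ψ₁ (fun ζ => Φ n (Function.update ξ k ζ)) := by
    intro n ξ
    have hs : ∀ ζ, creation ψ₂ Φ (n + 1) (Fin.snoc (α := fun _ => Spacetime) ξ ζ)
        = (Real.sqrt ((n : ℝ) + 1) : ℂ)⁻¹ * (Φ n ξ * ψ₂ ζ +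
          ∑ k, ψ₂ (ξ k) * Φ n (Function.update ξ k ζ)) := fun ζ => by
      rw [creation_succ_apply ψ₂ (hΦ n).symm, Fin.sum_univ_castSucc]
      simp only [snoc_swap_castSucc, Fin.snoc_castSucc, Fin.snoc_last, Equiv.swap_self,
        Equiv.refl_apply]
      rw [mul_comm (ψ₂ ζ), add_comm (∑ _, _)]
    have hu : ∀ k : Fin n, ContDiff ℝ ∞ fun ζ => ψ₂ (ξ k) * Φ n (Function.update ξ k ζ) :=
      fun k => contDiff_const.mul (contDiff_update (hΦ n).smooth ξ k)
    unfold annihilation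
    simp_rw [hs]
    rw [dampedProduct_const_mul, mul_inv_cancel_left₀ (hsq0 n),
      dampedProduct_add hχ hε hψ₁ (contDiff_const.mul hψ₂) (ContDiff.sum fun k _ => hu k),
      dampedProduct_const_mul, dampedProduct_sum hχ hε hψ₁ _ hu, mul_comm]
    simp_rw [dampedProduct_const_mul]
  funext n ξ
  rw [h1, add_comm, Pi.add_apply, Pi.add_apply, Pi.smul_apply, Pi.smul_apply, smul_eq_mul]
  congr 1
  cases n with
  | zero => simp [creation]
  | succ n =>
    rw [creation_succ_apply ψ₂ (isWaveFunction_annihilation hχ hε hψ₁ hΦ t n).symm,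
      Finset.mul_sum]
    refine Finset.sum_congr rfl fun k _ => ?_
    unfold annihilation
    rw [mul_left_comm, inv_mul_cancel_left₀ (hsq0 n)]
    simp_rw [snoc_comp_swap, (hΦ (n + 1)).symm]

/-- The Segal-type field operator `a⁺(ψ) + a⁻(ψ)`. -/
noncomputable def fieldOp (χh : Space → ℝ) (ε t : ℝ) (ψ : Spacetime → ℂ) (Φ : FockSeq) :
    FockSeq :=
  creation ψ Φ + annihilation χh ε t ψ Φ

theorem isWaveFunction_fieldOp (hχ : IsSuitableDamper χh) (hε : 0 < ε) (hψ : IsOneParticle ψ)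
    (hΦ : ∀ n, IsWaveFunction (Φ n)) (t : ℝ) (n : ℕ) :
    IsWaveFunction (fieldOp χh ε t ψ Φ n) :=
  (isWaveFunction_creation hψ hΦ n).add (isWaveFunction_annihilation hχ hε hψ.smooth hΦ t n)

theorem fieldOp_commutator (hχ : IsSuitableDamper χh) (hε : 0 < ε) (hψ₁ : IsOneParticle ψ₁)
    (hψ₂ : IsOneParticle ψ₂) (hΦ : ∀ n, IsWaveFunction (Φ n)) (t : ℝ) :
    fieldOp χh ε t ψ₁ (fieldOp χh ε t ψ₂ Φ) - fieldOp χh ε t ψ₂ (fieldOp χh ε t ψ₁ Φ)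
      = (dampedProduct χh ε t ψ₁ ψ₂ - dampedProduct χh ε t ψ₂ ψ₁) • Φ := by
  have hc := fun {ψ} (h : IsOneParticle ψ) n => (isWaveFunction_creation h hΦ n).smooth
  have ha := fun {ψ} (h : IsOneParticle ψ) n =>
    (isWaveFunction_annihilation hχ hε h.smooth hΦ t n).smooth
  simp only [fieldOp, creation_add]
  rw [annihilation_add hχ hε hψ₁.smooth (hc hψ₂) (ha hψ₂),
    annihilation_add hχ hε hψ₂.smooth (hc hψ₁) (ha hψ₁),
    annihilation_creation hχ hε hψ₁.smooth hψ₂.smooth hΦ,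
    annihilation_creation hχ hε hψ₂.smooth hψ₁.smooth hΦ,
    annihilation_comm hχ hε hψ₁.smooth hψ₂.smooth hΦ, creation_comm ψ₁ ψ₂, sub_smul]
  abel

/-- The field operator as an endomorphism of the space of finite-particle states. -/
noncomputable def fieldEnd (hχ : IsSuitableDamper χh) (hε : 0 < ε) (t : ℝ)
    (hψ : IsOneParticle ψ) : Module.End ℂ FiniteParticle where
  toFun Φ := ⟨fieldOp χh ε t ψ Φ, by
    obtain ⟨N, hN⟩ := Φ.2.1
    refine ⟨⟨N + 1, fun n hn => ?_⟩, isWaveFunction_fieldOp hχ hε hψ Φ.2.2 t⟩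
    obtain ⟨m, rfl⟩ := Nat.exists_eq_add_of_le' (Nat.one_le_of_lt hn)
    funext ξ
    have h1 := hN m (by omega)
    have h2 := hN (m + 1 + 1) (by omega)
    simp [fieldOp, creation, annihilation, sym, dampedProduct, h1, h2]⟩
  map_add' Φ Ψ := by
    ext1
    change creation ψ ((Φ : FockSeq) + Ψ) + annihilation χh ε t ψ ((Φ : FockSeq) + Ψ)
      = (creation ψ Φ + annihilation χh ε t ψ Φ) + (creation ψ Ψ + annihilation χh ε t ψ Ψ)
    rw [creation_add, annihilation_add hχ hε hψ.smooth (fun n => (Φ.2.2 n).smooth)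
      (fun n => (Ψ.2.2 n).smooth)]
    abel
  map_smul' c Φ := by
    ext1
    change creation ψ (c • (Φ : FockSeq)) + annihilation χh ε t ψ (c • (Φ : FockSeq))
      = c • (creation ψ Φ + annihilation χh ε t ψ Φ)
    rw [creation_smul, annihilation_smul, smul_add]

/-- The commutator of two field operators is a number. -/
theorem fieldEnd_commutator (hχ : IsSuitableDamper χh) (hε : 0 < ε) (t : ℝ)
    (hψ₁ : IsOneParticle ψ₁) (hψ₂ : IsOneParticle ψ₂) :
    fieldEnd hχ hε t hψ₁ * fieldEnd hχ hε t hψ₂ - fieldEnd hχ hε t hψ₂ * fieldEnd hχ hε t hψ₁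
      = (dampedProduct χh ε t ψ₁ ψ₂ - dampedProduct χh ε t ψ₂ ψ₁) •
        (1 : Module.End ℂ FiniteParticle) := by
  ext1 Φ
  ext1
  exact fieldOp_commutator hχ hε hψ₁ hψ₂ Φ.2.2 t

end CCR

/-! ### The Fourier transformation on Schwartz functions -/

open scoped FourierTransform in
/-- The physicists' sign and normalization: `fourier` is Mathlib's inverse transform, rescaled. -/
theorem fourier_eq_fourierInv (f : Space → ℂ) (x : Space) :
    fourier f x = 𝓕⁻ f ((2 * Real.pi)⁻¹ • x) := by
  rw [Real.fourierInv_eq']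
  unfold fourier
  congr 1 with p
  rw [inner_smul_right, real_inner_comm, smul_eq_mul, mul_inv_cancel_left₀ (by positivity),
    mul_comm Complex.I]

/-- Dilations as continuous linear equivalences. -/
noncomputable def dilation (c : ℝ) (hc : c ≠ 0) : Space ≃L[ℝ] Space :=
  ContinuousLinearEquiv.smulLeft (Units.mk0 c hc)

theorem dilation_apply (c : ℝ) (hc : c ≠ 0) (x : Space) : dilation c hc x = c • x := rfl

open scoped FourierTransform in
theorem exists_schwartz_fourier (s : 𝓢(Space, ℂ)) : ∃ s' : 𝓢(Space, ℂ), ⇑s' = fourier s := by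
  refine ⟨SchwartzMap.compCLMOfContinuousLinearEquiv ℂ
    (dilation (2 * Real.pi)⁻¹ (by positivity)) (𝓕⁻ s), funext fun x => ?_⟩
  rw [SchwartzMap.compCLMOfContinuousLinearEquiv_apply, Function.comp_apply, dilation_apply,
    fourier_eq_fourierInv, SchwartzMap.fourierInv_coe]

theorem fourier_conj (u : Space → ℂ) (z : Space) :
    conj (fourier u z) = fourier (fun p => conj (u (-p))) z := by
  unfold fourier
  rw [← integral_conj, ← integral_neg_eq_self]
  congr 1 with p
  rw [map_mul, ← Complex.exp_conj]
  simp

/-! ### Wave packets -/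

theorem energy_pos {m : ℝ} (hm : 0 < m) (p : Space) : 0 < energy m p :=
  Real.sqrt_pos.2 (by positivity)

theorem contDiff_energy {m : ℝ} (hm : 0 < m) : ContDiff ℝ ∞ (energy m) :=
  ((contDiff_id.norm_sq ℝ).add contDiff_const).sqrt fun p => by positivity

theorem energy_neg (m : ℝ) (p : Space) : energy m (-p) = energy m p := by simp [energy]

/-- The components `(-E_p, p)` of the momentum four-vector. -/
noncomputable def momentum (m : ℝ) : Fin 4 → Space → ℝ :=
  Fin.cons (fun p => -energy m p) fun j p => p j

theorem contDiff_momentum {m : ℝ} (hm : 0 < m) (i : Fin 4) : ContDiff ℝ ∞ (momentum m i) := by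
  refine Fin.cases (contDiff_energy hm).neg (fun j => ?_) i
  exact (EuclideanSpace.proj (𝕜 := ℝ) j).contDiff

/-- The coordinates of a space-time point. -/
noncomputable def coordL : Fin 4 → (Spacetime →L[ℝ] ℝ) :=
  Fin.cons (ContinuousLinearMap.fst ℝ ℝ Space) fun j =>
    (EuclideanSpace.proj j).comp (ContinuousLinearMap.snd ℝ ℝ Space)

theorem sum_momentum_mul_coord (m : ℝ) (p : Space) (z : Spacetime) :
    ∑ i, momentum m i p * coordL i z = inner ℝ p z.2 - energy m p * z.1 := by
  simp [momentum, coordL, Fin.sum_univ_succ, PiLp.inner_apply]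
  ring

/-- Multiplication of a complex number by a coordinate function. -/
noncomputable def coordMulL (i : Fin 4) : ℂ →L[ℝ] (Spacetime →L[ℝ] ℂ) :=
  ((ContinuousLinearMap.compL ℝ Spacetime ℂ ℂ).flip (Complex.ofRealCLM.comp (coordL i))).comp
    (ContinuousLinearMap.mul ℝ ℂ)

theorem coordMulL_apply (i : Fin 4) (c : ℂ) (v : Spacetime) :
    coordMulL i c v = c * (coordL i v : ℂ) := rfl

/-- The plane wave `exp i(p·x - E_p t)`. -/
noncomputable def planeWave (m : ℝ) (z : Spacetime) (p : Space) : ℂ :=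
  Complex.exp (Complex.I * ((inner ℝ p z.2 - energy m p * z.1 : ℝ) : ℂ))

theorem contDiff_planeWave {m : ℝ} (hm : 0 < m) :
    ContDiff ℝ ∞ (Function.uncurry (planeWave m)) := by
  have h : ContDiff ℝ ∞ fun q : Spacetime × Space =>
      (inner ℝ q.2 q.1.2 - energy m q.2 * q.1.1 : ℝ) :=
    (contDiff_snd.inner ℝ (by fun_prop)).sub
      (((contDiff_energy hm).comp contDiff_snd).mul (by fun_prop))
  exact (contDiff_const.mul (Complex.ofRealCLM.contDiff.comp h)).cexp

theorem planeWave_sub (m : ℝ) (z a : Spacetime) (p : Space) :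
    planeWave m (z - a) p = planeWave m (-a) p * planeWave m z p := by
  unfold planeWave
  rw [← Complex.exp_add, ← mul_add, ← Complex.ofReal_add]
  congr 3
  simp [inner_sub_right, inner_neg_right]
  ring

theorem hasFDerivAt_planeWave (m : ℝ) (z : Spacetime) (p : Space) :
    HasFDerivAt (fun z => planeWave m z p) (∑ i,
      coordMulL i (Complex.I * momentum m i p * planeWave m z p)) z := by
  set L : Spacetime →L[ℝ] ℝ := ∑ i, momentum m i p • coordL i
  have hL : ∀ z, L z = inner ℝ p z.2 - energy m p * z.1 := fun z => by
    rw [← sum_momentum_mul_coord]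
    simp [L]
  have h := ((Complex.ofRealCLM.comp L).hasFDerivAt (x := z)).const_mul Complex.I |>.cexp
  simp only [ContinuousLinearMap.comp_apply, Complex.ofRealCLM_apply, hL] at h
  refine h.congr_fderiv ?_
  refine ContinuousLinearMap.ext fun v => ?_
  simp only [L, coordMulL_apply, _root_.smul_apply, ContinuousLinearMap.comp_apply,
    _root_.sum_apply, Complex.ofRealCLM_apply, smul_eq_mul, Complex.ofReal_sum,
    Complex.ofReal_mul, Finset.mul_sum]
  refine Finset.sum_congr rfl fun i _ => ?_
  unfold planeWave
  ring

/-- The solution `∫ w(p) exp i(p·x - E_p t) d³p` of the Klein–Gordon equation. -/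
noncomputable def wavePacket (m : ℝ) (w : Space → ℂ) (z : Spacetime) : ℂ :=
  ∫ p : Space, w p * planeWave m z p

theorem wavePacket_sub (m : ℝ) (w : Space → ℂ) (z a : Spacetime) :
    wavePacket m w (z - a) = wavePacket m (fun p => w p * planeWave m (-a) p) z := by
  unfold wavePacket
  simp_rw [planeWave_sub m z a, mul_assoc]

theorem wavePacket_eq_fourier (m : ℝ) (w : Space → ℂ) (t : ℝ) (x : Space) :
    wavePacket m w (t, x) = fourier (fun p => w p * planeWave m (t, 0) p) x := by
  unfold wavePacket fourier
  congr 1 with p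
  rw [mul_left_comm]
  congr 1
  unfold planeWave
  rw [← Complex.exp_add, ← mul_add, ← Complex.ofReal_add]
  congr 3
  simp [real_inner_comm]
  ring

theorem wavePacket_zero_time (m : ℝ) (w : Space → ℂ) (x : Space) :
    wavePacket m w (0, x) = fourier w x := by
  rw [wavePacket_eq_fourier]
  simp [planeWave]

section

variable {m : ℝ} {w : Space → ℂ}

theorem contDiff_wavePacket_integrand (hm : 0 < m) (hw : ContDiff ℝ ∞ w) :
    ContDiff ℝ ∞ (Function.uncurry fun (z : Spacetime) p => w p * planeWave m z p) :=
  (hw.comp contDiff_snd).mul (contDiff_planeWave hm)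

theorem wavePacket_integrand_eq_zero (z : Spacetime) {p : Space} (hp : p ∉ tsupport w) :
    w p * planeWave m z p = 0 := by
  rw [image_eq_zero_of_notMem_tsupport hp, zero_mul]

theorem contDiff_wavePacket (hm : 0 < m) (hw : ContDiff ℝ ∞ w) (hc : HasCompactSupport w) :
    ContDiff ℝ ∞ (wavePacket m w) :=
  contDiff_integral_of_compact (contDiff_wavePacket_integrand hm hw) hc
    fun z _ hp => wavePacket_integrand_eq_zero z hp

theorem contDiff_momentum_weight (hm : 0 < m) (hw : ContDiff ℝ ∞ w) (i : Fin 4) :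
    ContDiff ℝ ∞ fun p => Complex.I * momentum m i p * w p :=
  (contDiff_const.mul (Complex.ofRealCLM.contDiff.comp (contDiff_momentum hm i))).mul hw

/-- Differentiating a wave packet multiplies its weight by the momentum. -/
theorem hasFDerivAt_wavePacket (hm : 0 < m) (hw : ContDiff ℝ ∞ w) (hc : HasCompactSupport w)
    (z : Spacetime) :
    HasFDerivAt (wavePacket m w)
      (∑ i, coordMulL i (wavePacket m (fun p => Complex.I * momentum m i p * w p) z)) z := by
  have hG := contDiff_wavePacket_integrand hm hw
  have h := hasFDerivAt_integral_of_compact (μ := volume) hG hc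
    (fun z _ hp => wavePacket_integrand_eq_zero z hp) z
  refine h.congr_fderiv ?_
  have hi : ∀ i, Integrable fun p => Complex.I * momentum m i p * w p * planeWave m z p :=
    fun i => integrable_slice (G := fun z p => Complex.I * momentum m i p * w p * planeWave m z p)
      (contDiff_wavePacket_integrand hm (contDiff_momentum_weight hm hw i)).continuous
      (hc.mul_left (f := fun p => Complex.I * momentum m i p))
      (fun z _ hp => wavePacket_integrand_eq_zero z hp) z
  refine ContinuousLinearMap.ext fun v => ?_
  have hd : ∀ p, fderiv ℝ (fun z => w p * planeWave m z p) z v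
      = ∑ i, Complex.I * momentum m i p * w p * planeWave m z p * (coordL i v : ℂ) := fun p => by
    rw [((hasFDerivAt_planeWave m z p).const_mul (w p)).fderiv, _root_.smul_apply,
      _root_.sum_apply, Finset.smul_sum]
    refine Finset.sum_congr rfl fun i _ => ?_
    rw [coordMulL_apply, smul_eq_mul]
    ring
  rw [ContinuousLinearMap.integral_apply (integrable_slice (contDiff_fderiv_slice hG).continuous
    hc (fderiv_slice_eq_zero fun z _ hp => wavePacket_integrand_eq_zero z hp) z),
    _root_.sum_apply]
  simp_rw [hd, coordMulL_apply]
  rw [integral_finsetSum _ fun i _ => (hi i).mul_const _]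
  exact Finset.sum_congr rfl fun i _ => integral_mul_const _ _

theorem hasDerivAt_wavePacket_time (hm : 0 < m) (hw : ContDiff ℝ ∞ w) (hc : HasCompactSupport w)
    (t : ℝ) (x : Space) :
    HasDerivAt (fun s => wavePacket m w (s, x))
      (wavePacket m (fun p => -(Complex.I * energy m p * w p)) (t, x)) t := by
  have h := (hasFDerivAt_wavePacket hm hw hc (t, x)).comp_hasDerivAt
    (f := fun s : ℝ => ((s, x) : Spacetime)) t ((hasDerivAt_id t).prodMk (hasDerivAt_const t x))
  refine h.congr_deriv ?_
  have h0 : coordL 0 (1, 0) = 1 := rfl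
  have h1 : ∀ j : Fin 3, coordL j.succ (1, 0) = 0 := fun j => by simp [coordL]
  rw [_root_.sum_apply, Fin.sum_univ_succ]
  simp [coordMulL_apply, h0, h1, momentum]

theorem contDiff_mul_planeWave (hm : 0 < m) (hw : ContDiff ℝ ∞ w) (a : Spacetime) :
    ContDiff ℝ ∞ fun p => w p * planeWave m a p := by
  have h : ContDiff ℝ ∞ fun p => Function.uncurry (planeWave m) (a, p) :=
    (contDiff_planeWave hm).comp (contDiff_const.prodMk contDiff_id)
  exact hw.mul h

theorem hasCompactSupport_mul_planeWave (hc : HasCompactSupport w) (a : Spacetime) :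
    HasCompactSupport fun p => w p * planeWave m a p :=
  HasCompactSupport.mul_right (f := w) (f' := planeWave m a) hc

/-- At a fixed time a wave packet is the Fourier transform of a test function, hence a Schwartz
function. -/
theorem memLp_wavePacket (hm : 0 < m) (hw : ContDiff ℝ ∞ w) (hc : HasCompactSupport w) (t : ℝ) :
    MemLp (fun x => wavePacket m w (t, x)) 2 volume := by
  obtain ⟨s, hs⟩ := exists_schwartz_fourier (HasCompactSupport.toSchwartzMap
    (hasCompactSupport_mul_planeWave (m := m) hc (t, 0)) (contDiff_mul_planeWave hm hw (t, 0)))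
  have h := s.memLp 2 volume
  rw [hs] at h
  simp_rw [wavePacket_eq_fourier]
  exact h

/-- By `hasFDerivAt_wavePacket` every derivative of a wave packet is again composed of wave packets,
so that `memLp_wavePacket` applies to all orders. -/
theorem isOneParticle_wavePacket (hm : 0 < m) (hw : ContDiff ℝ ∞ w) (hc : HasCompactSupport w) :
    IsOneParticle (wavePacket m w) where
  smooth := contDiff_wavePacket hm hw hc
  square_integrable k t := by
    induction k generalizing w with
    | zero => simpa using (memLp_wavePacket hm hw hc t).norm
    | succ k ih =>
      have hs := contDiff_wavePacket hm hw hc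
      set J : Fin 4 → Spacetime → ℂ := fun i =>
        wavePacket m (fun p => Complex.I * momentum m i p * w p)
      have hJ : ∀ i, ContDiff ℝ ∞ (J i) := fun i =>
        contDiff_wavePacket hm (contDiff_momentum_weight hm hw i) hc.mul_left
      have hd : fderiv ℝ (wavePacket m w) = fun z => ∑ i, (coordMulL i ∘ J i) z :=
        funext fun z => (hasFDerivAt_wavePacket hm hw hc z).fderiv
      refine (memLp_finsetSum Finset.univ fun i _ =>
        (ih (contDiff_momentum_weight hm hw i) hc.mul_left).const_mul ‖coordMulL i‖).mono
        (Continuous.aestronglyMeasurable ?_) (Eventually.of_forall fun x => ?_)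
      · exact ((hs.continuous_iteratedFDeriv (m := k + 1) (by exact_mod_cast le_top)).comp
          (by fun_prop : Continuous fun x : Space => ((t, x) : Spacetime))).norm
      · rw [norm_norm, ← norm_iteratedFDeriv_fderiv, hd, iteratedFDeriv_fun_sum_apply fun i _ =>
          ((coordMulL i).contDiff.comp (hJ i)).contDiffAt.of_le (by exact_mod_cast le_top)]
        refine (norm_sum_le _ _).trans (le_trans (Finset.sum_le_sum fun i _ => ?_)
          (le_abs_self _))
        exact (coordMulL i).norm_iteratedFDeriv_comp_left (hJ i).contDiffAt
          (by exact_mod_cast le_top)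

theorem isOneParticle_wavePacket_sub (hm : 0 < m) (hw : ContDiff ℝ ∞ w)
    (hc : HasCompactSupport w) (a : Spacetime) :
    IsOneParticle fun ξ => wavePacket m w (ξ - a) := by
  simp_rw [wavePacket_sub]
  exact isOneParticle_wavePacket hm (contDiff_mul_planeWave hm hw _)
    (hasCompactSupport_mul_planeWave hc _)

end

/-! ### The state functions as wave packets -/

theorem rfourier_neg (ρ : Space → ℝ) (p : Space) : rfourier ρ (-p) = conj (rfourier ρ p) := by
  unfold rfourier fourier
  rw [← integral_conj]
  congr 1 with x
  rw [map_mul, ← Complex.exp_conj]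
  simp

theorem fourier_const_mul (c : ℂ) (u : Space → ℂ) (z : Space) :
    fourier (fun p => c * u p) z = c * fourier u z := by
  unfold fourier
  simp_rw [mul_left_comm _ c]
  exact integral_const_mul _ _

namespace IsSuitableMollifier

variable {ρ : Space → ℝ}

theorem exists_complex_schwartz (hρ : IsSuitableMollifier ρ) :
    ∃ s : 𝓢(Space, ℂ), ⇑s = fun x => (ρ x : ℂ) := by
  obtain ⟨s, rfl⟩ := hρ.schwartz
  exact ⟨s.postcompCLM Complex.ofRealCLM, rfl⟩

theorem exists_schwartz_rfourier (hρ : IsSuitableMollifier ρ) :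
    ∃ h : 𝓢(Space, ℂ), ⇑h = rfourier ρ := by
  obtain ⟨s, hs⟩ := hρ.exists_complex_schwartz
  obtain ⟨h, hh⟩ := exists_schwartz_fourier s
  exact ⟨h, by rw [hh, hs]; rfl⟩

theorem contDiff_rfourier (hρ : IsSuitableMollifier ρ) : ContDiff ℝ ∞ (rfourier ρ) := by
  obtain ⟨h, hh⟩ := hρ.exists_schwartz_rfourier
  exact hh ▸ h.smooth ⊤

theorem hasCompactSupport_rfourier_smul (hρ : IsSuitableMollifier ρ) {ε : ℝ} (hε : 0 < ε) :
    HasCompactSupport fun p : Space => rfourier ρ (ε • p) :=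
  hρ.compact.comp_homeomorph (Homeomorph.smulOfNeZero ε hε.ne')

end IsSuitableMollifier

/-- The weight `(2π)⁻³ (g(p) / 2) ρ̂(ε p)`; the state functions and their time derivatives are
the wave packets for `g = E_p⁻¹, 1, E_p`. -/
noncomputable def shellWeight (ρ : Space → ℝ) (ε : ℝ) (g : Space → ℝ) (p : Space) : ℂ :=
  ((((2 * Real.pi) ^ 3)⁻¹ * (g p / 2) : ℝ) : ℂ) * rfourier ρ (ε • p)

section

variable {m ε : ℝ} {ρ : Space → ℝ} {g : Space → ℝ}

theorem contDiff_shellWeight (hρ : IsSuitableMollifier ρ) (hg : ContDiff ℝ ∞ g) :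
    ContDiff ℝ ∞ (shellWeight ρ ε g) :=
  (Complex.ofRealCLM.contDiff.comp (contDiff_const.mul (hg.div_const 2))).mul
    (hρ.contDiff_rfourier.comp (contDiff_const_smul ε))

theorem hasCompactSupport_shellWeight (hρ : IsSuitableMollifier ρ) (hε : 0 < ε) :
    HasCompactSupport (shellWeight ρ ε g) :=
  (hρ.hasCompactSupport_rfourier_smul hε).mul_left

theorem conj_fourier_shellWeight (hg : ∀ p, g (-p) = g p) (z : Space) :
    conj (fourier (shellWeight ρ ε g) z) = fourier (shellWeight ρ ε g) z := by
  rw [fourier_conj]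
  congr 1 with p
  unfold shellWeight
  rw [hg, smul_neg, rfourier_neg, map_mul, Complex.conj_ofReal, Complex.conj_conj]

theorem contDiff_energy_inv (hm : 0 < m) : ContDiff ℝ ∞ fun p => (energy m p)⁻¹ :=
  (contDiff_energy hm).inv fun p => (energy_pos hm p).ne'

theorem Delta_eq_wavePacket (m : ℝ) (ρ : Space → ℝ) (ε : ℝ) :
    Delta m ρ ε = wavePacket m (shellWeight ρ ε fun p => (energy m p)⁻¹) := by
  funext z
  unfold Delta wavePacket
  rw [← integral_const_mul]
  congr 1 with p
  unfold shellWeight planeWave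
  push_cast
  rw [mul_inv]
  ring

theorem energy_mul_shellWeight_inv (hm : 0 < m) (p : Space) :
    (energy m p : ℂ) * shellWeight ρ ε (fun p => (energy m p)⁻¹) p
      = shellWeight ρ ε (fun _ => 1) p := by
  have : (energy m p : ℂ) ≠ 0 := Complex.ofReal_ne_zero.2 (energy_pos hm p).ne'
  unfold shellWeight
  push_cast
  field_simp

theorem energy_mul_shellWeight_one (p : Space) :
    (energy m p : ℂ) * shellWeight ρ ε (fun _ => 1) p = shellWeight ρ ε (energy m) p := by
  unfold shellWeight
  push_cast
  ring

theorem stateFn_eq (m : ℝ) (ρ : Space → ℝ) (ε t : ℝ) (x : Space) :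
    stateFn m ρ ε t x = fun ξ =>
      wavePacket m (shellWeight ρ ε fun p => (energy m p)⁻¹) (ξ - (t, x)) := by
  funext ξ
  rw [← Delta_eq_wavePacket]
  rfl

theorem hasDerivAt_stateFn (hm : 0 < m) (hρ : IsSuitableMollifier ρ) (hε : 0 < ε) (t : ℝ)
    (x : Space) (ξ : Spacetime) :
    HasDerivAt (fun s => stateFn m ρ ε s x ξ)
      (wavePacket m (fun p => Complex.I * shellWeight ρ ε (fun _ => 1) p) (ξ - (t, x))) t := by
  have h := (hasDerivAt_wavePacket_time hm (contDiff_shellWeight (ε := ε) hρ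
    (contDiff_energy_inv hm)) (hasCompactSupport_shellWeight hρ hε) (ξ.1 - t) (ξ.2 - x)).scomp t
    ((hasDerivAt_id t).const_sub ξ.1)
  simp_rw [stateFn_eq]
  refine h.congr_deriv ?_
  rw [neg_one_smul]
  unfold wavePacket
  rw [← integral_neg]
  congr 1 with p
  change -(-(Complex.I * energy m p * shellWeight ρ ε (fun p => (energy m p)⁻¹) p)
    * planeWave m (ξ - (t, x)) p)
      = Complex.I * shellWeight ρ ε (fun _ => 1) p * planeWave m (ξ - (t, x)) p
  rw [← energy_mul_shellWeight_inv hm]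
  ring

theorem stateFnDot_eq (hm : 0 < m) (hρ : IsSuitableMollifier ρ) (hε : 0 < ε) (t : ℝ)
    (x : Space) :
    stateFnDot m ρ ε t x = fun ξ =>
      wavePacket m (fun p => Complex.I * shellWeight ρ ε (fun _ => 1) p) (ξ - (t, x)) :=
  funext fun ξ => (hasDerivAt_stateFn hm hρ hε t x ξ).deriv

theorem isOneParticle_stateFn (hm : 0 < m) (hρ : IsSuitableMollifier ρ) (hε : 0 < ε) (t : ℝ)
    (x : Space) : IsOneParticle (stateFn m ρ ε t x) := by
  rw [stateFn_eq]
  exact isOneParticle_wavePacket_sub hm (contDiff_shellWeight hρ (contDiff_energy_inv hm))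
    (hasCompactSupport_shellWeight hρ hε) _

theorem isOneParticle_stateFnDot (hm : 0 < m) (hρ : IsSuitableMollifier ρ) (hε : 0 < ε) (t : ℝ)
    (x : Space) : IsOneParticle (stateFnDot m ρ ε t x) := by
  rw [stateFnDot_eq hm hρ hε]
  exact isOneParticle_wavePacket_sub hm (contDiff_const.mul (contDiff_shellWeight hρ
    contDiff_const)) (HasCompactSupport.mul_left (f := fun _ => Complex.I)
    (hasCompactSupport_shellWeight hρ hε)) _

/-! ### The field is differentiable in time -/

theorem contDiff_stateFn_uncurry (hm : 0 < m) (hρ : IsSuitableMollifier ρ) (hε : 0 < ε)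
    (x : Space) : ContDiff ℝ ∞ fun q : ℝ × Spacetime => stateFn m ρ ε q.1 x q.2 := by
  simp_rw [stateFn_eq]
  exact (contDiff_wavePacket hm (contDiff_shellWeight hρ (contDiff_energy_inv hm))
    (hasCompactSupport_shellWeight hρ hε)).comp (by fun_prop :
      ContDiff ℝ ∞ fun q : ℝ × Spacetime => q.2 - ((q.1, x) : Spacetime))

theorem hasDerivAt_creation (hm : 0 < m) (hρ : IsSuitableMollifier ρ) (hε : 0 < ε) (t : ℝ)
    (x : Space) (Φ : FockSeq) (n : ℕ) (ξ : Fin n → Spacetime) :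
    HasDerivAt (fun s => creation (stateFn m ρ ε s x) Φ n ξ)
      (creation (stateFnDot m ρ ε t x) Φ n ξ) t := by
  cases n with
  | zero => exact hasDerivAt_const t 0
  | succ n =>
    simp only [creation, sym]
    refine ((HasDerivAt.fun_sum fun σ _ => HasDerivAt.mul_const ?_ _).const_mul _).const_mul _
    rw [stateFnDot_eq hm hρ hε]
    exact hasDerivAt_stateFn hm hρ hε t x _

theorem hasDerivAt_conj_stateFn (hm : 0 < m) (hρ : IsSuitableMollifier ρ) (hε : 0 < ε) (t : ℝ)
    (x : Space) (ξ : Spacetime) :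
    HasDerivAt (fun s => conj (stateFn m ρ ε s x ξ)) (conj (stateFnDot m ρ ε t x ξ)) t := by
  rw [stateFnDot_eq hm hρ hε]
  exact (hasDerivAt_stateFn hm hρ hε t x ξ).star

theorem contDiff_conj_stateFn (hm : 0 < m) (hρ : IsSuitableMollifier ρ) (hε : 0 < ε) (x : Space)
    {P : Type} [NormedAddCommGroup P] [NormedSpace ℝ P] {u r : P → ℝ} {y : P → Space}
    (hu : ContDiff ℝ ∞ u) (hr : ContDiff ℝ ∞ r) (hy : ContDiff ℝ ∞ y) :
    ContDiff ℝ ∞ fun p => conj (stateFn m ρ ε (u p) x (r p, y p)) := by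
  have h : ContDiff ℝ ∞ fun p => stateFn m ρ ε (u p) x (r p, y p) :=
    ContDiff.comp (g := fun q : ℝ × Spacetime => stateFn m ρ ε q.1 x q.2)
      (f := fun p => (u p, (r p, y p)))
      (contDiff_stateFn_uncurry hm hρ hε x) (hu.prodMk (hr.prodMk hy))
  exact Complex.conjCLE.contDiff.comp h

theorem hasDerivAt_deriv_conj_stateFn (hm : 0 < m) (hρ : IsSuitableMollifier ρ) (hε : 0 < ε)
    (tξ t : ℝ) (x y : Space) :
    HasDerivAt (fun s => deriv (fun r => conj (stateFn m ρ ε s x (r, y))) tξ)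
      (deriv (fun r => conj (stateFnDot m ρ ε t x (r, y))) tξ) t := by
  have hF : ContDiff ℝ ∞ (Function.uncurry fun s r => conj (stateFn m ρ ε s x (r, y))) :=
    contDiff_conj_stateFn hm hρ hε x contDiff_fst contDiff_snd contDiff_const
  have hdiff : DifferentiableAt ℝ
      (fun s => deriv (fun r => conj (stateFn m ρ ε s x (r, y))) tξ) t :=
    (contDiff_deriv_param hF contDiff_const).differentiable (by simp) t
  refine hdiff.hasDerivAt.congr_deriv ?_
  rw [deriv_deriv_comm hF]
  simp_rw [fun r => (hasDerivAt_conj_stateFn hm hρ hε t x (r, y)).deriv]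

theorem contDiff_dampedIntegrand_stateFn {χh : Space → ℝ} (hχ : IsSuitableDamper χh)
    (hm : 0 < m) (hρ : IsSuitableMollifier ρ) (hε : 0 < ε) (tξ : ℝ) (x : Space)
    {f : Spacetime → ℂ} (hf : ContDiff ℝ ∞ f) :
    ContDiff ℝ ∞ (Function.uncurry fun (s : ℝ) (y : Space) =>
      dampedIntegrand χh ε tξ (stateFn m ρ ε s x) f y) := by
  have h1 : ContDiff ℝ ∞ fun q : ℝ × Space => conj (stateFn m ρ ε q.1 x (tξ, q.2)) :=
    contDiff_conj_stateFn hm hρ hε x contDiff_fst contDiff_const contDiff_snd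
  have h2 : ContDiff ℝ ∞ fun q : ℝ × Space =>
      deriv (fun r => conj (stateFn m ρ ε q.1 x (r, q.2))) tξ :=
    contDiff_deriv_param (F := fun (q : ℝ × Space) r => conj (stateFn m ρ ε q.1 x (r, q.2)))
      (contDiff_conj_stateFn hm hρ hε x (by fun_prop) (by fun_prop) (by fun_prop)) contDiff_const
  have h3 : ContDiff ℝ ∞ fun q : ℝ × Space => deriv (fun r => f (r, q.2)) tξ :=
    contDiff_deriv_param (F := fun (q : ℝ × Space) r => f (r, q.2)) (hf.comp (by fun_prop :
      ContDiff ℝ ∞ fun q : (ℝ × Space) × ℝ => ((q.2, q.1.2) : Spacetime))) contDiff_const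
  have h4 : ContDiff ℝ ∞ fun q : ℝ × Space => f (tξ, q.2) := hf.comp (by fun_prop)
  have h5 : ContDiff ℝ ∞ fun q : ℝ × Space => ((χh (ε • q.2) : ℝ) : ℂ) :=
    (hχ.contDiff_scaled ε).comp contDiff_snd
  exact ((h1.mul h3).sub (h2.mul h4)).mul h5

theorem hasDerivAt_dampedProduct {χh : Space → ℝ} (hχ : IsSuitableDamper χh) (hm : 0 < m)
    (hρ : IsSuitableMollifier ρ) (hε : 0 < ε) (tξ t : ℝ) (x : Space) {f : Spacetime → ℂ}
    (hf : ContDiff ℝ ∞ f) :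
    HasDerivAt (fun s => dampedProduct χh ε tξ (stateFn m ρ ε s x) f)
      (dampedProduct χh ε tξ (stateFnDot m ρ ε t x) f) t := by
  have h := hasDerivAt_integral_of_compact (μ := volume)
    (contDiff_dampedIntegrand_stateFn hχ hm hρ hε tξ x hf) (hχ.hasCompactSupport_scaled hε)
    (fun s y hy => dampedIntegrand_eq_zero hy tξ) t
  have hd : ∀ y, deriv (fun s => dampedIntegrand χh ε tξ (stateFn m ρ ε s x) f y) t
      = dampedIntegrand χh ε tξ (stateFnDot m ρ ε t x) f y := fun y => HasDerivAt.deriv <|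
    ((((hasDerivAt_conj_stateFn hm hρ hε t x (tξ, y)).mul_const _).sub
      ((hasDerivAt_deriv_conj_stateFn hm hρ hε tξ t x y).mul_const _)).mul_const _)
  simp_rw [hd] at h
  exact h.const_mul Complex.I

/-- The conjugate field is the time derivative of the field, pointwise on every component. -/
theorem hasDerivAt_fieldOp {χh : Space → ℝ} (hχ : IsSuitableDamper χh) (hm : 0 < m)
    (hρ : IsSuitableMollifier ρ) (hε : 0 < ε) (tξ t : ℝ) (x : Space) {Φ : FockSeq}
    (hΦ : ∀ n, IsWaveFunction (Φ n)) (n : ℕ) (ξ : Fin n → Spacetime) :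
    HasDerivAt (fun s => fieldOp χh ε tξ (stateFn m ρ ε s x) Φ n ξ)
      (fieldOp χh ε tξ (stateFnDot m ρ ε t x) Φ n ξ) t :=
  (hasDerivAt_creation hm hρ hε t x Φ n ξ).add ((hasDerivAt_dampedProduct hχ hm hρ hε tξ t x
    (f := fun ζ => Φ (n + 1) (Fin.snoc (α := fun _ => Spacetime) ξ ζ))
    (contDiff_snoc (hΦ _).smooth contDiff_const contDiff_id)).const_mul _)

end

/-! ### Equal-time scalar products -/

section EqualTime

variable {m ε : ℝ} {ρ χh : Space → ℝ}

/-- The function `∫ (2π)⁻³ (g(p) / 2) ρ̂(ε p) exp(i p·z) d³p`. -/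
noncomputable def shellFn (ρ : Space → ℝ) (ε : ℝ) (g : Space → ℝ) (z : Space) : ℂ :=
  fourier (shellWeight ρ ε g) z

theorem wavePacket_sub_same_time (m : ℝ) (w : Space → ℂ) (t : ℝ) (x y : Space) :
    wavePacket m w ((t, y) - (t, x)) = fourier w (y - x) := by
  rw [Prod.mk_sub_mk, sub_self, wavePacket_zero_time]

theorem hasDerivAt_wavePacket_sub_same_time (hm : 0 < m) {w : Space → ℂ} (hw : ContDiff ℝ ∞ w)
    (hc : HasCompactSupport w) (t : ℝ) (x y : Space) :
    HasDerivAt (fun s => wavePacket m w ((s, y) - (t, x)))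
      (fourier (fun p => -(Complex.I * energy m p * w p)) (y - x)) t := by
  have h := hasDerivAt_wavePacket_time hm hw hc (t - t) (y - x)
  rw [← wavePacket_zero_time m, ← sub_self t]
  exact h.comp_sub_const t t

theorem stateFn_same_time (m : ℝ) (ρ : Space → ℝ) (ε t : ℝ) (x y : Space) :
    stateFn m ρ ε t x (t, y) = shellFn ρ ε (fun p => (energy m p)⁻¹) (y - x) := by
  simp_rw [stateFn_eq]
  exact wavePacket_sub_same_time ..

theorem hasDerivAt_stateFn_same_time (hm : 0 < m) (hρ : IsSuitableMollifier ρ) (hε : 0 < ε)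
    (t : ℝ) (x y : Space) : HasDerivAt (fun s => stateFn m ρ ε t x (s, y))
      (-Complex.I * shellFn ρ ε (fun _ => 1) (y - x)) t := by
  simp_rw [stateFn_eq]
  refine (hasDerivAt_wavePacket_sub_same_time hm (contDiff_shellWeight hρ
    (contDiff_energy_inv hm)) (hasCompactSupport_shellWeight hρ hε) t x y).congr_deriv ?_
  unfold shellFn
  rw [← fourier_const_mul]
  congr 1 with p
  rw [← energy_mul_shellWeight_inv hm]
  ring

theorem stateFnDot_same_time (hm : 0 < m) (hρ : IsSuitableMollifier ρ) (hε : 0 < ε)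
    (t : ℝ) (x y : Space) :
    stateFnDot m ρ ε t x (t, y) = Complex.I * shellFn ρ ε (fun _ => 1) (y - x) := by
  simp_rw [stateFnDot_eq hm hρ hε]
  rw [wavePacket_sub_same_time, fourier_const_mul]
  rfl

theorem hasDerivAt_stateFnDot_same_time (hm : 0 < m) (hρ : IsSuitableMollifier ρ) (hε : 0 < ε)
    (t : ℝ) (x y : Space) : HasDerivAt (fun s => stateFnDot m ρ ε t x (s, y))
      (shellFn ρ ε (energy m) (y - x)) t := by
  simp_rw [stateFnDot_eq hm hρ hε]
  refine (hasDerivAt_wavePacket_sub_same_time hm (contDiff_const.mul (contDiff_shellWeight hρ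
    contDiff_const)) (HasCompactSupport.mul_left (f := fun _ => Complex.I)
    (hasCompactSupport_shellWeight hρ hε)) t x y).congr_deriv ?_
  unfold shellFn
  congr 1 with p
  rw [← energy_mul_shellWeight_one, show -(Complex.I * energy m p *
    (Complex.I * shellWeight ρ ε (fun _ => 1) p)) = -(Complex.I * Complex.I) *
    (energy m p * shellWeight ρ ε (fun _ => 1) p) by ring, Complex.I_mul_I]
  ring

/-- `shellFn` is real for even `g`, since `ρ` is real. -/
theorem conj_shellFn {g : Space → ℝ} (hg : ∀ p, g (-p) = g p) (z : Space) :
    conj (shellFn ρ ε g z) = shellFn ρ ε g z := conj_fourier_shellWeight hg z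

theorem conj_shellFn_energy_inv (z : Space) : conj (shellFn ρ ε (fun p => (energy m p)⁻¹) z)
    = shellFn ρ ε (fun p => (energy m p)⁻¹) z := conj_shellFn (fun p => by rw [energy_neg]) z

theorem conj_shellFn_one (z : Space) : conj (shellFn ρ ε (fun _ => 1) z)
    = shellFn ρ ε (fun _ => 1) z := conj_shellFn (fun _ => rfl) z

theorem conj_shellFn_energy (z : Space) : conj (shellFn ρ ε (energy m) z)
    = shellFn ρ ε (energy m) z := conj_shellFn (energy_neg m) z

theorem deriv_conj_eq {f : ℝ → ℂ} {f' : ℂ} {t : ℝ} (h : HasDerivAt f f' t) :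
    deriv (fun s => conj (f s)) t = conj f' := h.star.deriv

/-- The scalar product of two equal-time state functions is symmetric, because their values are real
and their time derivatives imaginary. -/
theorem dampedProduct_stateFn_symm (hm : 0 < m) (hρ : IsSuitableMollifier ρ) (hε : 0 < ε)
    (χh : Space → ℝ) (t : ℝ) (x₁ x₂ : Space) :
    dampedProduct χh ε t (stateFn m ρ ε t x₁) (stateFn m ρ ε t x₂)
      = dampedProduct χh ε t (stateFn m ρ ε t x₂) (stateFn m ρ ε t x₁) := by
  unfold dampedProduct
  congr 2 with y
  have h := fun x => hasDerivAt_stateFn_same_time hm hρ hε t x y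
  rw [(h x₁).deriv, (h x₂).deriv, deriv_conj_eq (h x₁), deriv_conj_eq (h x₂), stateFn_same_time,
    stateFn_same_time]
  simp only [map_mul, map_neg, Complex.conj_I, conj_shellFn_one,
    conj_shellFn_energy_inv]
  ring

/-- As for the state functions: here the values are imaginary and the time derivatives real. -/
theorem dampedProduct_stateFnDot_symm (hm : 0 < m) (hρ : IsSuitableMollifier ρ) (hε : 0 < ε)
    (χh : Space → ℝ) (t : ℝ) (x₁ x₂ : Space) :
    dampedProduct χh ε t (stateFnDot m ρ ε t x₁) (stateFnDot m ρ ε t x₂)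
      = dampedProduct χh ε t (stateFnDot m ρ ε t x₂) (stateFnDot m ρ ε t x₁) := by
  unfold dampedProduct
  congr 2 with y
  have h := fun x => hasDerivAt_stateFnDot_same_time hm hρ hε t x y
  rw [(h x₁).deriv, (h x₂).deriv, deriv_conj_eq (h x₁), deriv_conj_eq (h x₂),
    stateFnDot_same_time hm hρ hε, stateFnDot_same_time hm hρ hε]
  simp only [map_mul, Complex.conj_I, conj_shellFn_one, conj_shellFn_energy]
  ring

/-- The density whose damped integral is the commutator of the field and its conjugate. -/
noncomputable def commutatorDensity (m : ℝ) (ρ : Space → ℝ) (ε : ℝ) (x₁ x₂ y : Space) : ℂ :=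
  shellFn ρ ε (fun p => (energy m p)⁻¹) (y - x₁) * shellFn ρ ε (energy m) (y - x₂)
    + shellFn ρ ε (fun _ => 1) (y - x₁) * shellFn ρ ε (fun _ => 1) (y - x₂)

theorem conj_commutatorDensity (x₁ x₂ y : Space) :
    conj (commutatorDensity m ρ ε x₁ x₂ y) = commutatorDensity m ρ ε x₁ x₂ y := by
  simp only [commutatorDensity, map_add, map_mul, conj_shellFn_energy_inv, conj_shellFn_one,
    conj_shellFn_energy]

theorem dampedProduct_stateFn_stateFnDot (hm : 0 < m) (hρ : IsSuitableMollifier ρ) (hε : 0 < ε)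
    (χh : Space → ℝ) (t : ℝ) (x₁ x₂ : Space) :
    dampedProduct χh ε t (stateFn m ρ ε t x₁) (stateFnDot m ρ ε t x₂)
      - dampedProduct χh ε t (stateFnDot m ρ ε t x₂) (stateFn m ρ ε t x₁)
      = Complex.I * (2 * ∫ y, commutatorDensity m ρ ε x₁ x₂ y * ((χh (ε • y) : ℝ) : ℂ)) := by
  have e1 : dampedProduct χh ε t (stateFn m ρ ε t x₁) (stateFnDot m ρ ε t x₂)
      = Complex.I * ∫ y, commutatorDensity m ρ ε x₁ x₂ y * ((χh (ε • y) : ℝ) : ℂ) := by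
    unfold dampedProduct
    congr 2 with y
    rw [(hasDerivAt_stateFnDot_same_time hm hρ hε t x₂ y).deriv,
      deriv_conj_eq (hasDerivAt_stateFn_same_time hm hρ hε t x₁ y), stateFn_same_time,
      stateFnDot_same_time hm hρ hε]
    simp only [map_mul, map_neg, Complex.conj_I, conj_shellFn_one,
      conj_shellFn_energy_inv, commutatorDensity]
    linear_combination (-shellFn ρ ε (fun _ => 1) (y - x₁) * shellFn ρ ε (fun _ => 1) (y - x₂)
      * ((χh (ε • y) : ℝ) : ℂ)) * Complex.I_mul_I
  have e2 : dampedProduct χh ε t (stateFnDot m ρ ε t x₂) (stateFn m ρ ε t x₁)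
      = -(Complex.I * ∫ y, commutatorDensity m ρ ε x₁ x₂ y * ((χh (ε • y) : ℝ) : ℂ)) := by
    unfold dampedProduct
    rw [← mul_neg, ← integral_neg]
    congr 2 with y
    rw [deriv_conj_eq (hasDerivAt_stateFnDot_same_time hm hρ hε t x₂ y),
      (hasDerivAt_stateFn_same_time hm hρ hε t x₁ y).deriv, stateFn_same_time,
      stateFnDot_same_time hm hρ hε]
    simp only [map_mul, Complex.conj_I, conj_shellFn_one,
      conj_shellFn_energy, commutatorDensity]
    linear_combination (shellFn ρ ε (fun _ => 1) (y - x₁) * shellFn ρ ε (fun _ => 1) (y - x₂)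
      * ((χh (ε • y) : ℝ) : ℂ)) * Complex.I_mul_I
  rw [e1, e2]
  ring

end EqualTime

/-! ### The commutator in momentum space -/

theorem continuous_fourier {u : Space → ℂ} (hu : ContDiff ℝ ∞ u) (hc : HasCompactSupport u) :
    Continuous (fourier u) := by
  obtain ⟨s, hs⟩ := exists_schwartz_fourier (hc.toSchwartzMap hu)
  have : ⇑s = fourier u := hs
  exact this ▸ s.continuous

/-- The plane wave phase `exp(i p·x)`. -/
noncomputable def phase (p x : Space) : ℂ := Complex.exp (Complex.I * ((inner ℝ p x : ℝ) : ℂ))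

theorem fourier_eq_phase (u : Space → ℂ) (z : Space) : fourier u z = ∫ p, u p * phase p z := by
  unfold fourier phase
  congr 1 with p
  rw [real_inner_comm, mul_comm]

theorem continuous_phase {X : Type*} [TopologicalSpace X] {f g : X → Space} (hf : Continuous f)
    (hg : Continuous g) : Continuous fun x => phase (f x) (g x) := by
  unfold phase
  fun_prop

theorem integral_phase_damper (χh : Space → ℝ) {ε : ℝ} (hε : 0 < ε) (p : Space) :
    ∫ y, phase (-p) y * ((χh (ε • y) : ℝ) : ℂ)
      = (((2 * Real.pi) ^ 3 : ℝ) : ℂ) *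
        ((((ε ^ 3)⁻¹ : ℝ) : ℂ) * invFourier (fun x => (χh x : ℂ)) (ε⁻¹ • p)) := by
  have h := Measure.integral_comp_smul (volume : Measure Space)
    (fun y => phase (-(ε⁻¹ • p)) y * ((χh y : ℝ) : ℂ)) ε
  have hphase : ∀ y, phase (-(ε⁻¹ • p)) (ε • y) = phase (-p) y := fun y => by
    unfold phase
    rw [← smul_neg, real_inner_smul_left, real_inner_smul_right, inv_mul_cancel_left₀ hε.ne']
  simp only [hphase, finrank_euclideanSpace_fin] at h
  rw [h, abs_of_pos (by positivity), Complex.real_smul]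
  unfold invFourier
  have hpi : (((2 * Real.pi) ^ 3 : ℝ) : ℂ) ≠ 0 :=
    Complex.ofReal_ne_zero.2 (by positivity)
  rw [Complex.ofReal_inv ((2 * Real.pi) ^ 3), mul_left_comm, mul_inv_cancel_left₀ hpi]
  congr 2 with y
  unfold phase
  rw [real_inner_comm]
  simp

/-- The inner momentum integral in the damped product of two Fourier integrals. -/
noncomputable def dampedKernel (χh : Space → ℝ) (ε : ℝ) (v : Space → ℂ) (x₁ x₂ p₁ : Space) : ℂ :=
  ∫ p₂, v p₂ * (phase p₁ x₁ * phase (-p₂) x₂) *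
    ((((ε ^ 3)⁻¹ : ℝ) : ℂ) * invFourier (fun x => (χh x : ℂ)) (ε⁻¹ • (p₁ - p₂)))

/-- Fubini's theorem for a damped product of two Fourier integrals. -/
theorem integral_fourier_mul_fourier_damper {χh : Space → ℝ} (hχ : IsSuitableDamper χh) {ε : ℝ}
    (hε : 0 < ε) {u v : Space → ℂ} (hu : ContDiff ℝ ∞ u) (huc : HasCompactSupport u)
    (hv : ContDiff ℝ ∞ v) (hvc : HasCompactSupport v) (x₁ x₂ : Space) :
    Integrable (fun p₁ => conj (u p₁) * dampedKernel χh ε v x₁ x₂ p₁) ∧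
    ∫ y, conj (fourier u (y - x₁)) * fourier v (y - x₂) * ((χh (ε • y) : ℝ) : ℂ)
      = (((2 * Real.pi) ^ 3 : ℝ) : ℂ) * ∫ p₁, conj (u p₁) * dampedKernel χh ε v x₁ x₂ p₁ := by
  have hχs := hχ.hasCompactSupport_scaled hε
  have hχc := (hχ.contDiff_scaled ε).continuous
  have hconj : ∀ y, conj (fourier u (y - x₁)) = ∫ p, conj (u p) * phase (-p) (y - x₁) := fun y => by
    rw [fourier_eq_phase, ← integral_conj]
    congr 1 with p
    rw [map_mul]
    congr 1
    unfold phase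
    rw [← Complex.exp_conj]
    simp
  have hucc : Continuous fun p => conj (u p) := Complex.continuous_conj.comp hu.continuous
  have hus : HasCompactSupport fun p => conj (u p) := huc.comp_left (map_zero _)
  have hvf := continuous_fourier hv hvc
  have hint : Integrable (Function.uncurry fun y p₁ => conj (u p₁) *
      (phase (-p₁) (y - x₁) * fourier v (y - x₂) * ((χh (ε • y) : ℝ) : ℂ)))
      (volume.prod volume) := by
    refine Continuous.integrable_of_hasCompactSupport ?_
      (HasCompactSupport.intro (hχs.prod hus) fun q hq => ?_)
    · exact (hucc.comp continuous_snd).mul (((continuous_phase continuous_snd.neg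
        (continuous_fst.sub continuous_const)).mul (hvf.comp
        (continuous_fst.sub continuous_const))).mul (hχc.comp continuous_fst))
    · by_cases h1 : q.1 ∈ tsupport fun x : Space => ((χh (ε • x) : ℝ) : ℂ)
      · have h2 : q.2 ∉ tsupport fun p => conj (u p) := fun h2 => hq ⟨h1, h2⟩
        have h3 : conj (u q.2) = 0 := image_eq_zero_of_notMem_tsupport
          (f := fun p => conj (u p)) h2
        simp [Function.uncurry_def, h3]
      · have h3 : ((χh (ε • q.1) : ℝ) : ℂ) = 0 := image_eq_zero_of_notMem_tsupport
          (f := fun x : Space => ((χh (ε • x) : ℝ) : ℂ)) h1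
        simp only [Function.uncurry_def, h3, mul_zero]
  have hin : ∀ p₁, ∫ y, phase (-p₁) (y - x₁) * fourier v (y - x₂) * ((χh (ε • y) : ℝ) : ℂ)
      = (((2 * Real.pi) ^ 3 : ℝ) : ℂ) * dampedKernel χh ε v x₁ x₂ p₁ := fun p₁ => by
    calc ∫ y, phase (-p₁) (y - x₁) * fourier v (y - x₂) * ((χh (ε • y) : ℝ) : ℂ)
        = ∫ y, ∫ p₂, v p₂ * (phase p₁ x₁ * phase (-p₂) x₂) *
          (phase (-(p₁ - p₂)) y * ((χh (ε • y) : ℝ) : ℂ)) := by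
          congr 1 with y
          rw [fourier_eq_phase, ← integral_const_mul, ← integral_mul_const]
          congr 1 with p₂
          have : phase (-p₁) (y - x₁) * phase p₂ (y - x₂)
              = phase p₁ x₁ * phase (-p₂) x₂ * phase (-(p₁ - p₂)) y := by
            unfold phase
            rw [← Complex.exp_add, ← Complex.exp_add, ← Complex.exp_add]
            congr 1
            simp only [inner_sub_right, inner_neg_left, inner_sub_left]
            push_cast
            ring
          linear_combination v p₂ * ((χh (ε • y) : ℝ) : ℂ) * this
      _ = ∫ p₂, ∫ y, v p₂ * (phase p₁ x₁ * phase (-p₂) x₂) *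
          (phase (-(p₁ - p₂)) y * ((χh (ε • y) : ℝ) : ℂ)) := by
          refine integral_integral_swap (Continuous.integrable_of_hasCompactSupport ?_
            (HasCompactSupport.intro (hχs.prod hvc) fun q hq => ?_))
          · exact ((hv.continuous.comp continuous_snd).mul (continuous_const.mul
              (continuous_phase continuous_snd.neg continuous_const))).mul
              ((continuous_phase (continuous_const.sub continuous_snd).neg
                continuous_fst).mul (hχc.comp continuous_fst))
          · by_cases h1 : q.1 ∈ tsupport fun x : Space => ((χh (ε • x) : ℝ) : ℂ)
            · have h2 : q.2 ∉ tsupport v := fun h2 => hq ⟨h1, h2⟩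
              have h3 : v q.2 = 0 := image_eq_zero_of_notMem_tsupport h2
              simp [Function.uncurry_def, h3]
            · have h3 : ((χh (ε • q.1) : ℝ) : ℂ) = 0 := image_eq_zero_of_notMem_tsupport
                (f := fun x : Space => ((χh (ε • x) : ℝ) : ℂ)) h1
              simp only [Function.uncurry_def, h3, mul_zero]
      _ = _ := by
          unfold dampedKernel
          rw [← integral_const_mul]
          congr 1 with p₂
          rw [integral_const_mul, integral_phase_damper χh hε, mul_left_comm]
  have hout : ∀ p₁, ∫ y, conj (u p₁) * (phase (-p₁) (y - x₁) * fourier v (y - x₂) *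
      ((χh (ε • y) : ℝ) : ℂ)) = (((2 * Real.pi) ^ 3 : ℝ) : ℂ) *
        (conj (u p₁) * dampedKernel χh ε v x₁ x₂ p₁) := fun p₁ => by
    rw [integral_const_mul, hin, mul_left_comm]
  have hpi : (((2 * Real.pi) ^ 3 : ℝ) : ℂ) ≠ 0 := Complex.ofReal_ne_zero.2 (by positivity)
  constructor
  · have h := hint.integral_prod_right.const_mul (((2 * Real.pi) ^ 3 : ℝ) : ℂ)⁻¹
    simp only [Function.uncurry_apply_pair, hout, inv_mul_cancel_left₀ hpi] at h
    exact h
  · rw [← integral_const_mul]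
    simp_rw [← hout]
    rw [← integral_integral_swap hint]
    congr 1 with y
    rw [hconj, mul_assoc, ← integral_mul_const]
    congr 1 with p
    ring

theorem invFourier_eq_fourier (f : Space → ℂ) (x : Space) :
    invFourier f x = (((2 * Real.pi) ^ 3)⁻¹ : ℝ) * fourier f (-x) := by
  unfold invFourier fourier
  congr 2 with p
  simp [real_inner_comm]

theorem integrable_dampedKernel {χh : Space → ℝ} (hχ : IsSuitableDamper χh) (ε : ℝ)
    {v : Space → ℂ} (hv : ContDiff ℝ ∞ v) (hvc : HasCompactSupport v) (x₁ x₂ p₁ : Space) :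
    Integrable fun p₂ => v p₂ * (phase p₁ x₁ * phase (-p₂) x₂) *
      ((((ε ^ 3)⁻¹ : ℝ) : ℂ) * invFourier (fun x => (χh x : ℂ)) (ε⁻¹ • (p₁ - p₂))) := by
  have h1 : Continuous (invFourier fun x => (χh x : ℂ)) := by
    simp_rw [funext (invFourier_eq_fourier fun x => (χh x : ℂ))]
    exact continuous_const.mul ((continuous_fourier (Complex.ofRealCLM.contDiff.comp hχ.smooth)
      (hχ.compact.comp_left (g := ((↑) : ℝ → ℂ)) Complex.ofReal_zero)).comp continuous_neg)
  refine Continuous.integrable_of_hasCompactSupport ?_ hvc.mul_right.mul_right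
  exact (hv.continuous.mul (continuous_const.mul (continuous_phase continuous_neg
    continuous_const))).mul (continuous_const.mul (h1.comp (by fun_prop)))

section

variable {m ε : ℝ} {ρ χh : Space → ℝ}

theorem commutatorDensity_eq_conj (x₁ x₂ y : Space) : commutatorDensity m ρ ε x₁ x₂ y
    = conj (fourier (shellWeight ρ ε fun p => (energy m p)⁻¹) (y - x₁))
        * fourier (shellWeight ρ ε (energy m)) (y - x₂)
      + conj (fourier (shellWeight ρ ε fun _ => 1) (y - x₁))
        * fourier (shellWeight ρ ε fun _ => 1) (y - x₂) := by
  unfold commutatorDensity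
  rw [← conj_shellFn_energy_inv, ← conj_shellFn_one (y - x₁)]
  rfl

theorem continuous_shellFn (hρ : IsSuitableMollifier ρ) (hε : 0 < ε) {g : Space → ℝ}
    (hg : ContDiff ℝ ∞ g) : Continuous (shellFn ρ ε g) :=
  continuous_fourier (contDiff_shellWeight hρ hg) (hasCompactSupport_shellWeight hρ hε)

/-- The damped integral of the commutator density is the regularized `δ`-function. -/
theorem deltaG_eq (hm : 0 < m) (hρ : IsSuitableMollifier ρ) (hχ : IsSuitableDamper χh)
    (hε : 0 < ε) (x₁ x₂ : Space) :
    deltaG m ρ χh ε x₁ x₂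
      = 2 * ∫ y, commutatorDensity m ρ ε x₁ x₂ y * ((χh (ε • y) : ℝ) : ℂ) := by
  have hs := fun {g : Space → ℝ} (hg : ContDiff ℝ ∞ g) => contDiff_shellWeight (ε := ε) hρ hg
  have hc := fun {g : Space → ℝ} => hasCompactSupport_shellWeight (g := g) hρ hε
  have hE := contDiff_energy hm
  have hEi := contDiff_energy_inv hm
  have h1 : ContDiff ℝ ∞ fun _ : Space => (1 : ℝ) := contDiff_const
  obtain ⟨i1, e1⟩ := integral_fourier_mul_fourier_damper hχ hε (hs hEi) hc (hs hE) hc x₁ x₂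
  obtain ⟨i2, e2⟩ := integral_fourier_mul_fourier_damper hχ hε (hs h1) hc (hs h1) hc x₁ x₂
  have hcont := fun {g₁ g₂ : Space → ℝ} (hg₁ : ContDiff ℝ ∞ g₁) (hg₂ : ContDiff ℝ ∞ g₂) =>
    Continuous.integrable_of_hasCompactSupport (μ := volume)
      (f := fun y => conj (fourier (shellWeight ρ ε g₁) (y - x₁)) *
        fourier (shellWeight ρ ε g₂) (y - x₂) * ((χh (ε • y) : ℝ) : ℂ))
      (((Complex.continuous_conj.comp ((continuous_fourier (hs hg₁) hc).comp
        (continuous_sub_right x₁))).mul ((continuous_fourier (hs hg₂) hc).comp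
        (continuous_sub_right x₂))).mul (hχ.contDiff_scaled ε).continuous)
      (hχ.hasCompactSupport_scaled hε).mul_left
  simp_rw [commutatorDensity_eq_conj, add_mul]
  rw [integral_add (hcont hEi hE) (hcont h1 h1), e1, e2, ← mul_add, ← integral_add i1 i2,
    ← integral_const_mul, ← integral_const_mul]
  unfold deltaG
  congr 1 with p₁
  unfold dampedKernel
  have hE₁ : (energy m p₁ : ℂ) ≠ 0 := Complex.ofReal_ne_zero.2 (energy_pos hm p₁).ne'
  have hpi : (Real.pi : ℂ) ≠ 0 := Complex.ofReal_ne_zero.2 Real.pi_ne_zero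
  rw [← integral_const_mul, ← integral_const_mul, ← integral_const_mul,
    ← integral_add ((integrable_dampedKernel hχ ε (hs hE) hc x₁ x₂ p₁).const_mul _)
      ((integrable_dampedKernel hχ ε (hs h1) hc x₁ x₂ p₁).const_mul _),
    ← integral_const_mul, ← integral_const_mul]
  congr 1 with p₂
  have hph : phase p₁ x₁ * phase (-p₂) x₂
      = Complex.exp (Complex.I * ((inner ℝ p₁ x₁ - inner ℝ p₂ x₂ : ℝ) : ℂ)) := by
    unfold phase
    rw [← Complex.exp_add, inner_neg_left]
    congr 1
    push_cast
    ring
  rw [hph]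
  unfold shellWeight
  simp only [map_mul, Complex.conj_ofReal]
  push_cast
  field_simp
  ring

theorem deltaG_im (hm : 0 < m) (hρ : IsSuitableMollifier ρ) (hχ : IsSuitableDamper χh)
    (hε : 0 < ε) (x₁ x₂ : Space) : (deltaG m ρ χh ε x₁ x₂).im = 0 := by
  rw [← Complex.conj_eq_iff_im, deltaG_eq hm hρ hχ hε, map_mul, ← integral_conj]
  simp_rw [map_mul, conj_commutatorDensity, Complex.conj_ofReal]
  rw [Complex.conj_ofNat]

end

/-! ### Fourier inversion, Plancherel's theorem and `ρ^∨ ∗ ρ` -/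

open scoped FourierTransform in
theorem invFourier_fourier (s : 𝓢(Space, ℂ)) (x : Space) : invFourier (fourier s) x = s x := by
  have h := Measure.integral_comp_smul (volume : Measure Space)
    (fun q => Complex.exp (-(Complex.I * ((inner ℝ q x : ℝ) : ℂ))) * fourier s q) (2 * Real.pi)
  have hpi : (((2 * Real.pi) ^ 3 : ℝ) : ℂ) ≠ 0 := Complex.ofReal_ne_zero.2 (by positivity)
  rw [finrank_euclideanSpace_fin, abs_of_pos (by positivity), Complex.real_smul] at h
  unfold invFourier
  rw [← h]
  have h2 : 𝓕 (𝓕⁻ s) x = s x := by rw [FourierTransform.fourier_fourierInv_eq]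
  rw [← h2, SchwartzMap.fourier_coe, Real.fourier_eq']
  congr 1 with q
  rw [fourier_eq_fourierInv, smul_smul, inv_mul_cancel₀ (by positivity), one_smul,
    SchwartzMap.fourierInv_coe, smul_eq_mul, real_inner_smul_left]
  congr 2
  push_cast
  ring

open scoped FourierTransform in
theorem integral_conj_fourier_mul_fourier (s r : 𝓢(Space, ℂ)) :
    ∫ y, conj (fourier s y) * fourier r y
      = (((2 * Real.pi) ^ 3 : ℝ) : ℂ) * ∫ p, conj (s p) * r p := by
  have h := Measure.integral_comp_smul (volume : Measure Space)
    (fun y => conj (fourier s y) * fourier r y) (-(2 * Real.pi))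
  have hpi : (((2 * Real.pi) ^ 3 : ℝ) : ℂ) ≠ 0 := Complex.ofReal_ne_zero.2 (by positivity)
  have habs : |((-(2 * Real.pi)) ^ Module.finrank ℝ Space)⁻¹| = ((2 * Real.pi) ^ 3)⁻¹ := by
    rw [finrank_euclideanSpace_fin, abs_inv, abs_pow, abs_neg, abs_of_pos (by positivity)]
  rw [habs, Complex.real_smul, Complex.ofReal_inv, eq_inv_mul_iff_mul_eq₀ hpi] at h
  rw [← h]
  congr 1
  have h2 := SchwartzMap.integral_inner_fourier_fourier s r
  simp only [RCLike.inner_apply, mul_comm _ (conj _)] at h2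
  rw [← h2]
  congr 1 with q
  have hf : ∀ s : 𝓢(Space, ℂ), fourier s (-(2 * Real.pi) • q) = 𝓕 s q := fun s => by
    rw [fourier_eq_fourierInv, smul_smul, mul_neg, inv_mul_cancel₀ (by positivity),
      neg_one_smul, Real.fourierInv_eq_fourier_neg, neg_neg, SchwartzMap.fourier_coe]
  rw [hf, hf]

/-- Translations become phases. -/
theorem fourier_sub (u : Space → ℂ) (y a : Space) :
    fourier u (y - a) = fourier (fun p => u p * phase (-p) a) y := by
  simp_rw [fourier_eq_phase]
  congr 1 with p
  rw [mul_assoc]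
  congr 1
  unfold phase
  rw [← Complex.exp_add]
  congr 1
  rw [inner_sub_right, inner_neg_left]
  push_cast
  ring

section Autoconvolution

variable {m ε : ℝ} {ρ : Space → ℝ}

/-- `ρ^∨ ∗ ρ` is a Schwartz function with Fourier transform `|ρ̂|²`. -/
theorem IsSuitableMollifier.exists_schwartz_autoconv (hρ : IsSuitableMollifier ρ) :
    ∃ s : 𝓢(Space, ℂ), (∀ x, s x = (autoconv ρ x : ℂ)) ∧
      ∀ p, fourier s p = conj (rfourier ρ p) * rfourier ρ p := by
  obtain ⟨s, hs⟩ := hρ.exists_complex_schwartz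
  set r : 𝓢(Space, ℂ) :=
    SchwartzMap.compCLMOfContinuousLinearEquiv ℂ (ContinuousLinearEquiv.neg ℝ) s
  have hr : ∀ x, r x = s (-x) := fun x => rfl
  have hval : ∀ x, SchwartzMap.convolution (ContinuousLinearMap.mul ℂ ℂ) r s x
      = (autoconv ρ x : ℂ) := fun x => by
    rw [SchwartzMap.convolution_apply, autoconv, convolution_def, convolution_def,
      ← integral_complex_ofReal]
    congr 1 with t
    simp [hr, hs]
  refine ⟨SchwartzMap.convolution (ContinuousLinearMap.mul ℂ ℂ) r s, hval, fun p => ?_⟩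
  have hrf : fourier r p = conj (rfourier ρ p) := by
    rw [← rfourier_neg]
    unfold rfourier fourier
    rw [← integral_neg_eq_self]
    congr 1 with x
    simp [hr, hs]
  have hsf : fourier s p = rfourier ρ p := by rw [hs]; rfl
  rw [← hrf, ← hsf, fourier_eq_fourierInv, fourier_eq_fourierInv, fourier_eq_fourierInv,
    Real.fourierInv_eq_fourier_neg, Real.fourierInv_eq_fourier_neg,
    Real.fourierInv_eq_fourier_neg, ← Real.fourier_mul_convolution_eq r.integrable s.integrable]
  rw [funext fun x => SchwartzMap.convolution_apply (ContinuousLinearMap.mul ℂ ℂ) r s x]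

theorem IsSuitableMollifier.rfourier_autoconv (hρ : IsSuitableMollifier ρ) (p : Space) :
    rfourier (autoconv ρ) p = conj (rfourier ρ p) * rfourier ρ p := by
  obtain ⟨s, hs, hp⟩ := hρ.exists_schwartz_autoconv
  rw [← hp, funext hs]
  rfl

theorem IsSuitableMollifier.autoconv (hρ : IsSuitableMollifier ρ) :
    IsSuitableMollifier (autoconv ρ) where
  schwartz := by
    obtain ⟨s, hs, -⟩ := hρ.exists_schwartz_autoconv
    refine ⟨s.postcompCLM Complex.reCLM, funext fun x => ?_⟩
    have : (s.postcompCLM Complex.reCLM) x = (s x).re := rfl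
    rw [this, hs, Complex.ofReal_re]
  eq_one := by
    filter_upwards [hρ.eq_one] with p hp
    rw [hρ.rfourier_autoconv, hp, map_one, one_mul]
  compact := by
    rw [funext hρ.rfourier_autoconv]
    exact hρ.compact.mul_left

/-- Fourier inversion for `ρ^∨ ∗ ρ`; the sign in the exponent is immaterial since `|ρ̂|²` is
even. -/
theorem IsSuitableMollifier.autoconv_eq_fourier (hρ : IsSuitableMollifier ρ) (y : Space) :
    (FreeFieldCCR.autoconv ρ y : ℂ) = (((2 * Real.pi) ^ 3)⁻¹ : ℝ) *
      fourier (fun p => conj (rfourier ρ p) * rfourier ρ p) y := by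
  obtain ⟨s, hs, hp⟩ := hρ.exists_schwartz_autoconv
  rw [← hs, ← invFourier_fourier s, invFourier_eq_fourier, funext hp]
  congr 1
  unfold fourier
  rw [← integral_neg_eq_self]
  congr 1 with p
  simp only [rfourier_neg, Complex.conj_conj, inner_neg_neg]
  ring

theorem conj_phase_neg (p x : Space) : conj (phase (-p) x) = phase p x := by
  unfold phase
  rw [← Complex.exp_conj]
  simp

/-- Plancherel's theorem for translated Fourier integrals. -/
theorem integral_conj_fourier_sub_mul_fourier_sub {u v : Space → ℂ} (hu : ContDiff ℝ ∞ u)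
    (huc : HasCompactSupport u) (hv : ContDiff ℝ ∞ v) (hvc : HasCompactSupport v)
    (x₁ x₂ : Space) :
    Integrable (fun y => conj (fourier u (y - x₁)) * fourier v (y - x₂)) ∧
    ∫ y, conj (fourier u (y - x₁)) * fourier v (y - x₂)
      = (((2 * Real.pi) ^ 3 : ℝ) : ℂ) * ∫ p, conj (u p) * v p * phase p (x₁ - x₂) := by
  have hph : ∀ a, ContDiff ℝ ∞ fun p => phase (-p) a := fun a =>
    (contDiff_const.mul (Complex.ofRealCLM.contDiff.comp
      (contDiff_neg.inner ℝ contDiff_const))).cexp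
  set s := HasCompactSupport.toSchwartzMap (f := fun p => u p * phase (-p) x₁)
    (huc.mul_right) (hu.mul (hph x₁))
  set r := HasCompactSupport.toSchwartzMap (f := fun p => v p * phase (-p) x₂)
    (hvc.mul_right) (hv.mul (hph x₂))
  have hs : ∀ y, fourier u (y - x₁) = fourier s y := fun y => fourier_sub u y x₁
  have hr : ∀ y, fourier v (y - x₂) = fourier r y := fun y => fourier_sub v y x₂
  simp_rw [hs, hr]
  constructor
  · obtain ⟨s', hs'⟩ := exists_schwartz_fourier s
    obtain ⟨r', hr'⟩ := exists_schwartz_fourier r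
    rw [← hs', ← hr']
    exact MemLp.integrable_mul (p := 2) (q := 2) (s'.memLp 2 volume).star (r'.memLp 2 volume)
  · rw [integral_conj_fourier_mul_fourier]
    congr 2 with p
    change conj (u p * phase (-p) x₁) * (v p * phase (-p) x₂) = _
    rw [map_mul, conj_phase_neg]
    have : phase p x₁ * phase (-p) x₂ = phase p (x₁ - x₂) := by
      unfold phase
      rw [← Complex.exp_add, inner_sub_right, inner_neg_left]
      congr 1
      push_cast
      ring
    rw [← this]
    ring

/-- Without the damper, the integral of the commutator density is a rescaled `ρ^∨ ∗ ρ`. -/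
theorem integral_commutatorDensity (hm : 0 < m) (hρ : IsSuitableMollifier ρ) (hε : 0 < ε)
    (x₁ x₂ : Space) :
    Integrable (commutatorDensity m ρ ε x₁ x₂) ∧
    2 * ∫ y, commutatorDensity m ρ ε x₁ x₂ y
      = (((ε ^ 3)⁻¹ * autoconv ρ (ε⁻¹ • (x₁ - x₂)) : ℝ) : ℂ) := by
  have hs := fun {g : Space → ℝ} (hg : ContDiff ℝ ∞ g) => contDiff_shellWeight (ε := ε) hρ hg
  have hc := fun {g : Space → ℝ} => hasCompactSupport_shellWeight (g := g) hρ hε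
  have hE := contDiff_energy hm
  have hEi := contDiff_energy_inv hm
  have h1 : ContDiff ℝ ∞ fun _ : Space => (1 : ℝ) := contDiff_const
  obtain ⟨i1, e1⟩ := integral_conj_fourier_sub_mul_fourier_sub (hs hEi) hc (hs hE) hc x₁ x₂
  obtain ⟨i2, e2⟩ := integral_conj_fourier_sub_mul_fourier_sub (hs h1) hc (hs h1) hc x₁ x₂
  have hphc := continuous_phase continuous_id (continuous_const (y := x₁ - x₂))
  have hi := fun {g₁ g₂ : Space → ℝ} (hg₁ : ContDiff ℝ ∞ g₁) (hg₂ : ContDiff ℝ ∞ g₂) =>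
    Continuous.integrable_of_hasCompactSupport (μ := volume)
      (f := fun p => conj (shellWeight ρ ε g₁ p) * shellWeight ρ ε g₂ p * phase p (x₁ - x₂))
      (((Complex.continuous_conj.comp (hs hg₁).continuous).mul (hs hg₂).continuous).mul hphc)
      hc.mul_left.mul_right
  have hd : commutatorDensity m ρ ε x₁ x₂ = _ := funext fun y => commutatorDensity_eq_conj x₁ x₂ y
  rw [hd]
  refine ⟨i1.add i2, ?_⟩
  rw [integral_add i1 i2, e1, e2, ← mul_add, ← integral_add (hi hEi hE) (hi h1 h1),
    Complex.ofReal_mul, hρ.autoconv_eq_fourier, fourier_eq_phase]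
  have hsc := Measure.integral_comp_smul (volume : Measure Space) (fun p =>
    conj (rfourier ρ p) * rfourier ρ p * phase p (ε⁻¹ • (x₁ - x₂))) ε
  rw [finrank_euclideanSpace_fin, abs_of_pos (by positivity), Complex.real_smul] at hsc
  rw [mul_left_comm ((((ε ^ 3)⁻¹ : ℝ) : ℂ)), ← hsc, ← integral_const_mul, ← integral_const_mul,
    ← integral_const_mul]
  congr 1 with p
  have hph : phase (ε • p) (ε⁻¹ • (x₁ - x₂)) = phase p (x₁ - x₂) := by
    unfold phase
    rw [real_inner_smul_left, real_inner_smul_right, mul_inv_cancel_left₀ hε.ne']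
  rw [hph]
  unfold shellWeight
  have hE₁ : (energy m p : ℂ) ≠ 0 := Complex.ofReal_ne_zero.2 (energy_pos hm p).ne'
  have hpi : (Real.pi : ℂ) ≠ 0 := Complex.ofReal_ne_zero.2 Real.pi_ne_zero
  simp only [map_mul, Complex.conj_ofReal]
  push_cast
  field_simp
  ring

end Autoconvolution

/-! ### Symbol estimates for the energy -/

section BoundedDerivs

variable {E F G H : Type*} [NormedAddCommGroup E] [NormedSpace ℝ E]
  [NormedAddCommGroup F] [NormedSpace ℝ F] [NormedAddCommGroup G] [NormedSpace ℝ G]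
  [NormedAddCommGroup H] [NormedSpace ℝ H]

/-- Smooth functions whose derivatives up to order `n` are bounded. -/
structure HasBoundedDerivs (n : ℕ) (f : E → F) : Prop where
  smooth : ContDiff ℝ ∞ f
  bound : ∀ k ≤ n, ∃ C, ∀ x, ‖iteratedFDeriv ℝ k f x‖ ≤ C

theorem HasBoundedDerivs.const (n : ℕ) (c : F) : HasBoundedDerivs n fun _ : E => c where
  smooth := contDiff_const
  bound k _ := by
    refine ⟨‖c‖, fun x => ?_⟩
    rcases k with _ | k
    · rw [norm_iteratedFDeriv_zero]
    · rw [iteratedFDeriv_const_of_ne (Nat.succ_ne_zero k)]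
      simp

theorem HasBoundedDerivs.bilin {n : ℕ} {f : E → F} {g : E → G} (hf : HasBoundedDerivs n f)
    (hg : HasBoundedDerivs n g) (B : F →L[ℝ] G →L[ℝ] H) :
    HasBoundedDerivs n fun x => B (f x) (g x) where
  smooth := B.isBoundedBilinearMap.contDiff.comp₂ hf.smooth hg.smooth
  bound k hk := by
    choose! C hC using hf.bound
    choose! D hD using hg.bound
    refine ⟨‖B‖ * ∑ i ∈ Finset.range (k + 1), (k.choose i : ℝ) * C i * D (k - i), fun x => ?_⟩
    refine (B.norm_iteratedFDeriv_le_of_bilinear hf.smooth hg.smooth x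
      (by exact_mod_cast le_top)).trans ?_
    gcongr with i hi
    · exact mul_nonneg (by positivity) ((norm_nonneg _).trans
        (hC i (by have := Finset.mem_range.1 hi; lia) x))
    · exact hC i (by have := Finset.mem_range.1 hi; lia) x
    · exact hD (k - i) (by lia) x

theorem HasBoundedDerivs.smulRight {n : ℕ} {f : E → F →L[ℝ] ℝ} {g : E → G}
    (hf : HasBoundedDerivs n f) (hg : HasBoundedDerivs n g) :
    HasBoundedDerivs n fun x => (f x).smulRight (g x) :=
  hf.bilin hg (ContinuousLinearMap.smulRightL ℝ F G)

theorem HasBoundedDerivs.sub {n : ℕ} {f g : E → F} (hf : HasBoundedDerivs n f)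
    (hg : HasBoundedDerivs n g) : HasBoundedDerivs n fun x => f x - g x where
  smooth := hf.smooth.sub hg.smooth
  bound k hk := by
    obtain ⟨C, hC⟩ := hf.bound k hk
    obtain ⟨D, hD⟩ := hg.bound k hk
    refine ⟨C + D, fun x => ?_⟩
    have h := iteratedFDeriv_sub_apply (𝕜 := ℝ) (i := k) (x := x) (f := f) (g := g)
      (hf.smooth.contDiffAt.of_le (by exact_mod_cast le_top))
      (hg.smooth.contDiffAt.of_le (by exact_mod_cast le_top))
    change ‖iteratedFDeriv ℝ k (f - g) x‖ ≤ _
    rw [h]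
    exact (norm_sub_le _ _).trans (add_le_add (hC x) (hD x))

theorem HasBoundedDerivs.smul {n : ℕ} {f : E → ℝ} {g : E → F} (hf : HasBoundedDerivs n f)
    (hg : HasBoundedDerivs n g) : HasBoundedDerivs n fun x => f x • g x :=
  hf.bilin hg (ContinuousLinearMap.lsmul ℝ ℝ)

theorem HasBoundedDerivs.of_fderiv {n : ℕ} {f : E → F} {f' : E → E →L[ℝ] F}
    (hf : ContDiff ℝ ∞ f) (hd : ∀ x, HasFDerivAt f (f' x) x) {C : ℝ} (hC : ∀ x, ‖f x‖ ≤ C)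
    (hf' : HasBoundedDerivs n f') : HasBoundedDerivs (n + 1) f where
  smooth := hf
  bound k hk := by
    rcases k with _ | k
    · exact ⟨C, fun x => by rw [norm_iteratedFDeriv_zero]; exact hC x⟩
    · obtain ⟨D, hD⟩ := hf'.bound k (by lia)
      refine ⟨D, fun x => ?_⟩
      rw [← norm_iteratedFDeriv_fderiv, funext fun x => (hd x).fderiv]
      exact hD x

end BoundedDerivs

section Energy

variable {m : ℝ}

/-- The scalar product of `ℝ³` as a bilinear, rather than sesquilinear, map. -/
noncomputable def innerForm : Space →L[ℝ] Space →L[ℝ] ℝ := innerSL ℝ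

/-- The velocity `p / E_p` as a linear form; it is the derivative of the energy. -/
noncomputable def velocity (m : ℝ) (p : Space) : Space →L[ℝ] ℝ := (energy m p)⁻¹ • innerForm p

theorem hasFDerivAt_energy (hm : 0 < m) (p : Space) :
    HasFDerivAt (energy m) (velocity m p) p := by
  have h : HasFDerivAt (fun p : Space => ‖p‖ ^ 2 + m ^ 2) (2 • innerForm p) p :=
    (hasStrictFDerivAt_norm_sq p).hasFDerivAt.add_const _
  refine (h.sqrt (by positivity)).congr_fderiv ?_
  unfold velocity energy
  rw [← Nat.cast_smul_eq_nsmul ℝ, smul_smul]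
  congr 1
  have : Real.sqrt (‖p‖ ^ 2 + m ^ 2) ≠ 0 := (energy_pos hm p).ne'
  field_simp
  norm_num

theorem hasFDerivAt_energy_inv (hm : 0 < m) (p : Space) :
    HasFDerivAt (fun p => (energy m p)⁻¹)
      (-((energy m p)⁻¹ * (energy m p)⁻¹) • velocity m p) p := by
  refine ((hasDerivAt_inv (energy_pos hm p).ne').comp_hasFDerivAt p
    (hasFDerivAt_energy hm p)).congr_fderiv ?_
  rw [pow_two, mul_inv]

theorem hasFDerivAt_velocity (hm : 0 < m) (p : Space) :
    HasFDerivAt (velocity m) ((energy m p)⁻¹ • (innerForm -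
      (velocity m p).smulRight (velocity m p))) p := by
  refine ((hasFDerivAt_energy_inv hm p).smul innerForm.hasFDerivAt).congr_fderiv ?_
  refine ContinuousLinearMap.ext fun v => ContinuousLinearMap.ext fun w => ?_
  simp [velocity]
  ring

theorem norm_velocity_le (hm : 0 < m) (p : Space) : ‖velocity m p‖ ≤ 1 := by
  have hE := energy_pos hm p
  unfold velocity
  have hn : ‖innerForm p‖ = ‖p‖ := innerSL_apply_norm ℝ p
  rw [norm_smul, hn, norm_inv, Real.norm_of_nonneg hE.le, inv_mul_le_one₀ hE]
  exact Real.le_sqrt_of_sq_le (by nlinarith)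

theorem energy_ge (m : ℝ) (p : Space) : m ≤ energy m p :=
  Real.le_sqrt_of_sq_le (by nlinarith [sq_nonneg ‖p‖])

theorem contDiff_velocity (hm : 0 < m) : ContDiff ℝ ∞ (velocity m) :=
  (contDiff_energy_inv hm).smul innerForm.contDiff

/-- All derivatives of `1 / E_p` and of the velocity are bounded: their derivatives are
polynomials in these functions. -/
theorem hasBoundedDerivs_energy_inv_velocity (hm : 0 < m) (n : ℕ) :
    HasBoundedDerivs n (fun p => (energy m p)⁻¹) ∧ HasBoundedDerivs n (velocity m) := by
  have hu : ∀ p, ‖(energy m p)⁻¹‖ ≤ m⁻¹ := fun p => by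
    rw [norm_inv, Real.norm_of_nonneg (energy_pos hm p).le]
    exact inv_anti₀ hm (energy_ge m p)
  induction n with
  | zero =>
    refine ⟨⟨contDiff_energy_inv hm, fun k hk => ⟨m⁻¹, fun p => ?_⟩⟩,
      ⟨contDiff_velocity hm, fun k hk => ⟨1, fun p => ?_⟩⟩⟩
    · rw [Nat.le_zero.1 hk, norm_iteratedFDeriv_zero]
      exact hu p
    · rw [Nat.le_zero.1 hk, norm_iteratedFDeriv_zero]
      exact norm_velocity_le hm p
  | succ n ih =>
    obtain ⟨h1, h2⟩ := ih
    refine ⟨.of_fderiv (contDiff_energy_inv hm) (hasFDerivAt_energy_inv hm) hu ?_,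
      .of_fderiv (contDiff_velocity hm) (hasFDerivAt_velocity hm) (norm_velocity_le hm) ?_⟩
    · exact (h1.bilin h1 (-ContinuousLinearMap.mul ℝ ℝ)).smul h2
    · exact h1.smul ((HasBoundedDerivs.const n innerForm).sub (h2.smulRight h2))

/-- Smooth functions all of whose derivatives grow at most linearly. -/
structure HasLinearGrowth (g : Space → ℝ) : Prop where
  smooth : ContDiff ℝ ∞ g
  bound : ∀ k, ∃ C, ∀ p, ‖iteratedFDeriv ℝ k g p‖ ≤ C * (1 + ‖p‖)

theorem HasLinearGrowth.of_boundedDerivs {g : Space → ℝ} (hg : ∀ n, HasBoundedDerivs n g) :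
    HasLinearGrowth g where
  smooth := (hg 0).smooth
  bound k := by
    obtain ⟨C, hC⟩ := (hg k).bound k le_rfl
    have h0 := (norm_nonneg _).trans (hC 0)
    exact ⟨C, fun p => (hC p).trans (le_mul_of_one_le_right h0 (by simp))⟩

theorem hasLinearGrowth_one : HasLinearGrowth fun _ => 1 :=
  .of_boundedDerivs fun n => .const n 1

theorem hasLinearGrowth_energy_inv (hm : 0 < m) : HasLinearGrowth fun p => (energy m p)⁻¹ :=
  .of_boundedDerivs fun n => (hasBoundedDerivs_energy_inv_velocity hm n).1

theorem hasLinearGrowth_energy (hm : 0 < m) : HasLinearGrowth (energy m) where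
  smooth := contDiff_energy hm
  bound k := by
    rcases k with _ | k
    · refine ⟨1 + m, fun p => ?_⟩
      rw [norm_iteratedFDeriv_zero, Real.norm_of_nonneg (energy_pos hm p).le]
      refine Real.sqrt_le_iff.2 ⟨by positivity, ?_⟩
      nlinarith [norm_nonneg p, mul_nonneg hm.le (norm_nonneg p)]
    · obtain ⟨C, hC⟩ := (hasBoundedDerivs_energy_inv_velocity hm k).2.bound k le_rfl
      have h0 := (norm_nonneg _).trans (hC 0)
      refine ⟨C, fun p => ?_⟩
      rw [← norm_iteratedFDeriv_fderiv, funext fun x => (hasFDerivAt_energy hm x).fderiv]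
      exact (hC p).trans (le_mul_of_one_le_right h0 (by simp))

end Energy

/-! ### Decay of the momentum integrals -/

theorem integrable_inv_one_add_norm_pow_four :
    Integrable fun p : Space => ((1 + ‖p‖) ^ 4)⁻¹ := by
  have h := integrable_one_add_norm (E := Space) (μ := volume) (r := 4)
    (by rw [finrank_euclideanSpace_fin]; norm_num)
  refine h.congr (Eventually.of_forall fun p => ?_)
  have : (0 : ℝ) ≤ 1 + ‖p‖ := by positivity
  change (1 + ‖p‖) ^ (-4 : ℝ) = _
  rw [Real.rpow_neg this]
  norm_cast

open scoped FourierTransform in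
/-- The Fourier transform decays as fast as the integrability of the derivatives of the
function permits. -/
theorem exists_fourier_decay (N : ℕ) : ∃ C, 0 ≤ C ∧ ∀ {u : Space → ℂ} {A : ℝ}, 0 ≤ A →
    ContDiff ℝ ∞ u → HasCompactSupport u →
    (∀ j ≤ N, ∀ p, (1 + ‖p‖) ^ 4 * ‖iteratedFDeriv ℝ j u p‖ ≤ A) →
    ∀ z, (1 + ‖z‖) ^ N * ‖fourier u z‖ ≤ C * A := by
  set I : ℝ := ∫ p : Space, ((1 + ‖p‖) ^ 4)⁻¹
  have hI : 0 ≤ I := integral_nonneg fun p => by positivity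
  have hpi : (0 : ℝ) < 2 * Real.pi := by positivity
  refine ⟨2 ^ (N - 1) * (I + (2 * Real.pi) ^ N * (2 ^ N * ((N + 1 : ℕ) * I))), by positivity,
    fun {u A} hA hu hc hb z => ?_⟩
  have hcont : ∀ j : ℕ, Continuous fun p => ‖iteratedFDeriv ℝ j u p‖ := fun j =>
    (hu.continuous_iteratedFDeriv (by exact_mod_cast le_top)).norm
  have hint : ∀ k j : ℕ, Integrable fun p => ‖p‖ ^ k * ‖iteratedFDeriv ℝ j u p‖ := fun k j => by
    have hcs : HasCompactSupport fun p => ‖iteratedFDeriv ℝ j u p‖ := (hc.iteratedFDeriv j).norm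
    exact Continuous.integrable_of_hasCompactSupport ((continuous_norm.pow k).mul (hcont j))
      hcs.mul_left
  have hle : ∀ j ≤ N, ∫ p, ‖iteratedFDeriv ℝ j u p‖ ≤ A * I := fun j hj => by
    rw [← integral_const_mul]
    refine integral_mono (by simpa using hint 0 j)
      (integrable_inv_one_add_norm_pow_four.const_mul A) fun p => ?_
    change _ ≤ A * ((1 + ‖p‖) ^ 4)⁻¹
    rw [← div_eq_mul_inv, le_div_iff₀ (by positivity), mul_comm]
    exact hb j hj p
  set w : Space := -((2 * Real.pi)⁻¹ • z)
  have hw : fourier u z = 𝓕 u w := by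
    rw [fourier_eq_fourierInv, Real.fourierInv_eq_fourier_neg]
  have hzw : ‖z‖ = 2 * Real.pi * ‖w‖ := by
    rw [norm_neg, norm_smul, norm_inv, Real.norm_of_nonneg hpi.le, mul_inv_cancel_left₀ hpi.ne']
  have key : ∀ n ≤ N, ‖w‖ ^ n * ‖𝓕 u w‖ ≤ 2 ^ n * ((n + 1 : ℕ) * (A * I)) := fun n hn => by
    have h := Real.pow_mul_norm_iteratedFDeriv_fourier_le (K := ⊤) (N := ⊤) (f := u) hu
      (fun k j _ _ => hint k j) (k := 0) (n := n) le_top le_top w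
    rw [norm_iteratedFDeriv_zero] at h
    refine h.trans ?_
    simp only [pow_zero, one_mul, Nat.cast_zero, mul_zero, zero_add]
    gcongr
    rw [Finset.sum_product, Finset.range_one, Finset.sum_singleton]
    simp only [pow_zero, one_mul]
    refine (Finset.sum_le_card_nsmul (Finset.range (n + 1)) _ (A * I) fun j hj =>
      hle j (by have := Finset.mem_range.1 hj; lia)).trans_eq ?_
    rw [Finset.card_range, nsmul_eq_mul]
  have h0 : ‖𝓕 u w‖ ≤ A * I := by simpa using key 0 (Nat.zero_le _)
  rw [hw]
  calc (1 + ‖z‖) ^ N * ‖𝓕 u w‖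
      ≤ 2 ^ (N - 1) * (1 ^ N + ‖z‖ ^ N) * ‖𝓕 u w‖ := by
        gcongr
        exact add_pow_le zero_le_one (norm_nonneg z) N
    _ = 2 ^ (N - 1) * (‖𝓕 u w‖ + (2 * Real.pi) ^ N * (‖w‖ ^ N * ‖𝓕 u w‖)) := by
        rw [hzw, mul_pow]
        ring
    _ ≤ 2 ^ (N - 1) * (A * I + (2 * Real.pi) ^ N * (2 ^ N * ((N + 1 : ℕ) * (A * I)))) := by
        gcongr ?_ * (?_ + ?_ * ?_)
        exact key N le_rfl
    _ = _ := by ring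

/-- The derivatives of the scaled functions `h(ε p)`, `ε ≤ 1`, of a Schwartz function. Of the five
powers, four are for integrability in three dimensions and one compensates for the growth of
`E_p`. -/
theorem exists_bound_iteratedFDeriv_comp_smul (h : 𝓢(Space, ℂ)) (j : ℕ) : ∃ C, 0 ≤ C ∧
    ∀ ε : ℝ, 0 < ε → ε ≤ 1 → ∀ p,
      (1 + ‖p‖) ^ 5 * ‖iteratedFDeriv ℝ j (fun p => h (ε • p)) p‖ ≤ C * (ε ^ 5)⁻¹ := by
  set C := 2 ^ 5 * (Finset.Iic ((5, j) : ℕ × ℕ)).sup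
    (fun m => SchwartzMap.seminorm ℝ m.1 m.2) h
  have hC := fun p => SchwartzMap.one_add_le_sup_seminorm_apply (𝕜 := ℝ) (m := (5, j))
    (k := 5) (n := j) le_rfl le_rfl h p
  refine ⟨C, le_trans (by positivity) (hC 0), fun ε h0 h1 p => ?_⟩
  have hL : ‖ε • ContinuousLinearMap.id ℝ Space‖ ≤ 1 := by
    rw [norm_smul, Real.norm_of_nonneg h0.le]
    exact mul_le_one₀ h1 (norm_nonneg _) ContinuousLinearMap.norm_id_le
  have hd := norm_iteratedFDeriv_comp_clm_le (h.smooth ⊤) (ε • ContinuousLinearMap.id ℝ Space)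
    hL j p
  change ‖iteratedFDeriv ℝ j (fun p => h (ε • p)) p‖ ≤ ‖iteratedFDeriv ℝ j h (ε • p)‖ at hd
  have hp : ε * (1 + ‖p‖) ≤ 1 + ‖ε • p‖ := by
    rw [norm_smul, Real.norm_of_nonneg h0.le]
    linarith
  rw [← div_eq_mul_inv, le_div_iff₀ (by positivity)]
  calc (1 + ‖p‖) ^ 5 * ‖iteratedFDeriv ℝ j (fun p => h (ε • p)) p‖ * ε ^ 5
      = (ε * (1 + ‖p‖)) ^ 5 * ‖iteratedFDeriv ℝ j (fun p => h (ε • p)) p‖ := by ring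
    _ ≤ (1 + ‖ε • p‖) ^ 5 * ‖iteratedFDeriv ℝ j h (ε • p)‖ := by gcongr
    _ ≤ C := hC _

/-- Decay of every order of the momentum integrals, at the cost of the fixed power `ε⁻⁵`. -/
theorem exists_shellFn_decay {ρ : Space → ℝ} (hρ : IsSuitableMollifier ρ) {g : Space → ℝ}
    (hg : HasLinearGrowth g) (N : ℕ) : ∃ C, 0 ≤ C ∧ ∀ ε : ℝ, 0 < ε → ε ≤ 1 → ∀ z,
      (1 + ‖z‖) ^ N * ‖shellFn ρ ε g z‖ ≤ C * (ε ^ 5)⁻¹ := by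
  obtain ⟨h, hh⟩ := hρ.exists_schwartz_rfourier
  choose G hG using hg.bound
  choose D hD0 hD using exists_bound_iteratedFDeriv_comp_smul h
  have hG0 : ∀ k, 0 ≤ G k := fun k => by simpa using (norm_nonneg _).trans (hG k 0)
  obtain ⟨C, hC0, hC⟩ := exists_fourier_decay N
  -- `(2π)⁻³ g / 2` inherits the linear growth of `g`
  set B : ℝ →L[ℝ] ℂ →L[ℝ] ℂ :=
    (((2 * Real.pi) ^ 3)⁻¹ * 2⁻¹ : ℝ) • ContinuousLinearMap.lsmul ℝ ℝ
  set A : ℕ → ℝ := fun j => ‖B‖ * ∑ i ∈ Finset.range (j + 1), (j.choose i : ℝ) * G i * D (j - i)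
  have hA0 : ∀ j, 0 ≤ A j := fun j => mul_nonneg (norm_nonneg B) (Finset.sum_nonneg fun i _ =>
    mul_nonneg (mul_nonneg (by positivity) (hG0 i)) (hD0 _))
  refine ⟨C * ∑ j ∈ Finset.range (N + 1), A j,
    mul_nonneg hC0 (Finset.sum_nonneg fun j _ => hA0 j), fun ε h0 h1 z => ?_⟩
  rw [mul_assoc]
  refine hC (mul_nonneg (Finset.sum_nonneg fun j _ => hA0 j) (by positivity))
    (contDiff_shellWeight hρ hg.smooth) (hasCompactSupport_shellWeight hρ h0) (fun j hj p => ?_) z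
  have hw : shellWeight ρ ε g = fun p => B (g p) (h (ε • p)) := funext fun p => by
    simp [shellWeight, B, hh]
    ring
  have hs : ContDiff ℝ ∞ fun p => h (ε • p) := (h.smooth ⊤).comp (contDiff_const_smul ε)
  have hb := B.norm_iteratedFDeriv_le_of_bilinear hg.smooth hs p (n := j)
    (by exact_mod_cast le_top)
  rw [hw]
  calc (1 + ‖p‖) ^ 4 * ‖iteratedFDeriv ℝ j (fun p => B (g p) (h (ε • p))) p‖
      ≤ (1 + ‖p‖) ^ 4 * (‖B‖ * ∑ i ∈ Finset.range (j + 1), (j.choose i : ℝ) *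
          (G i * (1 + ‖p‖)) * ‖iteratedFDeriv ℝ (j - i) (fun p => h (ε • p)) p‖) := by
        refine mul_le_mul_of_nonneg_left (hb.trans ?_) (by positivity)
        gcongr with i hi
        exact hG i p
    _ = ‖B‖ * ∑ i ∈ Finset.range (j + 1), (j.choose i : ℝ) * G i *
          ((1 + ‖p‖) ^ 5 * ‖iteratedFDeriv ℝ (j - i) (fun p => h (ε • p)) p‖) := by
        rw [mul_left_comm, Finset.mul_sum]
        congr 1
        exact Finset.sum_congr rfl fun i _ => by ring
    _ ≤ ‖B‖ * ∑ i ∈ Finset.range (j + 1), (j.choose i : ℝ) * G i * (D (j - i) * (ε ^ 5)⁻¹) := by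
        gcongr ‖B‖ * ?_
        exact Finset.sum_le_sum fun i _ => mul_le_mul_of_nonneg_left (hD _ ε h0 h1 p)
          (mul_nonneg (by positivity) (hG0 i))
    _ = A j * (ε ^ 5)⁻¹ := by
        rw [mul_assoc, Finset.sum_mul]
        congr 1
        exact Finset.sum_congr rfl fun i _ => by ring
    _ ≤ _ := by
        gcongr
        exact Finset.single_le_sum (fun j _ => hA0 j) (Finset.mem_range.2 (by lia))

/-! ### The remainder -/

theorem IsSuitableDamper.exists_sub_one_bound {χh : Space → ℝ} (hχ : IsSuitableDamper χh)
    (M : ℕ) : ∃ B, 0 ≤ B ∧ ∀ y, |χh y - 1| ≤ B * ‖y‖ ^ M := by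
  obtain ⟨b, hb⟩ := hχ.compact.exists_bound_of_continuous hχ.smooth.continuous
  obtain ⟨r, hr, hball⟩ := Metric.eventually_nhds_iff_ball.1 hχ.eq_one
  have hb0 : 0 ≤ b := (norm_nonneg _).trans (hb 0)
  refine ⟨(b + 1) * (r ^ M)⁻¹, by positivity, fun y => ?_⟩
  by_cases hy : ‖y‖ < r
  · rw [hball y (by simpa using hy), sub_self, abs_zero]
    positivity
  · have h1 : |χh y - 1| ≤ b + 1 := by
      simpa using (norm_sub_le (χh y) 1).trans (add_le_add_left (hb y) ‖(1 : ℝ)‖)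
    have h2 : 1 ≤ (r ^ M)⁻¹ * ‖y‖ ^ M := by
      rw [le_inv_mul_iff₀ (by positivity), mul_one]
      exact pow_le_pow_left₀ hr.le (not_lt.1 hy) M
    rw [mul_assoc]
    exact h1.trans (le_mul_of_one_le_right (by positivity) h2)

section

variable {m : ℝ} {ρ χh : Space → ℝ}

/-- The commutator density decays rapidly away from `x₁`; only the fixed power `ε⁻¹⁰` is lost. -/
theorem exists_commutatorDensity_decay (hm : 0 < m) (hρ : IsSuitableMollifier ρ) (N : ℕ) :
    ∃ C, 0 ≤ C ∧ ∀ ε : ℝ, 0 < ε → ε ≤ 1 → ∀ x₁ x₂ y,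
      (1 + ‖y - x₁‖) ^ N * ‖commutatorDensity m ρ ε x₁ x₂ y‖ ≤ C * (ε ^ 10)⁻¹ := by
  obtain ⟨A, hA0, hA⟩ := exists_shellFn_decay hρ (hasLinearGrowth_energy_inv hm) N
  obtain ⟨B, hB0, hB⟩ := exists_shellFn_decay hρ hasLinearGrowth_one N
  obtain ⟨A', hA'0, hA'⟩ := exists_shellFn_decay hρ (hasLinearGrowth_energy hm) 0
  obtain ⟨B', hB'0, hB'⟩ := exists_shellFn_decay hρ hasLinearGrowth_one 0
  refine ⟨A * A' + B * B', by positivity, fun ε h0 h1 x₁ x₂ y => ?_⟩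
  simp only [pow_zero, one_mul] at hA' hB'
  calc (1 + ‖y - x₁‖) ^ N * ‖commutatorDensity m ρ ε x₁ x₂ y‖
      ≤ (1 + ‖y - x₁‖) ^ N * (‖shellFn ρ ε (fun p => (energy m p)⁻¹) (y - x₁)‖ *
          ‖shellFn ρ ε (energy m) (y - x₂)‖ + ‖shellFn ρ ε (fun _ => 1) (y - x₁)‖ *
          ‖shellFn ρ ε (fun _ => 1) (y - x₂)‖) := by
        gcongr
        unfold commutatorDensity
        exact (norm_add_le _ _).trans_eq (by rw [norm_mul, norm_mul])
    _ = (1 + ‖y - x₁‖) ^ N * ‖shellFn ρ ε (fun p => (energy m p)⁻¹) (y - x₁)‖ *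
          ‖shellFn ρ ε (energy m) (y - x₂)‖ + (1 + ‖y - x₁‖) ^ N *
          ‖shellFn ρ ε (fun _ => 1) (y - x₁)‖ * ‖shellFn ρ ε (fun _ => 1) (y - x₂)‖ := by ring
    _ ≤ A * (ε ^ 5)⁻¹ * (A' * (ε ^ 5)⁻¹) + B * (ε ^ 5)⁻¹ * (B' * (ε ^ 5)⁻¹) := by
        gcongr ?_ * ?_ + ?_ * ?_
        · exact hA ε h0 h1 _
        · exact hA' ε h0 h1 _
        · exact hB ε h0 h1 _
        · exact hB' ε h0 h1 _
    _ = (A * A' + B * B') * (ε ^ 10)⁻¹ := by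
        rw [show 10 = 5 + 5 from rfl, pow_add, mul_inv]
        ring

/-- The difference between the commutator with and without damper is of every order in `ε`:
the damper differs from one by at most a power of `ε ‖y‖`, and the density decays rapidly. -/
theorem exists_remainder_bound (hm : 0 < m) (hρ : IsSuitableMollifier ρ)
    (hχ : IsSuitableDamper χh) (q : ℕ) (r : ℝ) (hr : 0 ≤ r) :
    ∃ C, 0 ≤ C ∧ ∀ ε : ℝ, 0 < ε → ε ≤ 1 → ∀ x₁ x₂, ‖x₁‖ ≤ r →
      ‖∫ y, commutatorDensity m ρ ε x₁ x₂ y * (((χh (ε • y) : ℝ) : ℂ) - 1)‖ ≤ C * ε ^ q := by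
  -- ten powers of `ε` compensate for the density, four powers of `‖y‖` are kept for integrability
  obtain ⟨B, hB0, hB⟩ := hχ.exists_sub_one_bound (q + 10)
  obtain ⟨D, hD0, hD⟩ := exists_commutatorDensity_decay hm hρ (q + 10 + 4)
  set I : ℝ := ∫ p : Space, ((1 + ‖p‖) ^ 4)⁻¹
  have hI : 0 ≤ I := integral_nonneg fun p => by positivity
  refine ⟨(1 + r) ^ (q + 10 + 4) * D * B * I, by positivity, fun ε h0 h1 x₁ x₂ hx => ?_⟩
  have hy : ∀ y : Space, 1 + ‖y‖ ≤ (1 + r) * (1 + ‖y - x₁‖) := fun y => by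
    have : ‖y‖ ≤ ‖y - x₁‖ + ‖x₁‖ := by simpa using norm_add_le (y - x₁) x₁
    nlinarith [norm_nonneg (y - x₁), mul_nonneg hr (norm_nonneg (y - x₁))]
  have hpt : ∀ y : Space, ‖commutatorDensity m ρ ε x₁ x₂ y * (((χh (ε • y) : ℝ) : ℂ) - 1)‖
      ≤ (1 + r) ^ (q + 10 + 4) * D * B * ε ^ q * ((1 + ‖y‖) ^ 4)⁻¹ := fun y => by
    have e1 : ‖((χh (ε • y) : ℝ) : ℂ) - 1‖ ≤ B * (ε ^ (q + 10) * (1 + ‖y‖) ^ (q + 10)) := by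
      rw [← Complex.ofReal_one, ← Complex.ofReal_sub, Complex.norm_real, Real.norm_eq_abs]
      refine (hB _).trans ?_
      rw [norm_smul, Real.norm_of_nonneg h0.le, mul_pow]
      gcongr
      linarith
    rw [← div_eq_mul_inv, le_div_iff₀ (by positivity), norm_mul]
    calc ‖commutatorDensity m ρ ε x₁ x₂ y‖ * ‖((χh (ε • y) : ℝ) : ℂ) - 1‖ * (1 + ‖y‖) ^ 4
        ≤ ‖commutatorDensity m ρ ε x₁ x₂ y‖ * (B * (ε ^ (q + 10) * (1 + ‖y‖) ^ (q + 10))) *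
          (1 + ‖y‖) ^ 4 := by gcongr
      _ = B * ε ^ (q + 10) * ((1 + ‖y‖) ^ (q + 10 + 4) *
          ‖commutatorDensity m ρ ε x₁ x₂ y‖) := by ring
      _ ≤ B * ε ^ (q + 10) * (((1 + r) * (1 + ‖y - x₁‖)) ^ (q + 10 + 4) *
          ‖commutatorDensity m ρ ε x₁ x₂ y‖) := by
          gcongr
          exact hy y
      _ = B * ε ^ (q + 10) * ((1 + r) ^ (q + 10 + 4) * ((1 + ‖y - x₁‖) ^ (q + 10 + 4) *
          ‖commutatorDensity m ρ ε x₁ x₂ y‖)) := by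
          rw [mul_pow, mul_assoc ((1 + r) ^ _)]
      _ ≤ B * ε ^ (q + 10) * ((1 + r) ^ (q + 10 + 4) * (D * (ε ^ 10)⁻¹)) := by
          gcongr _ * (_ * ?_)
          exact hD ε h0 h1 x₁ x₂ y
      _ = (1 + r) ^ (q + 10 + 4) * D * B * ε ^ q := by
          rw [pow_add ε]
          field_simp
  refine (norm_integral_le_of_norm_le
    (integrable_inv_one_add_norm_pow_four.const_mul _) (Eventually.of_forall hpt)).trans_eq ?_
  rw [integral_const_mul]
  ring

/-- The remainder as a damped integral. -/
theorem deltaG_sub_eq {ε : ℝ} (hm : 0 < m) (hρ : IsSuitableMollifier ρ)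
    (hχ : IsSuitableDamper χh) (hε : 0 < ε) (x₁ x₂ : Space) :
    deltaG m ρ χh ε x₁ x₂ - (((ε ^ 3)⁻¹ * autoconv ρ (ε⁻¹ • (x₁ - x₂)) : ℝ) : ℂ)
      = 2 * ∫ y, commutatorDensity m ρ ε x₁ x₂ y * (((χh (ε • y) : ℝ) : ℂ) - 1) := by
  obtain ⟨hi, he⟩ := integral_commutatorDensity hm hρ hε x₁ x₂
  have hsh : ∀ {g : Space → ℝ}, ContDiff ℝ ∞ g → ∀ x, Continuous fun y =>
      shellFn ρ ε g (y - x) := fun hg x =>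
    (continuous_shellFn hρ hε hg).comp (continuous_sub_right x)
  have hc : Continuous (commutatorDensity m ρ ε x₁ x₂) :=
    ((hsh (contDiff_energy_inv hm) x₁).mul (hsh (contDiff_energy hm) x₂)).add
      ((hsh contDiff_const x₁).mul (hsh contDiff_const x₂))
  have hi' : Integrable fun y => commutatorDensity m ρ ε x₁ x₂ y * ((χh (ε • y) : ℝ) : ℂ) :=
    (hc.mul (hχ.contDiff_scaled ε).continuous).integrable_of_hasCompactSupport
      (hχ.hasCompactSupport_scaled hε).mul_left
  rw [← he, deltaG_eq hm hρ hχ hε, ← mul_sub, ← integral_sub hi' hi]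
  congr 2 with y
  ring

end

/-! ### The commutation relations -/

section Fields

variable {m : ℝ} {ρ χh : Space → ℝ}

/-- The field operator `φ₀(ρ_ε, x)` on `𝔻`; it is set to zero for `ε ≤ 0`. -/
noncomputable def fieldPhi (hm : 0 < m) (hρ : IsSuitableMollifier ρ) (hχ : IsSuitableDamper χh)
    (ε tξ t : ℝ) (x : Space) : Module.End ℂ FiniteParticle :=
  if h : 0 < ε then fieldEnd hχ h tξ (isOneParticle_stateFn hm hρ h t x) else 0

/-- The conjugate field operator `π₀(ρ_ε, x)` on `𝔻`; it is set to zero for `ε ≤ 0`. -/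
noncomputable def fieldPi (hm : 0 < m) (hρ : IsSuitableMollifier ρ) (hχ : IsSuitableDamper χh)
    (ε tξ t : ℝ) (x : Space) : Module.End ℂ FiniteParticle :=
  if h : 0 < ε then fieldEnd hχ h tξ (isOneParticle_stateFnDot hm hρ h t x) else 0

theorem fieldPhi_of_pos (hm : 0 < m) (hρ : IsSuitableMollifier ρ) (hχ : IsSuitableDamper χh)
    {ε : ℝ} (h : 0 < ε) (tξ t : ℝ) (x : Space) : fieldPhi hm hρ hχ ε tξ t x
      = fieldEnd hχ h tξ (isOneParticle_stateFn hm hρ h t x) := dif_pos h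

theorem fieldPi_of_pos (hm : 0 < m) (hρ : IsSuitableMollifier ρ) (hχ : IsSuitableDamper χh)
    {ε : ℝ} (h : 0 < ε) (tξ t : ℝ) (x : Space) : fieldPi hm hρ hχ ε tξ t x
      = fieldEnd hχ h tξ (isOneParticle_stateFnDot hm hρ h t x) := dif_pos h

/-- The equal-time commutator of the field and its conjugate. -/
theorem fieldPhi_fieldPi_commutator (hm : 0 < m) (hρ : IsSuitableMollifier ρ)
    (hχ : IsSuitableDamper χh) {ε : ℝ} (hε : 0 < ε) (t : ℝ) (x₁ x₂ : Space) :
    fieldPhi hm hρ hχ ε t t x₁ * fieldPi hm hρ hχ ε t t x₂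
        - fieldPi hm hρ hχ ε t t x₂ * fieldPhi hm hρ hχ ε t t x₁
      = (Complex.I * deltaG m ρ χh ε x₁ x₂) • (1 : Module.End ℂ FiniteParticle) := by
  rw [fieldPhi_of_pos _ _ _ hε, fieldPi_of_pos _ _ _ hε, fieldEnd_commutator,
    dampedProduct_stateFn_stateFnDot hm hρ hε, deltaG_eq hm hρ hχ hε]

end Fields

end FreeFieldCCR

theorem mainTheorem4 (m : ℝ) (hm : 0 < m) (ρ χh : Space → ℝ)
    (hρ : IsSuitableMollifier ρ) (hχ : IsSuitableDamper χh) :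
    ∃ φ π : ℝ → ℝ → ℝ → Space → Module.End ℂ FiniteParticle,
      -- `φ ε tξ t x` and `π ε tξ t x` are the field operators on `𝔻`, and `π = ∂ₜ φ`
      (∀ ε > 0, ∀ (tξ t : ℝ) (x : Space) (Φ : FiniteParticle),
        (φ ε tξ t x Φ : FockSeq) = freeField m ρ χh ε tξ t x Φ ∧
        (π ε tξ t x Φ : FockSeq) = conjField m ρ χh ε tξ t x Φ ∧
        ∀ (n : ℕ) (ξ : Fin n → Spacetime),
          HasDerivAt (fun s : ℝ => (φ ε tξ s x Φ : FockSeq) n ξ)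
            ((π ε tξ t x Φ : FockSeq) n ξ) t) ∧
      -- (A) exact equal-time commutation relations
      (∀ ε > 0, ∀ (t : ℝ) (x₁ x₂ : Space),
        φ ε t t x₁ * φ ε t t x₂ - φ ε t t x₂ * φ ε t t x₁ = 0 ∧
        π ε t t x₁ * π ε t t x₂ - π ε t t x₂ * π ε t t x₁ = 0 ∧
        φ ε t t x₁ * π ε t t x₂ - π ε t t x₂ * φ ε t t x₁
          = (Complex.I * deltaG m ρ χh ε x₁ x₂) • (1 : Module.End ℂ FiniteParticle) ∧
        (deltaG m ρ χh ε x₁ x₂).im = 0) ∧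
      -- (B) the reduced form, with a remainder of every order, locally uniformly
      IsSuitableMollifier (autoconv ρ) ∧
      ∃ R : ℝ → Space → Space → ℝ,
        (∀ ε > 0, ∀ (t : ℝ) (x₁ x₂ : Space),
          deltaG m ρ χh ε x₁ x₂
            = (((ε ^ 3)⁻¹ * autoconv ρ (ε⁻¹ • (x₁ - x₂)) + R ε x₁ x₂ : ℝ) : ℂ) ∧
          φ ε t t x₁ * π ε t t x₂ - π ε t t x₂ * φ ε t t x₁
            = (Complex.I *
                (((ε ^ 3)⁻¹ * autoconv ρ (ε⁻¹ • (x₁ - x₂)) + R ε x₁ x₂ : ℝ) : ℂ)) •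
              (1 : Module.End ℂ FiniteParticle)) ∧
        ∀ (q : ℕ) (K : Set Space), IsCompact K →
          ∃ C > 0, ∃ η > 0, ∀ ε : ℝ, 0 < ε → ε < η → ∀ x₁ ∈ K, ∀ x₂ ∈ K,
            |R ε x₁ x₂| ≤ C * ε ^ ((q : ℤ) - 1) := by
  -- the remainder is the difference of the real parts; nothing is lost as `deltaG` is real
  have hsplit : ∀ ε > 0, ∀ x₁ x₂, deltaG m ρ χh ε x₁ x₂
      = (((ε ^ 3)⁻¹ * autoconv ρ (ε⁻¹ • (x₁ - x₂)) + ((deltaG m ρ χh ε x₁ x₂).re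
        - (ε ^ 3)⁻¹ * autoconv ρ (ε⁻¹ • (x₁ - x₂))) : ℝ) : ℂ) := fun ε hε x₁ x₂ => by
    rw [add_sub_cancel]
    exact Complex.ext rfl (deltaG_im hm hρ hχ hε x₁ x₂)
  refine ⟨fieldPhi hm hρ hχ, fieldPi hm hρ hχ, fun ε hε tξ t x Φ => ⟨?_, ?_, fun n ξ => ?_⟩,
    fun ε hε t x₁ x₂ => ⟨?_, ?_, fieldPhi_fieldPi_commutator hm hρ hχ hε t x₁ x₂,
      deltaG_im hm hρ hχ hε x₁ x₂⟩, hρ.autoconv,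
    fun ε x₁ x₂ => (deltaG m ρ χh ε x₁ x₂).re - (ε ^ 3)⁻¹ * autoconv ρ (ε⁻¹ • (x₁ - x₂)),
    fun ε hε t x₁ x₂ => ⟨hsplit ε hε x₁ x₂, ?_⟩, fun q K hK => ?_⟩
  · rw [fieldPhi_of_pos _ _ _ hε]
    rfl
  · rw [fieldPi_of_pos _ _ _ hε]
    rfl
  · simp_rw [fieldPhi_of_pos _ _ _ hε, fieldPi_of_pos _ _ _ hε]
    exact hasDerivAt_fieldOp hχ hm hρ hε tξ t x Φ.2.2 n ξ
  · rw [fieldPhi_of_pos _ _ _ hε, fieldPhi_of_pos _ _ _ hε, fieldEnd_commutator,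
      dampedProduct_stateFn_symm hm hρ hε, sub_self, zero_smul]
  · rw [fieldPi_of_pos _ _ _ hε, fieldPi_of_pos _ _ _ hε, fieldEnd_commutator,
      dampedProduct_stateFnDot_symm hm hρ hε, sub_self, zero_smul]
  · rw [← hsplit ε hε x₁ x₂]
    exact fieldPhi_fieldPi_commutator hm hρ hχ hε t x₁ x₂
  · obtain ⟨r, hr⟩ := hK.isBounded.exists_norm_le
    obtain ⟨C, hC0, hC⟩ := exists_remainder_bound hm hρ hχ q (max r 0) (le_max_right _ _)
    -- adding one makes the constant positive
    refine ⟨2 * C + 1, by positivity, 1, one_pos, fun ε h0 h1 x₁ hx₁ x₂ _ => ?_⟩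
    have hR : (deltaG m ρ χh ε x₁ x₂).re - (ε ^ 3)⁻¹ * autoconv ρ (ε⁻¹ • (x₁ - x₂))
        = (deltaG m ρ χh ε x₁ x₂
          - (((ε ^ 3)⁻¹ * autoconv ρ (ε⁻¹ • (x₁ - x₂)) : ℝ) : ℂ)).re := by
      rw [Complex.sub_re, Complex.ofReal_re]
    beta_reduce
    rw [hR, deltaG_sub_eq hm hρ hχ h0]
    refine (Complex.abs_re_le_norm _).trans ?_
    rw [norm_mul, Complex.norm_ofNat]
    have hpow : ε ^ q ≤ ε ^ ((q : ℤ) - 1) := by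
      rw [← zpow_natCast]
      exact zpow_le_zpow_right_of_le_one₀ h0 h1.le (by lia)
    calc 2 * ‖∫ y, commutatorDensity m ρ ε x₁ x₂ y * (((χh (ε • y) : ℝ) : ℂ) - 1)‖
        ≤ 2 * (C * ε ^ q) := by
          gcongr
          exact hC ε h0 h1.le x₁ x₂ ((hr x₁ hx₁).trans (le_max_left _ _))
      _ ≤ 2 * (C * ε ^ ((q : ℤ) - 1)) := by gcongr
      _ ≤ (2 * C + 1) * ε ^ ((q : ℤ) - 1) := by
          have := zpow_pos h0 ((q : ℤ) - 1)
          linarith
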